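/- Let $m\ge 1$, let $\mathcal H_m$ be the Siegel upper half space of complex symmetric $(m,m)$-matrices $Z=X+iY$ with $Y>0$, and let $\Gamma\subset \mathrm{Sp}_m(\mathbb Z)$ be a subgroup containing all translations $Z\mapsto Z+S$ with $S$ integral symmetric. Let $k$ be an integer with $k\ge m$, put $\kappa=k+2$, and let $h\in[\Gamma,k]_0$ be a holomorphic Siegel cusp form of scalar weight $k$: $h$ is holomorphic on $\mathcal H_m$, $h(\gamma Z)=\det(cZ+d)^k h(Z)$ for $\gamma=\begin{pmatrix}a&b\\c&d\end{pmatrix}\in\Gamma$, and for all $\gamma\in \mathrm{Sp}_m(\mathbb Z)$ and $N\ge 1$ such that $\gamma^{-1}\Gamma\gamma$ contains the translations by $NS$ ($S$ integral symmetric), the function $(h|\gamma)(Z)=\det(cZ+d)^{-k}h(\gamma Z)$ has an absolutely convergent expansion $\sum_{T>0}b_\gamma(T)\exp(2\pi i\,\mathrm{tr}(TZ)/N)$ on $\mathcal H_m$. Here and below $T$ runs over the positive definite half-integral symmetric matrices ($t_{ii}\in\mathbb Z$, $2t_{ij}\in\mathbb Z$). Let $$\Delta_+^{[m]}(h)(Z)=(2i)^m\det(Y)^{-(k+\frac{1-m}{2})}\det(\partial_Z)\Bigl(\det(Y)^{k+\frac{1-m}{2}}h(Z)\Bigr),$$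 where $\partial_Z=\frac12(\partial_X-i\partial_Y)$ and $(\partial_X)_{\mu\nu}=\frac12(1+\delta_{\mu\nu})\frac{\partial}{\partial x_{\mu\nu}}$, likewise for $\partial_Y$. Then $\Delta_+^{[m]}(h)$ is annihilated by Sturm's operator of weight $\kappa=k+2$. That is, $\Delta_+^{[m]}(h)$ has an absolutely convergent Fourier expansion $$\Delta_+^{[m]}(h)(Z)=\sum_{T>0}A(T,Y)\exp(2\pi i\,\mathrm{tr}(TX)),\qquad A(T,Y)=\int_{X\bmod 1}\Delta_+^{[m]}(h)(X+iY)\exp(-2\pi i\,\mathrm{tr}(TX))\,dX,$$ and, for every $T>0$, with $dY_{inv}=\det(Y)^{-\frac{m+1}{2}}\prod_{i\le j}dY_{ij}$, $c(m,\kappa)=(4\pi)^{-m(\kappa-\frac{m+1}{2})}\Gamma_m(\kappa-\frac{m+1}{2})$, $\Gamma_m(z)=\pi^{\frac{m(m-1)}{4}}\prod_{\nu=0}^{m-1}\Gamma(z-\frac{\nu}{2})$, the integral $$a(T,s)=c(m,\kappa)^{-1}\int_{Y>0}A(T,Y)\exp(-2\pi\,\mathrm{tr}(TY))\det(TY)^{\kappa-\frac{m+1}{2}+s}\,dY_{inv}$$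 converges absolutely for all complex $s$ in a neighbourhood of $0$, and Sturm's coefficient vanishes: $$a(T)=a(T,0)=0\qquad\text{and}\qquad \lim_{s\to0}a(T,s)=0 .$$ -/

import Mathlib

open Filter Topology MeasureTheory Matrix

namespace SiegelSturm

noncomputable section

/-- Index set `{(i, j) : i ≤ j}` of the independent coordinates of a symmetric `m × m` matrix. -/
abbrev SymIdx (m : ℕ) : Type := {p : Fin m × Fin m // p.1 ≤ p.2}

/-- The symmetric matrix with prescribed entries on and above the diagonal. -/
def symOf {m : ℕ} {R : Type*} (x : SymIdx m → R) : Matrix (Fin m) (Fin m) R :=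
  Matrix.of fun i j => if h : i ≤ j then x ⟨(i, j), h⟩ else x ⟨(j, i), (not_le.mp h).le⟩

/-- Real part `X` of `Z = X + iY` (entrywise). -/
def rePart {m : ℕ} (Z : Matrix (Fin m) (Fin m) ℂ) : Matrix (Fin m) (Fin m) ℝ := Z.map Complex.re

/-- Imaginary part `Y` of `Z = X + iY` (entrywise). -/
def imPart {m : ℕ} (Z : Matrix (Fin m) (Fin m) ℂ) : Matrix (Fin m) (Fin m) ℝ := Z.map Complex.im

/-- The complex matrix `X + iY`. -/
def mkZ {m : ℕ} (X Y : Matrix (Fin m) (Fin m) ℝ) : Matrix (Fin m) (Fin m) ℂ :=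
  X.map Complex.ofReal + Complex.I • Y.map Complex.ofReal

/-- The Siegel upper half space `ℋ_m`: complex symmetric matrices with positive definite
imaginary part. -/
def siegelUpperHalfSpace (m : ℕ) : Set (Matrix (Fin m) (Fin m) ℂ) :=
  {Z | Z.IsSymm ∧ (imPart Z).PosDef}

/-- `e(A) = exp(2πi tr A)`. -/
def expTr {m : ℕ} (A : Matrix (Fin m) (Fin m) ℂ) : ℂ :=
  Complex.exp (2 * Real.pi * Complex.I * A.trace)

/-! ### The symplectic group and its action -/

/-- `Sp_m(ℤ)`, of size `2m`. -/
abbrev SpZ (m : ℕ) : Type := Matrix.symplecticGroup (Fin m) ℤ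

/-- The translation matrix with blocks `1, S, 0, 1`, for an integral symmetric matrix `S`. -/
def translation {m : ℕ} (S : Matrix (Fin m) (Fin m) ℤ) (hS : S.IsSymm) : SpZ m :=
  ⟨Matrix.fromBlocks 1 S 0 1, by
    rw [SymplecticGroup.fromBlocks_mem_iff]
    refine ⟨by simp, ?_, by simp⟩
    simpa using hS.eq⟩

/-- The lower denominator `cZ + d`, where `γ` has blocks `a, b, c, d`. -/
def denom {m : ℕ} (γ : SpZ m) (Z : Matrix (Fin m) (Fin m) ℂ) : Matrix (Fin m) (Fin m) ℂ :=
  γ.1.toBlocks₂₁.map (Int.cast : ℤ → ℂ) * Z + γ.1.toBlocks₂₂.map (Int.cast : ℤ → ℂ)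

/-- The action `γZ = (aZ + b)(cZ + d)⁻¹`. -/
def moeb {m : ℕ} (γ : SpZ m) (Z : Matrix (Fin m) (Fin m) ℂ) : Matrix (Fin m) (Fin m) ℂ :=
  (γ.1.toBlocks₁₁.map (Int.cast : ℤ → ℂ) * Z + γ.1.toBlocks₁₂.map (Int.cast : ℤ → ℂ)) *
    (denom γ Z)⁻¹

/-- The slash operator of weight `k`: `(h|γ)(Z) = det(cZ + d)^(-k) h(γZ)`. -/
def slash {m : ℕ} (k : ℤ) (γ : SpZ m) (h : Matrix (Fin m) (Fin m) ℂ → ℂ)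
    (Z : Matrix (Fin m) (Fin m) ℂ) : ℂ :=
  (denom γ Z).det ^ (-k) * h (moeb γ Z)

/-- `Γ` contains the group `Γ_∞` of all integral translations `Z ↦ Z + S`. -/
def ContainsTranslations {m : ℕ} (Γ : Subgroup (SpZ m)) : Prop :=
  ∀ (S : Matrix (Fin m) (Fin m) ℤ) (hS : S.IsSymm), translation S hS ∈ Γ

/-! ### Holomorphic Siegel cusp forms -/

/-- Half-integral symmetric matrices: integral diagonal, off-diagonal entries in `½ℤ`. -/
def IsHalfIntegral {m : ℕ} (T : Matrix (Fin m) (Fin m) ℝ) : Prop :=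
  T.IsSymm ∧ (∀ i, ∃ n : ℤ, T i i = n) ∧ ∀ i j, ∃ n : ℤ, 2 * T i j = n

/-- The index set of the Fourier expansions: positive definite half-integral matrices. -/
abbrev PosHalfInt (m : ℕ) : Type :=
  {T : Matrix (Fin m) (Fin m) ℝ // T.PosDef ∧ IsHalfIntegral T}

/-- `h ∈ [Γ, k]_0`: `h` is a holomorphic Siegel cusp form of weight `k` for `Γ ⊆ Sp_m(ℤ)`.
Only the values of `h` on the Siegel upper half space matter. The cusp condition says that
at every cusp (represented by `γ ∈ Sp_m(ℤ)`), of a width dividing `N`, the form `h|γ`, which is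
invariant under the translations `Z ↦ Z + N S`, has a Fourier expansion over positive definite
matrices `T / N`. -/
structure IsCuspForm {m : ℕ} (Γ : Subgroup (SpZ m)) (k : ℤ)
    (h : Matrix (Fin m) (Fin m) ℂ → ℂ) : Prop where
  /-- `h` is holomorphic in the coordinates `z_{ij}`, `i ≤ j`. -/
  holo : DifferentiableOn ℂ (fun z : SymIdx m → ℂ => h (symOf z))
    {z | symOf z ∈ siegelUpperHalfSpace m}
  /-- `h(γZ) = det(cZ + d)^k h(Z)` for all `γ ∈ Γ`. -/
  modular : ∀ γ ∈ Γ, ∀ Z ∈ siegelUpperHalfSpace m, h (moeb γ Z) = (denom γ Z).det ^ k * h Z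
  /-- `h` is cuspidal at every cusp. -/
  cuspidal : ∀ (γ : SpZ m) (N : ℕ), 0 < N →
    (∀ (S : Matrix (Fin m) (Fin m) ℤ) (hS : S.IsSymm),
      γ * translation ((N : ℤ) • S) (hS.smul _) * γ⁻¹ ∈ Γ) →
    ∃ b : PosHalfInt m → ℂ, ∀ Z ∈ siegelUpperHalfSpace m,
      HasSum (fun T : PosHalfInt m =>
        b T * expTr ((N : ℂ)⁻¹ • (T.1.map Complex.ofReal * Z))) (slash k γ h Z)

/-! ### The Maass shift operator -/

/-- The symmetric direction `(E_{μν} + E_{νμ}) / 2`. -/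
def symDir {m : ℕ} (μ ν : Fin m) : Matrix (Fin m) (Fin m) ℂ :=
  (1 / 2 : ℂ) • (Matrix.single μ ν 1 + Matrix.single ν μ 1)

/-- The entry `(∂_Z)_{μν}` of `∂_Z = ½ (∂_X - i ∂_Y)`, where
`(∂_X)_{μν} = ½ (1 + δ_{μν}) ∂/∂x_{μν}` is the real directional derivative along
`(E_{μν} + E_{νμ}) / 2`, and likewise for `∂_Y`. -/
def dZ {m : ℕ} (μ ν : Fin m) (F : Matrix (Fin m) (Fin m) ℂ → ℂ)
    (Z : Matrix (Fin m) (Fin m) ℂ) : ℂ :=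
  (1 / 2 : ℂ) * (lineDeriv ℝ F Z (symDir μ ν) -
    Complex.I * lineDeriv ℝ F Z (Complex.I • symDir μ ν))

/-- The composition of the operators `(∂_Z)_{σ(i), i}` for `i = 0, …, m - 1`. -/
def dZPerm {m : ℕ} (σ : Equiv.Perm (Fin m)) (F : Matrix (Fin m) (Fin m) ℂ → ℂ) :
    Matrix (Fin m) (Fin m) ℂ → ℂ :=
  (List.finRange m).foldr (fun i G => dZ (σ i) i G) F

/-- The differential operator `det(∂_Z)`, expanded by the Leibniz formula. -/
def detDZ {m : ℕ} (F : Matrix (Fin m) (Fin m) ℂ → ℂ) (Z : Matrix (Fin m) (Fin m) ℂ) : ℂ :=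
  ∑ σ : Equiv.Perm (Fin m), ((Equiv.Perm.sign σ : ℤ) : ℂ) * dZPerm σ F Z

/-- The power `det(Y)^(k + (1 - m)/2)` for `Z = X + iY`. -/
def detImPow {m : ℕ} (k : ℤ) (Z : Matrix (Fin m) (Fin m) ℂ) : ℝ :=
  (imPart Z).det ^ ((k : ℝ) + (1 - (m : ℝ)) / 2)

/-- The Maass operator `Δ_+^{[m]}` on functions of scalar weight `k`:
`(2i)^m det(Y)^(-(k + (1-m)/2)) det(∂_Z) (det(Y)^(k + (1-m)/2) h(Z))`. -/
def maassShift {m : ℕ} (k : ℤ) (h : Matrix (Fin m) (Fin m) ℂ → ℂ)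
    (Z : Matrix (Fin m) (Fin m) ℂ) : ℂ :=
  (2 * Complex.I) ^ m * ((detImPow k Z)⁻¹ : ℝ) *
    detDZ (fun W => (detImPow k W : ℂ) * h W) Z

/-! ### Sturm's operator -/

/-- The Fourier coefficient `A(T, Y)` of `F`, that is
`∫ F(X + iY) exp(-2πi tr(TX)) dX` over all symmetric `X` with entries modulo `1`. -/
def fourierCoeff {m : ℕ} (F : Matrix (Fin m) (Fin m) ℂ → ℂ) (T Y : Matrix (Fin m) (Fin m) ℝ) : ℂ :=
  ∫ x in Set.Icc (0 : SymIdx m → ℝ) 1,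
    F (mkZ (symOf x) Y) * expTr (-(T * symOf x).map Complex.ofReal)

/-- `Γ_m(s) = π^(m(m-1)/4) ∏_{ν < m} Γ(s - ν/2)`. -/
def siegelGamma (m : ℕ) (s : ℝ) : ℝ :=
  Real.pi ^ ((m : ℝ) * ((m : ℝ) - 1) / 4) * ∏ ν ∈ Finset.range m, Real.Gamma (s - (ν : ℝ) / 2)

/-- `c(m, κ) = (4π)^(-m(κ - (m+1)/2)) Γ_m(κ - (m+1)/2)`. -/
def sturmConst (m : ℕ) (κ : ℤ) : ℝ :=
  (4 * Real.pi) ^ (-((m : ℝ) * ((κ : ℝ) - ((m : ℝ) + 1) / 2))) *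
    siegelGamma m ((κ : ℝ) - ((m : ℝ) + 1) / 2)

/-- The cone `Y > 0` in the coordinates `y_{ij}`, `i ≤ j`. -/
def posCone (m : ℕ) : Set (SymIdx m → ℝ) := {y | (symOf y).PosDef}

/-- The integrand of Sturm's operator with complex parameter `s`, as a function of the coordinates
`y_{ij}`, `i ≤ j`; the last factor is the density of the invariant measure
`dY_inv = det(Y)^(-(m+1)/2) ∏ dy_{ij}`. -/
def sturmIntegrand {m : ℕ} (κ : ℤ) (F : Matrix (Fin m) (Fin m) ℂ → ℂ)
    (T : Matrix (Fin m) (Fin m) ℝ) (s : ℂ) (y : SymIdx m → ℝ) : ℂ :=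
  fourierCoeff F T (symOf y) * (Real.exp (-2 * Real.pi * (T * symOf y).trace) : ℂ) *
    ((T * symOf y).det : ℂ) ^ ((κ : ℂ) - ((m : ℂ) + 1) / 2 + s) *
    (((symOf y).det ^ (-(((m : ℝ) + 1) / 2)) : ℝ) : ℂ)

/-- The coefficient `c(m, κ)⁻¹ ∫_{Y > 0} A(T,Y) exp(-2π tr(TY)) det(TY)^(κ - (m+1)/2 + s) dY_inv`. -/
def sturmCoeffAt {m : ℕ} (κ : ℤ) (F : Matrix (Fin m) (Fin m) ℂ → ℂ)
    (T : Matrix (Fin m) (Fin m) ℝ) (s : ℂ) : ℂ :=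
  ((sturmConst m κ)⁻¹ : ℝ) * ∫ y in posCone m, sturmIntegrand κ F T s y

/-- Sturm's operator of weight `κ`: the coefficient `a(T)` attached to `F`. -/
def sturmCoeff {m : ℕ} (κ : ℤ) (F : Matrix (Fin m) (Fin m) ℂ → ℂ)
    (T : Matrix (Fin m) (Fin m) ℝ) : ℂ :=
  sturmCoeffAt κ F T 0

end

end SiegelSturm

/-! Put `α = k + (1-m)/2` and expand `h = ∑ b(T) exp(2πi tr(TZ))`. Each term `det(Y)^α exp(2πi
tr(TZ))` equals `exp(2πi tr(T Z̄))` times a function of `Y` alone, namely `det(Y)^α exp(-4π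
tr(TY))`. Since `∂_Z` kills the antiholomorphic factor and acts on functions of `Y` as `-(i/2) ∂_Y`,
the Fourier coefficient of the shifted form is `b(T) det(Y)^(-α) exp(2π tr(TY)) det(∂_Y)(det(Y)^α
exp(-4π tr(TY)))` (`hasSum_maassShift`, `fourierCoeff_maassShift`).

In Sturm's integral the exponentials outside `det(∂_Y)` cancel and the powers of `det(Y)` collect to
`(1-m)/2 + s`. What remains, up to factors free of `Y`, is the integral of `det(∂_Y)(det(Y)^α
exp(-4π tr(TY)))` against `det(Y)^((1-m)/2 + s)` over the cone.

Formally, integration by parts moves `det(∂_Y)` onto the power, and Cayley's identity `det(∂_Y)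
det(Y)^s = c(s) det(Y)^(s-1)` finishes, because `c((1-m)/2) = 0`. The parts formula is proved only
for large exponents, where boundary terms vanish (`integral_detD_mul_detExp`). The identity theorem
in the exponent carries it down to `(1-m)/2` (`coneMellin_detD_eq_zero`).

Three facts make this work. Covariance of `det(∂_Y)` under `Y ↦ g Y gᵀ` gives Cayley's identity with
an unspecified constant, and it shows that `det(∂_Y)` lowers the boundary exponent by `1` only, not
by `m` (`detD_detExp_eq`). Powers `det(Y)^β` with exponential decay are integrable over the cone
when `mβ > -1` (`integrableOn_dt_rpow`); here `β = k - m ≥ 0` at `s = 0`. Finally `c((1-m)/2) = 0`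
follows because `det(Y)^(-(m-1)/2)` is a Gaussian integral over `m - 1` vectors, and `det(∂_Y)`
under the integral produces the determinant of a Gram matrix of rank below `m`
(`cayleyConst_eq_zero`). -/

namespace SiegelSturm

noncomputable section

/-! ### Iterated first order differential operators -/

section Calculus

variable {E : Type*} [NormedAddCommGroup E] [NormedSpace ℝ E]

/-- A complex linear combination `c₁ ∂_{v₁} + c₂ ∂_{v₂}` of two directional derivatives. -/
abbrev FirstOrder (E : Type*) : Type _ := (ℂ × E) × (ℂ × E)

/-- The action of a first order operator with constant coefficients. -/
def cD (p : FirstOrder E) (f : E → ℂ) (x : E) : ℂ :=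
  p.1.1 * lineDeriv ℝ f x p.1.2 + p.2.1 * lineDeriv ℝ f x p.2.2

/-- Composition of the first order operators of a list. -/
def cDL (l : List (FirstOrder E)) (f : E → ℂ) : E → ℂ := l.foldr cD f

@[simp] lemma cDL_nil (f : E → ℂ) : cDL [] f = f := rfl

@[simp] lemma cDL_cons (p : FirstOrder E) (l : List (FirstOrder E)) (f : E → ℂ) :
    cDL (p :: l) f = cD p (cDL l f) := rfl

lemma cDL_append (l l' : List (FirstOrder E)) (f : E → ℂ) :
    cDL (l ++ l') f = cDL l (cDL l' f) := by
  simp [cDL, List.foldr_append]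

/-- All iterated directional derivatives of `f` exist on `U`. -/
def IterDiffOn (f : E → ℂ) (U : Set E) : Prop :=
  ∀ l : List (FirstOrder E), ∀ x ∈ U, ∀ v, LineDifferentiableAt ℝ (cDL l f) x v

lemma HasLineDerivAt.cD_eq {f : E → ℂ} {x : E} {p : FirstOrder E} {a b : ℂ}
    (h₁ : HasLineDerivAt ℝ f a x p.1.2) (h₂ : HasLineDerivAt ℝ f b x p.2.2) :
    cD p f x = p.1.1 * a + p.2.1 * b := by
  rw [cD, h₁.lineDeriv, h₂.lineDeriv]

lemma cD_congr {U : Set E} (hU : IsOpen U) {f g : E → ℂ} (h : Set.EqOn f g U)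
    (p : FirstOrder E) : Set.EqOn (cD p f) (cD p g) U := by
  intro x hx
  have : f =ᶠ[𝓝 x] g := h.eventuallyEq_of_mem (hU.mem_nhds hx)
  simp only [cD, this.lineDeriv_eq]

lemma cDL_congr {U : Set E} (hU : IsOpen U) {f g : E → ℂ} (h : Set.EqOn f g U)
    (l : List (FirstOrder E)) : Set.EqOn (cDL l f) (cDL l g) U := by
  induction l with
  | nil => exact h
  | cons p l ih => exact cD_congr hU ih p

lemma ContDiffOn.cD_eqOn {U : Set E} (hU : IsOpen U) {f : E → ℂ} {n : WithTop ℕ∞} (hn : n ≠ 0)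
    (hf : ContDiffOn ℝ n f U) (p : FirstOrder E) :
    Set.EqOn (cD p f) (fun x => p.1.1 * fderiv ℝ f x p.1.2 + p.2.1 * fderiv ℝ f x p.2.2) U := by
  intro x hx
  have := (hf.differentiableOn hn).differentiableAt (hU.mem_nhds hx)
  simp only [cD, this.lineDeriv_eq_fderiv]

lemma ContDiffOn.cD {U : Set E} (hU : IsOpen U) {f : E → ℂ}
    (hf : ContDiffOn ℝ (⊤ : ℕ∞) f U) (p : FirstOrder E) :
    ContDiffOn ℝ (⊤ : ℕ∞) (cD p f) U := by
  have h1 : ContDiffOn ℝ (⊤ : ℕ∞) (fun x => fderiv ℝ f x) U :=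
    hf.fderiv_of_isOpen hU (by simp)
  refine ContDiffOn.congr ?_ (ContDiffOn.cD_eqOn hU (by simp) hf p)
  exact (contDiffOn_const.mul (h1.clm_apply contDiffOn_const)).add
    (contDiffOn_const.mul (h1.clm_apply contDiffOn_const))

lemma ContDiffOn.cDL {U : Set E} (hU : IsOpen U) {f : E → ℂ}
    (hf : ContDiffOn ℝ (⊤ : ℕ∞) f U) (l : List (FirstOrder E)) :
    ContDiffOn ℝ (⊤ : ℕ∞) (cDL l f) U := by
  induction l with
  | nil => exact hf
  | cons p l ih => exact ContDiffOn.cD hU ih p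

lemma ContDiffOn.iterDiffOn {U : Set E} (hU : IsOpen U) {f : E → ℂ}
    (hf : ContDiffOn ℝ (⊤ : ℕ∞) f U) : IterDiffOn f U := fun l _ hx _ =>
  (((ContDiffOn.cDL hU hf l).differentiableOn (by simp)).differentiableAt
    (hU.mem_nhds hx)).lineDifferentiableAt

lemma HasLineDerivAt.mul' {f g : E → ℂ} {a b : ℂ} {x v : E} (hf : HasLineDerivAt ℝ f a x v)
    (hg : HasLineDerivAt ℝ g b x v) :
    HasLineDerivAt ℝ (fun y => f y * g y) (a * g x + f x * b) x v := by
  have := HasDerivAt.fun_mul hf hg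
  simpa [HasLineDerivAt] using this

lemma hasLineDerivAt_list_sum {ι : Type*} (L : List ι) {F : ι → E → ℂ} {F' : ι → ℂ} {x v : E}
    (h : ∀ q, HasLineDerivAt ℝ (F q) (F' q) x v) :
    HasLineDerivAt ℝ (fun y => (L.map fun q => F q y).sum) (L.map F').sum x v := by
  induction L with
  | nil => simpa [HasLineDerivAt] using hasDerivAt_const (0 : ℝ) (0 : ℂ)
  | cons q L ih => simpa [HasLineDerivAt] using HasDerivAt.fun_add (h q) ih

/-- All ways to split a list into a sublist and its complement. -/
def splits {α : Type*} : List α → List (List α × List α)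
  | [] => [([], [])]
  | a :: l => (splits l).map (fun q => (a :: q.1, q.2)) ++ (splits l).map fun q => (q.1, a :: q.2)

/-- The Leibniz rule for a composition of first order operators. -/
theorem cDL_mul {U : Set E} (hU : IsOpen U) {f g : E → ℂ} (hf : IterDiffOn f U)
    (hg : IterDiffOn g U) (l : List (FirstOrder E)) :
    Set.EqOn (cDL l fun y => f y * g y)
      (fun x => ((splits l).map fun q => cDL q.1 f x * cDL q.2 g x).sum) U := by
  induction l with
  | nil => intro x _; simp [splits]
  | cons p l ih =>
    intro x hx
    rw [cDL_cons, cD_congr hU ih p hx]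
    have key := fun v => hasLineDerivAt_list_sum (splits l)
      (fun q : List (FirstOrder E) × List (FirstOrder E) =>
        HasLineDerivAt.mul' (hf q.1 x hx v).hasLineDerivAt (hg q.2 x hx v).hasLineDerivAt)
    rw [HasLineDerivAt.cD_eq (key _) (key _), ← List.sum_map_mul_left, ← List.sum_map_mul_left,
      ← List.sum_map_add, splits]
    beta_reduce
    rw [List.map_append, List.sum_append, List.map_map, List.map_map,
      ← List.sum_map_add]
    congr 1
    refine List.map_congr_left fun q _ => ?_
    simp only [Function.comp, cDL_cons, cD]
    ring

/-- The symbol of a first order operator. -/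
def symb (L : E →L[ℝ] ℂ) (p : FirstOrder E) : ℂ := p.1.1 * L p.1.2 + p.2.1 * L p.2.2

lemma hasLineDerivAt_cexp (L : E →L[ℝ] ℂ) (x v : E) :
    HasLineDerivAt ℝ (fun y => Complex.exp (L y)) (L v * Complex.exp (L x)) x v := by
  have := (L.hasFDerivAt (x := x)).cexp.hasLineDerivAt v
  simpa [mul_comm] using this

lemma cDL_cexp (L : E →L[ℝ] ℂ) (l : List (FirstOrder E)) :
    cDL l (fun y => Complex.exp (L y)) =
      fun y => (l.map (symb L)).prod * Complex.exp (L y) := by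
  induction l with
  | nil => simp
  | cons p l ih =>
    funext x
    rw [cDL_cons, ih]
    have key : ∀ v, HasLineDerivAt ℝ (fun y => (l.map (symb L)).prod * Complex.exp (L y))
        ((l.map (symb L)).prod * (L v * Complex.exp (L x))) x v := fun v =>
      HasDerivAt.const_mul _ (hasLineDerivAt_cexp L x v)
    rw [HasLineDerivAt.cD_eq (key _) (key _)]
    simp only [List.map_cons, List.prod_cons, symb]
    ring

/-! ### Differentiation of Laplace transforms -/

section Laplace

variable {Ω : Type*} [MeasurableSpace Ω] {μ : Measure Ω} {U : Set E} {L : Ω → E →L[ℝ] ℂ}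

/-- Locally uniform domination of the exponents of a Laplace transform. -/
def LaplaceDominated (U : Set E) (L : Ω → E →L[ℝ] ℂ) : Prop :=
  ∀ z ∈ U, ∃ δ : ℝ, 0 < δ ∧ ∃ z' ∈ U, ∀ ω w, ‖w‖ ≤ δ →
    (L ω (z + w)).re + δ * ‖L ω‖ ≤ (L ω z').re

theorem hasLineDerivAt_laplace (hL : ∀ v, Measurable fun ω => L ω v)
    (hdom : LaplaceDominated U L) {b : Ω → ℂ} (hb : Measurable b)
    (hint : ∀ z ∈ U, Integrable (fun ω => b ω * Complex.exp (L ω z)) μ) (v : E) {z : E}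
    (hz : z ∈ U) :
    Integrable (fun ω => b ω * L ω v * Complex.exp (L ω z)) μ ∧
    HasLineDerivAt ℝ (fun y => ∫ ω, b ω * Complex.exp (L ω y) ∂μ)
      (∫ ω, b ω * L ω v * Complex.exp (L ω z) ∂μ) z v := by
  -- The slack `δ * ‖L ω‖` in the exponent pays for the factor `L ω v` brought down by
  -- differentiation, since `x ≤ exp x`. The integrand at `z'` therefore dominates all derivatives
  -- near `z`, up to the constant `‖v‖ / δ`.
  obtain ⟨δ, hδ, z', hz', hd⟩ := hdom z hz
  have hε : 0 < δ / (‖v‖ + 1) := by positivity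
  have hmeas : ∀ y, Measurable fun ω => b ω * Complex.exp (L ω y) := fun y =>
    hb.mul (Complex.measurable_exp.comp (hL y))
  have hpt : ∀ (ω : Ω) (t : ℝ), HasDerivAt (fun t : ℝ => b ω * Complex.exp (L ω (z + t • v)))
      (b ω * L ω v * Complex.exp (L ω (z + t • v))) t := by
    intro ω t
    have h1 : HasDerivAt (fun t : ℝ => L ω (z + t • v)) (L ω v) t := by
      have h2 : HasDerivAt (fun t : ℝ => z + t • v) v t := by
        simpa using ((hasDerivAt_id t).smul_const v).const_add z
      exact (L ω).hasFDerivAt.comp_hasDerivAt t h2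
    have := (h1.cexp).const_mul (b ω)
    exact this.congr_deriv (by ring)
  have key := hasDerivAt_integral_of_dominated_loc_of_deriv_le (μ := μ) (𝕜 := ℝ)
    (F := fun t ω => b ω * Complex.exp (L ω (z + t • v)))
    (F' := fun t ω => b ω * L ω v * Complex.exp (L ω (z + t • v)))
    (x₀ := 0) (s := Metric.ball 0 (δ / (‖v‖ + 1)))
    (bound := fun ω => ‖b ω * Complex.exp (L ω z')‖ * (‖v‖ / δ))
    (Metric.ball_mem_nhds _ hε)
    (Eventually.of_forall fun t => (hmeas _).aestronglyMeasurable)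
    (by simpa using hint z hz)
    ((hb.mul (hL v)).mul (Complex.measurable_exp.comp (hL _))).aestronglyMeasurable
    (Eventually.of_forall fun ω t ht => ?_)
    ((hint z' hz').norm.mul_const _)
    (Eventually.of_forall fun ω t _ => hpt ω t)
  · simpa [HasLineDerivAt] using key
  · have ht' : ‖t • v‖ ≤ δ := by
      rw [mem_ball_zero_iff, lt_div_iff₀ (by positivity)] at ht
      rw [norm_smul]
      nlinarith [norm_nonneg t, norm_nonneg v]
    have h1 := hd ω _ ht'
    have h2 : ‖L ω v‖ ≤ ‖L ω‖ * ‖v‖ := (L ω).le_opNorm v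
    have h3 : δ * ‖L ω‖ ≤ Real.exp (δ * ‖L ω‖) := by
      linarith [Real.add_one_le_exp (δ * ‖L ω‖)]
    have h4 : Real.exp ((L ω (z + t • v)).re) * Real.exp (δ * ‖L ω‖) ≤
        Real.exp ((L ω z').re) := by
      rw [← Real.exp_add]; exact Real.exp_le_exp.mpr h1
    simp only [norm_mul, Complex.norm_exp]
    have h5 : ‖L ω‖ * Real.exp ((L ω (z + t • v)).re) ≤ Real.exp ((L ω z').re) / δ := by
      rw [le_div_iff₀ hδ]
      nlinarith [Real.exp_pos ((L ω (z + t • v)).re)]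
    calc ‖b ω‖ * ‖L ω v‖ * Real.exp ((L ω (z + t • v)).re)
        ≤ ‖b ω‖ * (‖L ω‖ * ‖v‖) * Real.exp ((L ω (z + t • v)).re) := by gcongr
      _ = ‖b ω‖ * ‖v‖ * (‖L ω‖ * Real.exp ((L ω (z + t • v)).re)) := by ring
      _ ≤ ‖b ω‖ * ‖v‖ * (Real.exp ((L ω z').re) / δ) := by gcongr
      _ = _ := by ring

/-- Differentiation only changes the density `b` by a symbol, so the one-step result applies again
as long as integrability is carried through the induction. It is used with Lebesgue measure for
Gaussian integrals and with counting measure for Fourier series. -/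
theorem cDL_laplace (hU : IsOpen U) (hL : ∀ v, Measurable fun ω => L ω v)
    (hdom : LaplaceDominated U L) {b : Ω → ℂ} (hb : Measurable b)
    (hint : ∀ z ∈ U, Integrable (fun ω => b ω * Complex.exp (L ω z)) μ)
    (l : List (FirstOrder E)) :
    (∀ z ∈ U, Integrable (fun ω => b ω * (l.map (symb (L ω))).prod * Complex.exp (L ω z)) μ) ∧
    Set.EqOn (cDL l fun y => ∫ ω, b ω * Complex.exp (L ω y) ∂μ)
      (fun y => ∫ ω, b ω * (l.map (symb (L ω))).prod * Complex.exp (L ω y) ∂μ) U := by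
  have hsym : ∀ p, Measurable fun ω => symb (L ω) p := fun p =>
    ((hL _).const_mul _).add ((hL _).const_mul _)
  have hprod : ∀ l : List (FirstOrder E), Measurable fun ω => (l.map (symb (L ω))).prod := by
    intro l
    induction l with
    | nil => simp
    | cons p l ih => simp only [List.map_cons, List.prod_cons]; exact (hsym p).mul ih
  induction l with
  | nil => exact ⟨by simpa using hint, fun z _ => by simp⟩
  | cons p l ih =>
    have step := fun v z hz => hasLineDerivAt_laplace hL hdom (b := fun ω => b ω * (l.map (symb (L ω))).prod)
      (hb.mul (hprod l)) ih.1 v (z := z) hz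
    have heq : ∀ z, (fun ω => b ω * ((p :: l).map (symb (L ω))).prod * Complex.exp (L ω z)) =
        fun ω => p.1.1 * (b ω * (l.map (symb (L ω))).prod * L ω p.1.2 * Complex.exp (L ω z)) +
          p.2.1 * (b ω * (l.map (symb (L ω))).prod * L ω p.2.2 * Complex.exp (L ω z)) := by
      intro z; funext ω
      simp only [List.map_cons, List.prod_cons, symb]
      ring
    constructor
    · intro z hz
      rw [heq z]
      exact ((step _ z hz).1.const_mul _).add ((step _ z hz).1.const_mul _)
    · intro z hz
      rw [cDL_cons, cD_congr hU ih.2 p hz, HasLineDerivAt.cD_eq (step _ z hz).2 (step _ z hz).2]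
      simp only [heq z]
      rw [integral_add ((step _ z hz).1.const_mul _) ((step _ z hz).1.const_mul _),
        integral_const_mul, integral_const_mul]

theorem iterDiffOn_laplace (hU : IsOpen U) (hL : ∀ v, Measurable fun ω => L ω v)
    (hdom : LaplaceDominated U L) {b : Ω → ℂ} (hb : Measurable b)
    (hint : ∀ z ∈ U, Integrable (fun ω => b ω * Complex.exp (L ω z)) μ) :
    IterDiffOn (fun y => ∫ ω, b ω * Complex.exp (L ω y) ∂μ) U := by
  intro l z hz v
  have h := cDL_laplace hU hL hdom hb hint l
  have hprod : ∀ l : List (FirstOrder E), Measurable fun ω => (l.map (symb (L ω))).prod := by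
    intro l
    induction l with
    | nil => simp
    | cons p l ih =>
      simp only [List.map_cons, List.prod_cons]
      exact (((hL _).const_mul _).add ((hL _).const_mul _)).mul ih
  have := (hasLineDerivAt_laplace hL hdom (b := fun ω => b ω * (l.map (symb (L ω))).prod)
    (hb.mul (hprod l)) h.1 v hz).2
  exact (this.congr_of_eventuallyEq
    (h.2.eventuallyEq_of_mem (hU.mem_nhds hz))).lineDifferentiableAt

end Laplace

end Calculus

/-! ### Symmetric matrices in coordinates -/

section Coordinates

variable {m : ℕ}

lemma symOf_apply {R : Type*} (x : SymIdx m → R) (i j : Fin m) :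
    symOf x i j = x (if h : i ≤ j then ⟨(i, j), h⟩ else ⟨(j, i), (not_le.mp h).le⟩) := by
  simp only [symOf, Matrix.of_apply]
  split_ifs <;> rfl

lemma symOf_isSymm {R : Type*} (x : SymIdx m → R) : (symOf x).IsSymm := by
  ext i j
  rw [Matrix.transpose_apply, symOf_apply, symOf_apply]
  congr 1
  rcases lt_trichotomy i j with h | h | h
  · simp [h.le, not_le.mpr h]
  · subst h; rfl
  · simp [h.le, not_le.mpr h]

/-- The coordinates of a symmetric matrix. -/
def upper {R : Type*} (A : Matrix (Fin m) (Fin m) R) : SymIdx m → R := fun p => A p.1.1 p.1.2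

@[simp] lemma upper_symOf {R : Type*} (x : SymIdx m → R) : upper (symOf x) = x := by
  funext p
  rw [upper, symOf_apply, dif_pos p.2]

lemma symOf_upper {R : Type*} {A : Matrix (Fin m) (Fin m) R} (hA : A.IsSymm) :
    symOf (upper A) = A := by
  ext i j
  rw [symOf_apply, upper]
  split_ifs with h
  · rfl
  · exact hA.apply _ _

lemma symOf_map {R S : Type*} (f : R → S) (x : SymIdx m → R) :
    (symOf x).map f = symOf (f ∘ x) := by
  ext i j
  simp [symOf_apply]

/-- `symOf` as a linear map. -/
def symOfL (m : ℕ) (R : Type*) [CommRing R] :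
    (SymIdx m → R) →ₗ[R] Matrix (Fin m) (Fin m) R where
  toFun := symOf
  map_add' x y := by ext i j; simp [symOf_apply]
  map_smul' c x := by ext i j; simp [symOf_apply]

lemma symOf_add {R : Type*} [CommRing R] (x y : SymIdx m → R) :
    symOf (x + y) = symOf x + symOf y := (symOfL m R).map_add x y

lemma symOf_sub {R : Type*} [CommRing R] (x y : SymIdx m → R) :
    symOf (x - y) = symOf x - symOf y := (symOfL m R).map_sub x y

lemma symOf_smul {R : Type*} [CommRing R] (c : R) (x : SymIdx m → R) :
    symOf (c • x) = c • symOf x := (symOfL m R).map_smul c x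

/-- The coordinates of the identity matrix. -/
def idY (m : ℕ) : SymIdx m → ℝ := upper 1

lemma symOf_idY : symOf (idY m) = 1 := symOf_upper Matrix.isSymm_one

/-- The linear functional `y ↦ tr(A y)`. -/
def trL {R : Type*} [CommRing R] (A : Matrix (Fin m) (Fin m) R) : (SymIdx m → R) →ₗ[R] R :=
  Matrix.traceLinearMap (Fin m) R R ∘ₗ LinearMap.mulLeft R A ∘ₗ symOfL m R

lemma trL_apply {R : Type*} [CommRing R] (A : Matrix (Fin m) (Fin m) R) (x : SymIdx m → R) :
    trL A x = (A * symOf x).trace := rfl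

/-- The determinant as a function of the coordinates. -/
def dt (y : SymIdx m → ℝ) : ℝ := (symOf y).det

lemma norm_symOf_apply_le (y : SymIdx m → ℝ) (i j : Fin m) : |symOf y i j| ≤ ‖y‖ := by
  rw [symOf_apply]; exact norm_le_pi_norm y _

end Coordinates

/-! ### Positive matrices -/

section Positive

variable {m : ℕ}

lemma exists_orthogonal_diagonalization {A : Matrix (Fin m) (Fin m) ℝ} (hA : A.IsSymm) :
    ∃ (g : Matrix (Fin m) (Fin m) ℝ) (d : Fin m → ℝ), g * gᵀ = 1 ∧ gᵀ * g = 1 ∧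
      A = g * diagonal d * gᵀ := by
  have hH : A.IsHermitian := by
    rw [Matrix.IsHermitian, Matrix.conjTranspose_eq_transpose_of_trivial]; exact hA
  refine ⟨hH.eigenvectorUnitary, hH.eigenvalues, ?_, ?_, ?_⟩
  · have := Unitary.coe_mul_star_self hH.eigenvectorUnitary
    rwa [Unitary.coe_star, Matrix.star_eq_conjTranspose, Matrix.conjTranspose_eq_transpose_of_trivial] at this
  · have := Unitary.coe_star_mul_self hH.eigenvectorUnitary
    rwa [Matrix.star_eq_conjTranspose, Matrix.conjTranspose_eq_transpose_of_trivial] at this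
  · have := hH.spectral_theorem
    rw [Unitary.conjStarAlgAut_apply, Matrix.star_eq_conjTranspose,
      Matrix.conjTranspose_eq_transpose_of_trivial] at this
    exact this

lemma conj_add_smul_one {g : Matrix (Fin m) (Fin m) ℝ} (hg : g * gᵀ = 1) (d : Fin m → ℝ) (t : ℝ) :
    g * diagonal d * gᵀ + t • 1 = g * diagonal (fun i => d i + t) * gᵀ := by
  have : diagonal (fun i => d i + t) = diagonal d + t • (1 : Matrix (Fin m) (Fin m) ℝ) := by
    rw [Matrix.smul_one_eq_diagonal, Matrix.diagonal_add]
  rw [this, mul_add, add_mul, mul_smul_comm, mul_one, smul_mul_assoc, hg]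

lemma posDef_conj_iff {g : Matrix (Fin m) (Fin m) ℝ} (hg : IsUnit g)
    {M : Matrix (Fin m) (Fin m) ℝ} : (g * M * gᵀ).PosDef ↔ M.PosDef := by
  have := hg.posDef_star_right_conjugate_iff (x := M)
  rwa [Matrix.star_eq_conjTranspose, Matrix.conjTranspose_eq_transpose_of_trivial] at this

lemma isUnit_of_mul_transpose {g : Matrix (Fin m) (Fin m) ℝ} (hg : g * gᵀ = 1) : IsUnit g :=
  (Matrix.isUnit_iff_isUnit_det _).mpr (Matrix.isUnit_det_of_right_inverse hg)

lemma exists_posDef_sub_smul {A : Matrix (Fin m) (Fin m) ℝ} (hA : A.PosDef) :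
    ∃ ε : ℝ, 0 < ε ∧ (A - ε • 1).PosDef := by
  have hs : A.IsSymm := by
    have := hA.isHermitian
    rwa [Matrix.IsHermitian, Matrix.conjTranspose_eq_transpose_of_trivial] at this
  obtain ⟨g, d, h1, h2, h3⟩ := exists_orthogonal_diagonalization hs
  have hu := isUnit_of_mul_transpose h1
  have hd : ∀ i, 0 < d i := by
    rw [h3, posDef_conj_iff hu, Matrix.posDef_diagonal_iff] at hA
    exact hA
  obtain ⟨ε, hε, hlt⟩ : ∃ ε : ℝ, 0 < ε ∧ ∀ i, ε < d i := by
    rcases isEmpty_or_nonempty (Fin m) with he | he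
    · exact ⟨1, one_pos, fun i => he.elim i⟩
    · obtain ⟨i₀, hi₀⟩ := Finite.exists_min d
      exact ⟨d i₀ / 2, half_pos (hd _), fun i => (half_lt_self (hd _)).trans_le (hi₀ i)⟩
  refine ⟨ε, hε, ?_⟩
  rw [sub_eq_add_neg, ← neg_smul, h3, conj_add_smul_one h1, posDef_conj_iff hu,
    Matrix.posDef_diagonal_iff]
  intro i
  linarith [hlt i]

lemma exists_eq_mul_transpose {A : Matrix (Fin m) (Fin m) ℝ} (hA : A.PosSemidef) :
    ∃ B : Matrix (Fin m) (Fin m) ℝ, A = B * Bᵀ := by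
  have hs : A.IsSymm := by
    have := hA.isHermitian
    rwa [Matrix.IsHermitian, Matrix.conjTranspose_eq_transpose_of_trivial] at this
  obtain ⟨g, d, h1, h2, h3⟩ := exists_orthogonal_diagonalization hs
  have h4 : gᵀ * A * g = diagonal d := by
    rw [h3]
    calc gᵀ * (g * diagonal d * gᵀ) * g = (gᵀ * g) * diagonal d * (gᵀ * g) := by
          simp only [mul_assoc]
      _ = _ := by rw [h2, one_mul, mul_one]
  have h5 := hA.conjTranspose_mul_mul_same g
  rw [Matrix.conjTranspose_eq_transpose_of_trivial, h4, Matrix.posSemidef_diagonal_iff] at h5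
  refine ⟨g * diagonal fun i => √(d i), ?_⟩
  rw [Matrix.transpose_mul, Matrix.diagonal_transpose, mul_assoc, ← mul_assoc (diagonal _),
    Matrix.diagonal_mul_diagonal, ← mul_assoc, h3]
  congr 3
  funext i
  exact (Real.mul_self_sqrt (h5 i)).symm

lemma trace_mul_nonneg {A B : Matrix (Fin m) (Fin m) ℝ} (hA : A.PosSemidef) (hB : B.PosSemidef) :
    0 ≤ (A * B).trace := by
  obtain ⟨C, rfl⟩ := exists_eq_mul_transpose hA
  rw [mul_assoc, Matrix.trace_mul_comm]
  have := (hB.conjTranspose_mul_mul_same C).trace_nonneg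
  rwa [Matrix.conjTranspose_eq_transpose_of_trivial] at this

lemma isHermitian_symOf (y : SymIdx m → ℝ) : (symOf y).IsHermitian := by
  rw [Matrix.IsHermitian, Matrix.conjTranspose_eq_transpose_of_trivial]; exact symOf_isSymm y

lemma abs_quadForm_le (v : SymIdx m → ℝ) (x : Fin m → ℝ) :
    |x ⬝ᵥ (symOf v *ᵥ x)| ≤ m * ‖v‖ * (x ⬝ᵥ x) := by
  have h1 : |x ⬝ᵥ (symOf v *ᵥ x)| ≤ ∑ i, ∑ j, ‖v‖ * ((x i ^ 2 + x j ^ 2) / 2) := by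
    simp only [dotProduct, mulVec, Finset.mul_sum]
    refine (Finset.abs_sum_le_sum_abs _ _).trans (Finset.sum_le_sum fun i _ => ?_)
    refine (Finset.abs_sum_le_sum_abs _ _).trans (Finset.sum_le_sum fun j _ => ?_)
    rw [abs_mul, abs_mul]
    have := norm_symOf_apply_le v i j
    have h2 : |x i| * |x j| ≤ (x i ^ 2 + x j ^ 2) / 2 := by
      nlinarith [sq_nonneg (|x i| - |x j|), sq_abs (x i), sq_abs (x j)]
    calc |x i| * (|symOf v i j| * |x j|) = |symOf v i j| * (|x i| * |x j|) := by ring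
      _ ≤ _ := by gcongr
  refine h1.trans (le_of_eq ?_)
  simp only [← Finset.mul_sum, add_div, Finset.sum_add_distrib, ← Finset.sum_div, dotProduct,
    Finset.sum_const, Finset.card_univ, Fintype.card_fin, nsmul_eq_mul]
  have : ∀ i, x i * x i = x i ^ 2 := fun i => (sq _).symm
  simp only [this]
  ring

lemma posSemidef_smul_one_add {v : SymIdx m → ℝ} {r : ℝ} (hr : m * ‖v‖ ≤ r) :
    (r • (1 : Matrix (Fin m) (Fin m) ℝ) + symOf v).PosSemidef := by
  refine Matrix.PosSemidef.of_dotProduct_mulVec_nonneg ?_ fun x => ?_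
  · exact (Matrix.isHermitian_one.smul (IsSelfAdjoint.all r)).add (isHermitian_symOf v)
  · have h1 := abs_le.mp (abs_quadForm_le v x)
    have h2 : 0 ≤ x ⬝ᵥ x := Finset.sum_nonneg fun i _ => mul_self_nonneg _
    simp only [star_trivial, Matrix.add_mulVec, dotProduct_add, Matrix.smul_mulVec,
      Matrix.one_mulVec, dotProduct_smul, smul_eq_mul]
    nlinarith

lemma trace_mul_symOf_le {T : Matrix (Fin m) (Fin m) ℝ} (hT : T.PosSemidef) (v : SymIdx m → ℝ) :
    |(T * symOf v).trace| ≤ m * ‖v‖ * T.trace := by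
  have h1 := trace_mul_nonneg hT (posSemidef_smul_one_add (le_refl (m * ‖v‖)))
  have h2 := trace_mul_nonneg hT (posSemidef_smul_one_add (v := -v) (r := m * ‖v‖) (by simp))
  have h3 : symOf (-v) = -symOf v := (symOfL m ℝ).map_neg v
  rw [h3] at h2
  simp only [mul_add, Matrix.trace_add, mul_smul_comm, mul_one, Matrix.trace_smul, smul_eq_mul,
    mul_neg, Matrix.trace_neg] at h1 h2
  exact abs_le.mpr ⟨by linarith, by linarith⟩

lemma mem_posCone {y : SymIdx m → ℝ} : y ∈ posCone m ↔ (symOf y).PosDef := Iff.rfl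

lemma isOpen_posCone (m : ℕ) : IsOpen (posCone m) := by
  rw [Metric.isOpen_iff]
  intro y hy
  obtain ⟨ε, hε, h⟩ := exists_posDef_sub_smul hy
  refine ⟨ε / (m + 1), by positivity, fun y' hy' => ?_⟩
  have h1 : m * ‖y' - y‖ ≤ ε := by
    rw [Metric.mem_ball, dist_eq_norm, lt_div_iff₀ (by positivity)] at hy'
    nlinarith [norm_nonneg (y' - y)]
  have := h.add_posSemidef (posSemidef_smul_one_add h1)
  rw [symOf_sub] at this
  rw [mem_posCone]
  convert this using 1
  abel

lemma idY_mem_posCone : idY m ∈ posCone m := by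
  rw [mem_posCone, symOf_idY]; exact Matrix.PosDef.one

lemma dt_pos {y : SymIdx m → ℝ} (hy : y ∈ posCone m) : 0 < dt y := hy.det_pos

lemma norm_le_trace {y : SymIdx m → ℝ} (hy : (symOf y).PosSemidef) : ‖y‖ ≤ (symOf y).trace := by
  have htr : ∀ i, symOf y i i ≤ (symOf y).trace := fun i =>
    Finset.single_le_sum (f := fun i => symOf y i i) (fun j _ => hy.diag_nonneg) (Finset.mem_univ i)
  rw [pi_norm_le_iff_of_nonneg hy.trace_nonneg]
  rintro ⟨⟨i, j⟩, hij⟩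
  have he : y ⟨(i, j), hij⟩ = symOf y i j := by rw [symOf_apply, dif_pos hij]
  rw [he, Real.norm_eq_abs]
  by_cases h : i = j
  · subst h
    rw [abs_of_nonneg hy.diag_nonneg]; exact htr i
  -- Testing against `e_i ± e_j` gives `2 |y_ij| ≤ y_ii + y_jj`.
  have h1 := hy.dotProduct_mulVec_nonneg (Pi.single i 1 + Pi.single j 1)
  have h2 := hy.dotProduct_mulVec_nonneg (Pi.single i 1 - Pi.single j 1)
  have h3 : symOf y j i = symOf y i j := (symOf_isSymm y).apply i j
  simp [Matrix.mulVec_add, Matrix.mulVec_sub, dotProduct_add, dotProduct_sub, add_dotProduct,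
    sub_dotProduct, h3] at h1 h2
  have h4 := htr i
  have h5 := htr j
  exact abs_le.mpr ⟨by linarith, by linarith⟩

/-- If `T - ε` is still positive, then `tr(T y) ≥ ε tr(y) ≥ ε ‖y‖` by `trace_mul_nonneg`. This turns
`exp(-tr(T y))` into exponential decay in the norm. -/
lemma exists_norm_le_trace_mul {T : Matrix (Fin m) (Fin m) ℝ} (hT : T.PosDef) :
    ∃ c : ℝ, 0 < c ∧ ∀ y ∈ posCone m, c * ‖y‖ ≤ (T * symOf y).trace := by
  obtain ⟨ε, hε, h⟩ := exists_posDef_sub_smul hT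
  refine ⟨ε, hε, fun y hy => ?_⟩
  have h1 := trace_mul_nonneg h.posSemidef hy.posSemidef
  rw [sub_mul, Matrix.trace_sub, smul_mul_assoc, one_mul, Matrix.trace_smul, smul_eq_mul] at h1
  nlinarith [norm_le_trace hy.posSemidef]

lemma abs_dt_le (y : SymIdx m → ℝ) : |dt y| ≤ m.factorial * ‖y‖ ^ m := by
  have := Matrix.det_le (A := symOf y) (abv := AbsoluteValue.abs) (x := ‖y‖)
    (fun i j => norm_symOf_apply_le y i j)
  simpa [dt] using this

end Positive

/-! ### Integrability of powers of the determinant over the cone -/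

section Integrability

variable {m : ℕ}

lemma exists_pow_le_exp {c : ℝ} (hc : 0 < c) (N : ℕ) :
    ∃ C : ℝ, 0 ≤ C ∧ ∀ r : ℝ, 0 ≤ r → (1 + r) ^ N ≤ C * Real.exp (c * r) := by
  refine ⟨N.factorial / c ^ N * Real.exp c, by positivity, fun r hr => ?_⟩
  have h := Real.pow_div_factorial_le_exp (c * (1 + r)) (by positivity) N
  rw [div_le_iff₀ (by positivity), mul_pow] at h
  have h2 : Real.exp (c * (1 + r)) = Real.exp c * Real.exp (c * r) := by
    rw [← Real.exp_add]; ring_nf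
  rw [h2] at h
  calc (1 + r) ^ N = (c ^ N * (1 + r) ^ N) / c ^ N := by field_simp
    _ ≤ (Real.exp c * Real.exp (c * r) * N.factorial) / c ^ N := by gcongr
    _ = _ := by ring

lemma integrable_exp_neg_norm {E : Type*} [NormedAddCommGroup E] [NormedSpace ℝ E]
    [FiniteDimensional ℝ E] [MeasurableSpace E] [BorelSpace E] (μ : Measure E)
    [μ.IsAddHaarMeasure] {c : ℝ} (hc : 0 < c) :
    Integrable (fun y : E => Real.exp (-c * ‖y‖)) μ := by
  obtain ⟨C, hC, h⟩ := exists_pow_le_exp hc (Module.finrank ℝ E + 1)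
  have hi := integrable_one_add_norm (μ := μ) (E := E)
    (r := ((Module.finrank ℝ E + 1 : ℕ) : ℝ)) (by push_cast; linarith)
  refine (hi.const_mul C).mono' (by fun_prop) (Eventually.of_forall fun y => ?_)
  have h1 := h ‖y‖ (norm_nonneg y)
  rw [Real.norm_eq_abs, abs_of_pos (Real.exp_pos _), Real.rpow_neg (by positivity),
    Real.rpow_natCast, neg_mul, Real.exp_neg, ← div_eq_mul_inv, le_div_iff₀ (by positivity),
    inv_mul_le_iff₀ (Real.exp_pos _), mul_comm]
  exact h1

/-- The number `a` is the least eigenvalue of `y`: a move along the identity shifts every eigenvalue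
by `t`, so the determinant is a product of `m` factors, each at least `a + t`. Singularities of
negative powers of the determinant are thus reduced to one real variable. -/
lemma exists_shift_pow_le_dt (hm : 0 < m) (y : SymIdx m → ℝ) : ∃ a : ℝ, ∀ t : ℝ,
    y + t • idY m ∈ posCone m → 0 < a + t ∧ (a + t) ^ m ≤ dt (y + t • idY m) := by
  obtain ⟨g, d, h1, h2, h3⟩ := exists_orthogonal_diagonalization (symOf_isSymm y)
  have : Nonempty (Fin m) := ⟨⟨0, hm⟩⟩
  obtain ⟨i₀, hi₀⟩ := Finite.exists_min d
  refine ⟨d i₀, fun t ht => ?_⟩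
  have he : symOf (y + t • idY m) = g * diagonal (fun i => d i + t) * gᵀ := by
    rw [symOf_add, symOf_smul, symOf_idY, ← conj_add_smul_one h1, ← h3]
  rw [mem_posCone, he, posDef_conj_iff (isUnit_of_mul_transpose h1),
    Matrix.posDef_diagonal_iff] at ht
  refine ⟨ht i₀, ?_⟩
  have hdet : g.det * gᵀ.det = 1 := by rw [← Matrix.det_mul, h1, Matrix.det_one]
  rw [dt, he, Matrix.det_mul, Matrix.det_mul, Matrix.det_diagonal, mul_right_comm, hdet, one_mul]
  calc (d i₀ + t) ^ m = ∏ _i : Fin m, (d i₀ + t) := by simp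
    _ ≤ _ := Finset.prod_le_prod (fun _ _ => (ht i₀).le) fun i _ => by linarith [hi₀ i]

lemma continuous_dt : Continuous (dt : (SymIdx m → ℝ) → ℝ) := by
  have : Continuous fun y : SymIdx m → ℝ => symOf y :=
    (symOfL m ℝ).continuous_of_finiteDimensional
  exact this.matrix_det

lemma measurableSet_posCone : MeasurableSet (posCone m) := (isOpen_posCone m).measurableSet

/-- Translation invariance lets the integrand be averaged over `y + t • 1` with `0 < t ≤ 1`. The
average is at most a constant times `exp(-c ‖y‖) (1 + ∫_0^1 r^(mβ) dr)`, and the inner integral is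
finite because `mβ > -1`. -/
theorem integrableOn_dt_rpow_neg (hm : 0 < m) {β c : ℝ} (hβ : -1 < m * β) (hβ0 : β ≤ 0)
    (hc : 0 < c) :
    IntegrableOn (fun y => dt y ^ β * Real.exp (-c * ‖y‖)) (posCone m) := by
  rw [← integrable_indicator_iff measurableSet_posCone]
  set F : (SymIdx m → ℝ) → ℝ :=
    (posCone m).indicator fun y => dt y ^ β * Real.exp (-c * ‖y‖) with hF
  have hFm : Measurable F :=
    ((continuous_dt.measurable.pow_const β).mul (by fun_prop)).indicator measurableSet_posCone
  refine ⟨hFm.aestronglyMeasurable, ?_⟩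
  have hF0 : ∀ y, 0 ≤ F y := fun y => Set.indicator_nonneg
    (fun y hy => mul_nonneg (Real.rpow_nonneg (dt_pos hy).le _) (Real.exp_pos _).le) y
  set H : (SymIdx m → ℝ) → ENNReal := fun y => ENNReal.ofReal (F y) with hH
  have hHm : Measurable H := hFm.ennreal_ofReal
  have hHe : (fun y => ‖F y‖ₑ) = H := by
    funext y; rw [hH]; exact Real.enorm_of_nonneg (hF0 y)
  rw [HasFiniteIntegral, hHe]
  set K : ℝ → ENNReal := (Set.Ioc (0 : ℝ) 1).indicator fun r => ENNReal.ofReal (r ^ (m * β)) with hK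
  have hKm : Measurable K :=
    (measurable_id.pow_const (m * β)).ennreal_ofReal.indicator measurableSet_Ioc
  have hKfin : ∫⁻ r, K r < ⊤ := by
    rw [hK, lintegral_indicator measurableSet_Ioc]
    have : IntegrableOn (fun r : ℝ => r ^ (m * β)) (Set.Ioc 0 1) := by
      have := intervalIntegral.intervalIntegrable_rpow' (a := 0) (b := 1) hβ
      rwa [intervalIntegrable_iff_integrableOn_Ioc_of_le zero_le_one] at this
    exact Integrable.lintegral_lt_top this
  set e := idY m
  have hbound : ∀ y, ∫⁻ t in Set.Ioc (0 : ℝ) 1, H (y + t • e) ≤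
      ENNReal.ofReal (Real.exp (c * ‖e‖) * Real.exp (-c * ‖y‖)) * ((∫⁻ r, K r) + 1) := by
    intro y
    obtain ⟨a, ha⟩ := exists_shift_pow_le_dt hm y
    have hpt : ∀ t ∈ Set.Ioc (0 : ℝ) 1, H (y + t • e) ≤
        ENNReal.ofReal (Real.exp (c * ‖e‖) * Real.exp (-c * ‖y‖)) * (K (a + t) + 1) := by
      intro t ht
      by_cases hy : y + t • e ∈ posCone m
      · obtain ⟨h1, h2⟩ := ha t hy
        have h3 : F (y + t • e) ≤
            (Real.exp (c * ‖e‖) * Real.exp (-c * ‖y‖)) * (a + t) ^ (m * β) := by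
          rw [hF, Set.indicator_of_mem hy, mul_comm]
          have h4 : dt (y + t • e) ^ β ≤ (a + t) ^ (m * β) := by
            rw [Real.rpow_mul h1.le, Real.rpow_natCast]
            exact Real.rpow_le_rpow_of_nonpos (by positivity) h2 hβ0
          have h5 : Real.exp (-c * ‖y + t • e‖) ≤ Real.exp (c * ‖e‖) * Real.exp (-c * ‖y‖) := by
            rw [← Real.exp_add]
            refine Real.exp_le_exp.mpr ?_
            have h6 : ‖y‖ ≤ ‖y + t • e‖ + ‖e‖ := by
              calc ‖y‖ = ‖(y + t • e) - t • e‖ := by simp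
                _ ≤ ‖y + t • e‖ + ‖t • e‖ := norm_sub_le _ _
                _ ≤ _ := by
                  rw [norm_smul, Real.norm_eq_abs, abs_of_pos ht.1]
                  nlinarith [ht.2, norm_nonneg e]
            nlinarith
          gcongr
          exact Real.rpow_nonneg (dt_pos hy).le _
        refine (ENNReal.ofReal_le_ofReal h3).trans ?_
        rw [ENNReal.ofReal_mul (by positivity)]
        gcongr
        -- Close to the boundary the bound is the singular power `K`; farther inside, a nonpositive
        -- power of a number above `1` is at most `1`.
        by_cases h7 : a + t ≤ 1
        · rw [hK, Set.indicator_of_mem (Set.mem_Ioc.mpr ⟨h1, h7⟩)]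
          exact le_self_add
        · refine le_trans ?_ le_add_self
          rw [ENNReal.ofReal_le_one]
          exact Real.rpow_le_one_of_one_le_of_nonpos (not_le.mp h7).le
            (mul_nonpos_of_nonneg_of_nonpos (Nat.cast_nonneg m) hβ0)
      · have : H (y + t • e) = 0 := by
          rw [hH]; simp only [hF, Set.indicator_of_notMem hy, ENNReal.ofReal_zero]
        rw [this]; exact zero_le
    refine (setLIntegral_mono (by fun_prop) hpt).trans ?_
    rw [lintegral_const_mul _ (by fun_prop)]
    gcongr
    rw [lintegral_add_right _ measurable_const]
    refine add_le_add ?_ (by simp)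
    refine (setLIntegral_le_lintegral _ _).trans ?_
    rw [lintegral_add_left_eq_self]
  have hswap : ∫⁻ y, H y = ∫⁻ y, ∫⁻ t in Set.Ioc (0 : ℝ) 1, H (y + t • e) := by
    rw [lintegral_lintegral_swap]
    · have : ∀ t : ℝ, ∫⁻ y, H (y + t • e) = ∫⁻ y, H y := fun t => lintegral_add_right_eq_self _ _
      simp [this]
    · exact (hHm.comp (by fun_prop : Measurable fun p : (SymIdx m → ℝ) × ℝ =>
        p.1 + p.2 • e)).aemeasurable
  rw [hswap]
  refine (lintegral_mono hbound).trans_lt ?_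
  rw [lintegral_mul_const _ (by fun_prop)]
  refine ENNReal.mul_lt_top ?_ (ENNReal.add_lt_top.mpr ⟨hKfin, ENNReal.one_lt_top⟩)
  exact ((integrable_exp_neg_norm volume hc).const_mul _).lintegral_lt_top

theorem integrableOn_dt_rpow (hm : 0 < m) {β c : ℝ} (hβ : -1 < m * β) (hc : 0 < c) (N : ℕ) :
    IntegrableOn (fun y => dt y ^ β * (1 + ‖y‖) ^ N * Real.exp (-c * ‖y‖)) (posCone m) := by
  have hmeas : ∀ γ : ℝ, AEStronglyMeasurable
      (fun y : SymIdx m → ℝ => dt y ^ γ * (1 + ‖y‖) ^ N * Real.exp (-c * ‖y‖))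
      (volume.restrict (posCone m)) := fun γ =>
    (((continuous_dt.measurable.pow_const γ).mul (by fun_prop)).mul
      (by fun_prop)).aestronglyMeasurable
  obtain ⟨n, hn⟩ := exists_nat_ge β
  -- The positive part of `β` is harmless: the determinant grows polynomially, so that power is
  -- absorbed by half of the exponential decay.
  set β' := min β 0
  obtain ⟨C, hC, hle⟩ := exists_pow_le_exp (half_pos hc) (m * n + N)
  have hβ' : -1 < m * β' := by
    rcases min_choice β 0 with h | h <;> simp only [β', h]
    · exact hβ
    · simp
  refine ((integrableOn_dt_rpow_neg hm hβ' (min_le_right _ _) (half_pos hc)).const_mul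
    ((1 + m.factorial) ^ n * C)).mono' (hmeas β) ?_
  refine (ae_restrict_iff' measurableSet_posCone).mpr (Eventually.of_forall fun y hy => ?_)
  have hd := dt_pos hy
  have h1 : dt y ≤ (1 + m.factorial) * (1 + ‖y‖) ^ m := by
    refine (le_abs_self _).trans ((abs_dt_le y).trans ?_)
    gcongr <;> linarith [norm_nonneg y]
  have h1' : 1 ≤ (1 + (m.factorial : ℝ)) * (1 + ‖y‖) ^ m := by
    have : 1 ≤ (1 + ‖y‖) ^ m := one_le_pow₀ (by linarith [norm_nonneg y])
    nlinarith [(Nat.cast_nonneg m.factorial : (0 : ℝ) ≤ _)]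
  have h2 : dt y ^ β ≤ dt y ^ β' * ((1 + m.factorial) * (1 + ‖y‖) ^ m) ^ n := by
    have : dt y ^ β = dt y ^ β' * dt y ^ (max β 0) := by
      rw [← Real.rpow_add hd, min_add_max, add_zero]
    rw [this]
    gcongr
    calc dt y ^ (max β 0) ≤ ((1 + m.factorial) * (1 + ‖y‖) ^ m) ^ (max β 0) :=
          Real.rpow_le_rpow hd.le h1 (le_max_right _ _)
      _ ≤ ((1 + m.factorial) * (1 + ‖y‖) ^ m) ^ (n : ℝ) :=
          Real.rpow_le_rpow_of_exponent_le h1' (max_le hn (Nat.cast_nonneg n))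
      _ = _ := Real.rpow_natCast _ _
  have h3 := hle ‖y‖ (norm_nonneg y)
  have h4 : Real.exp (c / 2 * ‖y‖) * Real.exp (-c * ‖y‖) = Real.exp (-(c / 2) * ‖y‖) := by
    rw [← Real.exp_add]; ring_nf
  have hr := Real.rpow_nonneg hd.le β'
  rw [Real.norm_of_nonneg (by have := Real.rpow_nonneg hd.le β; positivity)]
  calc dt y ^ β * (1 + ‖y‖) ^ N * Real.exp (-c * ‖y‖)
      ≤ dt y ^ β' * ((1 + m.factorial) * (1 + ‖y‖) ^ m) ^ n * (1 + ‖y‖) ^ N *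
          Real.exp (-c * ‖y‖) := by gcongr
    _ = dt y ^ β' * (1 + m.factorial) ^ n * (1 + ‖y‖) ^ (m * n + N) * Real.exp (-c * ‖y‖) := by
        rw [mul_pow, ← pow_mul, pow_add]; ring
    _ ≤ dt y ^ β' * (1 + m.factorial) ^ n * (C * Real.exp (c / 2 * ‖y‖)) * Real.exp (-c * ‖y‖) := by
        gcongr
    _ = dt y ^ β' * (1 + m.factorial) ^ n * C *
          (Real.exp (c / 2 * ‖y‖) * Real.exp (-c * ‖y‖)) := by ring
    _ = _ := by rw [h4]; ring

end Integrability

/-! ### Iterated derivatives along lists of vectors -/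

section RealDirections

variable {E : Type*} [NormedAddCommGroup E] [NormedSpace ℝ E]

/-- The directional derivative along `v` as a first order operator. -/
def rp (v : E) : FirstOrder E := ((1, v), (0, 0))

lemma cD_rp (v : E) (f : E → ℂ) (x : E) : cD (rp v) f x = lineDeriv ℝ f x v := by
  simp [cD, rp]

lemma symb_rp (L : E →L[ℝ] ℂ) (v : E) : symb L (rp v) = L v := by simp [symb, rp]

/-- This gives access to multilinearity in the directions and to the symmetry of higher derivatives,
on which covariance and the removal of order reversals rest. -/
lemma cDL_ofFn_eq_iteratedFDeriv {U : Set E} (hU : IsOpen U) {f : E → ℂ}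
    (hf : ContDiffOn ℝ (⊤ : ℕ∞) f U) (n : ℕ) (v : Fin n → E) :
    Set.EqOn (cDL (List.ofFn fun i => rp (v i)) f) (fun y => iteratedFDeriv ℝ n f y v) U := by
  induction n with
  | zero => intro y _; simp
  | succ n ih =>
    intro y hy
    rw [List.ofFn_succ, cDL_cons, cD_congr hU (ih fun i => v i.succ) _ hy, cD_rp]
    have h1 : DifferentiableAt ℝ (iteratedFDeriv ℝ n f) y :=
      (hf.contDiffAt (hU.mem_nhds hy)).differentiableAt_iteratedFDeriv
        (by exact_mod_cast WithTop.coe_lt_top _)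
    have h2 := (h1.hasFDerivAt.continuousMultilinear_apply_const fun i => v i.succ).hasLineDerivAt
      (v 0)
    rw [h2.lineDeriv]
    exact (iteratedFDeriv_succ_apply_left v).symm

lemma cDL_comp_linear {E' : Type*} [NormedAddCommGroup E'] [NormedSpace ℝ E'] (L : E →ₗ[ℝ] E')
    (f : E' → ℂ) (l : List E) :
    cDL (l.map rp) (fun y => f (L y)) = fun y => cDL (l.map fun v => rp (L v)) f (L y) := by
  induction l with
  | nil => rfl
  | cons v l ih =>
    funext y
    rw [List.map_cons, cDL_cons, ih, cD_rp, List.map_cons, cDL_cons, cD_rp]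
    simp [lineDeriv]

end RealDirections

/-! ### The operator `det(∂_Y)` and its covariance -/

section Covariance

variable {m : ℕ}

/-- The coordinates of `(E_{ij} + E_{ji}) / 2`. -/
def wdir (i j : Fin m) : SymIdx m → ℝ :=
  upper ((1 / 2 : ℝ) • (Matrix.single i j 1 + Matrix.single j i 1))

lemma symOf_wdir (i j : Fin m) :
    symOf (wdir i j) = (1 / 2 : ℝ) • (Matrix.single i j 1 + Matrix.single j i 1) := by
  refine symOf_upper ?_
  rw [Matrix.IsSymm, Matrix.transpose_smul, Matrix.transpose_add, Matrix.transpose_single,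
    Matrix.transpose_single, add_comm]

/-- With the factor `1/2` in `wdir`, the matrix `∂_Y` acts on `exp(tr(A Y))` as multiplication by
`A` itself, off the diagonal as well. Hence `det(∂_Y)` multiplies this exponential by `det A`. -/
lemma trL_wdir {A : Matrix (Fin m) (Fin m) ℝ} (hA : A.IsSymm) (i j : Fin m) :
    trL A (wdir i j) = A i j := by
  rw [trL_apply, symOf_wdir]
  simp only [Matrix.mul_smul, Matrix.mul_add, Matrix.trace_smul, Matrix.trace_add,
    Matrix.trace_mul_single, smul_eq_mul]
  rw [hA.apply j i]
  simp
  ring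

/-- The operator `det(∂_Y)`, expanded by the Leibniz formula. -/
def detD (f : (SymIdx m → ℝ) → ℂ) (y : SymIdx m → ℝ) : ℂ :=
  ∑ σ : Equiv.Perm (Fin m), ((Equiv.Perm.sign σ : ℤ) : ℂ) *
    cDL (List.ofFn fun i => rp (wdir (σ i) i)) f y

/-- The coordinates of the symmetrized product of two vectors. -/
def symP (m : ℕ) : (Fin m → ℝ) →ₗ[ℝ] (Fin m → ℝ) →ₗ[ℝ] (SymIdx m → ℝ) :=
  LinearMap.mk₂ ℝ (fun a b p => (1 / 2 : ℝ) * (a p.1.1 * b p.1.2 + a p.1.2 * b p.1.1))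
    (fun a a' b => by funext p; simp; ring) (fun c a b => by funext p; simp; ring)
    (fun a b b' => by funext p; simp; ring) (fun c a b => by funext p; simp; ring)

lemma symP_apply (a b : Fin m → ℝ) (p : SymIdx m) :
    symP m a b p = (1 / 2 : ℝ) * (a p.1.1 * b p.1.2 + a p.1.2 * b p.1.1) := rfl

lemma symP_comm (a b : Fin m → ℝ) : symP m a b = symP m b a := by
  funext p; simp only [symP_apply]; ring

lemma symOf_symP (a b : Fin m → ℝ) :
    symOf (symP m a b) = (1 / 2 : ℝ) • (vecMulVec a b + vecMulVec b a) := by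
  ext i j
  rw [symOf_apply, symP_apply]
  split_ifs <;> simp [vecMulVec_apply] <;> ring

lemma wdir_eq_symP (i j : Fin m) : wdir i j = symP m (Pi.single i 1) (Pi.single j 1) := by
  funext p
  simp only [wdir, upper, symP_apply, Matrix.smul_apply, Matrix.add_apply, Matrix.single_apply,
    Pi.single_apply, smul_eq_mul]
  congr 1
  by_cases h1 : i = p.1.1 <;> by_cases h2 : j = p.1.2 <;> by_cases h3 : j = p.1.1 <;>
    by_cases h4 : i = p.1.2 <;> simp [h1, h2, h3, h4, eq_comm]

/-- The action `y ↦ g y gᵀ` on symmetric matrices. -/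
def conjL (g : Matrix (Fin m) (Fin m) ℝ) : (SymIdx m → ℝ) →ₗ[ℝ] (SymIdx m → ℝ) where
  toFun y := upper (g * symOf y * gᵀ)
  map_add' x y := by
    funext p; simp [upper, symOf_add, mul_add, add_mul]
  map_smul' c x := by
    funext p; simp [upper, symOf_smul]

lemma symOf_conjL (g : Matrix (Fin m) (Fin m) ℝ) (y : SymIdx m → ℝ) :
    symOf (conjL g y) = g * symOf y * gᵀ := by
  change symOf (upper (g * symOf y * gᵀ)) = _
  refine symOf_upper ?_
  rw [Matrix.IsSymm, Matrix.transpose_mul, Matrix.transpose_mul, Matrix.transpose_transpose,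
    (symOf_isSymm y).eq, mul_assoc]

lemma conjL_symP (g : Matrix (Fin m) (Fin m) ℝ) (a b : Fin m → ℝ) :
    conjL g (symP m a b) = symP m (g *ᵥ a) (g *ᵥ b) := by
  have h : symOf (conjL g (symP m a b)) = symOf (symP m (g *ᵥ a) (g *ᵥ b)) := by
    rw [symOf_conjL, symOf_symP, symOf_symP]
    simp only [Matrix.mul_smul, Matrix.smul_mul, Matrix.mul_add, Matrix.add_mul,
      Matrix.mul_vecMulVec, Matrix.vecMulVec_mul, Matrix.vecMul_transpose]
  rw [← upper_symOf (conjL g (symP m a b)), h, upper_symOf]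

lemma alternating_eq_det_smul (f : (Fin m → ℝ) [⋀^Fin m]→ₗ[ℝ] ℂ) (a : Fin m → Fin m → ℝ) :
    f a = ((Matrix.of a).det : ℂ) * f (fun i => Pi.single i 1) := by
  let e := Pi.basisFun ℝ (Fin m)
  have key : f = (LinearMap.toSpanSingleton ℝ ℂ (f e)).compAlternatingMap e.det := by
    refine e.ext_alternating fun i h => ?_
    let σ : Equiv.Perm (Fin m) := Equiv.ofBijective i (Finite.injective_iff_bijective.1 h)
    change f (e ∘ σ) = LinearMap.toSpanSingleton ℝ ℂ (f e) (e.det (e ∘ σ))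
    simp [AlternatingMap.map_perm, Module.Basis.det_self]
  have he : (e : Fin m → Fin m → ℝ) = fun i => Pi.single i 1 := by
    funext i
    exact Pi.basisFun_apply ℝ _ i
  have h2 := congrArg (fun F => F a) key
  simp only [LinearMap.compAlternatingMap_apply, LinearMap.toSpanSingleton_apply,
    Complex.real_smul] at h2
  rw [h2, he]
  congr 2
  exact Pi.basisFun_det_apply _

/-- The determinant-like expression `∑ sgn(σ) M(a_{σ(i)} ∘ b_i)` of a multilinear map `M` on
symmetric matrices. -/
def altPairing (M : MultilinearMap ℝ (fun _ : Fin m => SymIdx m → ℝ) ℂ)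
    (a b : Fin m → Fin m → ℝ) : ℂ :=
  ∑ σ : Equiv.Perm (Fin m), ((Equiv.Perm.sign σ : ℤ) : ℂ) * M fun i => symP m (a (σ i)) (b i)

/-- For fixed `b` the signed sum is the alternatization of a multilinear map in `a`, and alternating
`m`-forms on `ℝ^m` are multiples of the determinant. -/
lemma altPairing_left (M : MultilinearMap ℝ (fun _ : Fin m => SymIdx m → ℝ) ℂ)
    (a b : Fin m → Fin m → ℝ) :
    altPairing M a b = (Matrix.of a).det * altPairing M (fun i => Pi.single i 1) b := by
  set f := MultilinearMap.alternatization (M.compLinearMap fun i => (symP m).flip (b i)) with hf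
  have h : ∀ a : Fin m → Fin m → ℝ, altPairing M a b = f a := by
    intro a
    rw [hf, MultilinearMap.alternatization_apply, altPairing]
    refine Finset.sum_congr rfl fun σ _ => ?_
    rw [Units.smul_def, zsmul_eq_mul]
    rfl
  rw [h, h, alternating_eq_det_smul]

lemma altPairing_comm {M : MultilinearMap ℝ (fun _ : Fin m => SymIdx m → ℝ) ℂ}
    (hM : ∀ (v : Fin m → SymIdx m → ℝ) (σ : Equiv.Perm (Fin m)), M (v ∘ σ) = M v)
    (a b : Fin m → Fin m → ℝ) : altPairing M a b = altPairing M b a := by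
  rw [altPairing, altPairing]
  refine Fintype.sum_equiv (Equiv.inv _) _ _ fun σ => ?_
  rw [Equiv.inv_apply, Equiv.Perm.sign_inv, ← hM _ σ⁻¹]
  congr 2
  funext i
  simp [Function.comp, symP_comm]

/-- Symmetry of `M` allows the two tuples to be exchanged, so each contributes one determinant. This
is the origin of the factor `det(g)^2` in the transformation law of `det(∂_Y)`. -/
lemma altPairing_self {M : MultilinearMap ℝ (fun _ : Fin m => SymIdx m → ℝ) ℂ}
    (hM : ∀ (v : Fin m → SymIdx m → ℝ) (σ : Equiv.Perm (Fin m)), M (v ∘ σ) = M v)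
    (a : Fin m → Fin m → ℝ) :
    altPairing M a a = ((Matrix.of a).det : ℂ) ^ 2 *
      altPairing M (fun i => Pi.single i 1) (fun i => Pi.single i 1) := by
  rw [altPairing_left, altPairing_comm hM, altPairing_left, altPairing_comm hM]
  ring

lemma detD_congr {U : Set (SymIdx m → ℝ)} (hU : IsOpen U) {f g : (SymIdx m → ℝ) → ℂ}
    (h : Set.EqOn f g U) : Set.EqOn (detD f) (detD g) U := fun y hy =>
  Finset.sum_congr rfl fun σ _ => by rw [cDL_congr hU h _ hy]

/-- The transformation law of `det(∂_Y)` under `Y ↦ g Y gᵀ`. -/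
theorem detD_comp_conjL {U : Set (SymIdx m → ℝ)} (hU : IsOpen U) {f : (SymIdx m → ℝ) → ℂ}
    (hf : AnalyticOnNhd ℝ f U) (g : Matrix (Fin m) (Fin m) ℝ) {y : SymIdx m → ℝ}
    (hy : conjL g y ∈ U) :
    detD (fun z => f (conjL g z)) y = (g.det : ℂ) ^ 2 * detD f (conjL g y) := by
  set z := conjL g y
  have hs : ContDiffOn ℝ (⊤ : ℕ∞) f U := hf.contDiffOn_of_completeSpace
  set M := (iteratedFDeriv ℝ m f z).toMultilinearMap with hM
  have hsym : ∀ (v : Fin m → SymIdx m → ℝ) (σ : Equiv.Perm (Fin m)), M (v ∘ σ) = M v := by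
    intro v σ
    exact (hf z hy).contDiffAt.iteratedFDeriv_comp_perm v σ
  have h1 : detD f z = altPairing M (fun i => Pi.single i 1) (fun i => Pi.single i 1) := by
    refine Finset.sum_congr rfl fun σ _ => ?_
    rw [cDL_ofFn_eq_iteratedFDeriv hU hs m _ hy]
    simp only [wdir_eq_symP]
    rfl
  have h2 : detD (fun z => f (conjL g z)) y = altPairing M (fun i => g.col i) fun i => g.col i := by
    refine Finset.sum_congr rfl fun σ _ => ?_
    have h3 : (List.ofFn fun i => rp (wdir (σ i) i)) = (List.ofFn fun i => wdir (σ i) i).map rp := by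
      rw [List.map_ofFn]; rfl
    have h4 : ((List.ofFn fun i => wdir (σ i) i).map fun v => rp (conjL g v)) =
        List.ofFn fun i => rp (conjL g (wdir (σ i) i)) := by
      rw [List.map_ofFn]; rfl
    rw [h3, cDL_comp_linear, h4]
    beta_reduce
    rw [cDL_ofFn_eq_iteratedFDeriv hU hs m _ hy]
    simp only [wdir_eq_symP, conjL_symP, Matrix.mulVec_single_one]
    rfl
  rw [h1, h2, altPairing_self hsym, ← Matrix.det_transpose g]
  rfl

end Covariance

/-! ### Cayley's identity and the boundary behaviour of `det(∂_Y)(det(Y)^s exp(-tr(AY)))` -/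

section DetExp

variable {m : ℕ}

lemma cDL_const_mul {E : Type*} [NormedAddCommGroup E] [NormedSpace ℝ E] (c : ℂ) (f : E → ℂ)
    (l : List (FirstOrder E)) : cDL l (fun y => c * f y) = fun y => c * cDL l f y := by
  induction l with
  | nil => rfl
  | cons p l ih =>
    funext y
    rw [cDL_cons, ih, cDL_cons]
    simp only [cD, lineDeriv, deriv_const_mul_field]
    ring

lemma detD_const_mul (c : ℂ) (f : (SymIdx m → ℝ) → ℂ) (y : SymIdx m → ℝ) :
    detD (fun y => c * f y) y = c * detD f y := by
  simp only [detD, cDL_const_mul, Finset.mul_sum]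
  exact Finset.sum_congr rfl fun σ _ => by ring

/-- The functional `y ↦ -tr(A y)` with values in `ℂ`. -/
def negTr (A : Matrix (Fin m) (Fin m) ℝ) : (SymIdx m → ℝ) →L[ℝ] ℂ :=
  Complex.ofRealCLM ∘L (-(trL A)).toContinuousLinearMap

lemma negTr_apply (A : Matrix (Fin m) (Fin m) ℝ) (y : SymIdx m → ℝ) :
    negTr A y = ((-(A * symOf y).trace : ℝ) : ℂ) := rfl

/-- The function `det(y)^s exp(-tr(A y))`. -/
def detExp (s : ℝ) (A : Matrix (Fin m) (Fin m) ℝ) (y : SymIdx m → ℝ) : ℂ :=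
  ((dt y ^ s : ℝ) : ℂ) * Complex.exp (negTr A y)

lemma analyticAt_dt (y : SymIdx m → ℝ) : AnalyticAt ℝ (dt : (SymIdx m → ℝ) → ℝ) y := by
  have h : (dt : (SymIdx m → ℝ) → ℝ) = fun y => ∑ σ : Equiv.Perm (Fin m),
      ((Equiv.Perm.sign σ : ℤ) : ℝ) * ∏ i, symOf y (σ i) i := by
    funext y
    rw [dt, Matrix.det_apply']
  rw [h]
  refine Finset.analyticAt_fun_sum _ fun σ _ => analyticAt_const.mul ?_
  refine Finset.analyticAt_fun_prod _ fun i _ => ?_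
  simp only [symOf_apply]
  exact (ContinuousLinearMap.proj (R := ℝ) (φ := fun _ : SymIdx m => ℝ) _).analyticAt y

/-- Analyticity in the exponent is included so that Cayley's constant becomes an analytic function
of `s`; the continuation argument then needs no product formula for it. -/
lemma analyticAt_detExp_joint (A : Matrix (Fin m) (Fin m) ℝ) (s : ℝ) {y : SymIdx m → ℝ}
    (hy : y ∈ posCone m) :
    AnalyticAt ℝ (fun p : ℝ × (SymIdx m → ℝ) => detExp p.1 A p.2) (s, y) := by
  have h1 : AnalyticAt ℝ (fun p : ℝ × (SymIdx m → ℝ) => dt p.2) (s, y) :=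
    (analyticAt_dt y).comp_of_eq analyticAt_snd rfl
  have h2 : AnalyticAt ℝ (fun p : ℝ × (SymIdx m → ℝ) => Real.exp (Real.log (dt p.2) * p.1))
      (s, y) :=
    analyticAt_rexp.comp (((analyticAt_log (dt_pos hy)).comp_of_eq h1 rfl).fun_mul analyticAt_fst)
  have h3 : AnalyticAt ℝ (fun p : ℝ × (SymIdx m → ℝ) =>
      ((Real.exp (Real.log (dt p.2) * p.1) : ℝ) : ℂ)) (s, y) :=
    (Complex.ofRealCLM.analyticAt _).comp h2
  have h4 : AnalyticAt ℝ (fun p : ℝ × (SymIdx m → ℝ) => Complex.exp (negTr A p.2)) (s, y) :=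
    (analyticAt_cexp.restrictScalars (𝕜 := ℝ)).comp
      (f := fun p : ℝ × (SymIdx m → ℝ) => negTr A p.2)
      (((negTr A).analyticAt y).comp_of_eq analyticAt_snd rfl)
  refine (h3.mul h4).congr ?_
  have : ∀ᶠ p : ℝ × (SymIdx m → ℝ) in 𝓝 (s, y), p.2 ∈ posCone m :=
    continuousAt_snd.eventually ((isOpen_posCone m).mem_nhds hy)
  filter_upwards [this] with p hp
  simp only [detExp, Pi.mul_apply, Real.rpow_def_of_pos (dt_pos hp)]

lemma analyticOnNhd_detExp (s : ℝ) (A : Matrix (Fin m) (Fin m) ℝ) :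
    AnalyticOnNhd ℝ (detExp s A) (posCone m) := fun _ hy =>
  (analyticAt_detExp_joint A s hy).comp_of_eq (g := fun p : ℝ × (SymIdx m → ℝ) => detExp p.1 A p.2)
    (f := fun y => (s, y)) (analyticAt_const.prod analyticAt_id) rfl

lemma contDiffOn_detExp (s : ℝ) (A : Matrix (Fin m) (Fin m) ℝ) :
    ContDiffOn ℝ (⊤ : ℕ∞) (detExp s A) (posCone m) :=
  (analyticOnNhd_detExp s A).contDiffOn_of_completeSpace

lemma analyticAt_cDL_joint {U : Set (SymIdx m → ℝ)} {F : ℝ × (SymIdx m → ℝ) → ℂ}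
    (hF : AnalyticOnNhd ℝ F (Prod.snd ⁻¹' U)) (l : List (SymIdx m → ℝ)) :
    AnalyticOnNhd ℝ (fun p => cDL (l.map rp) (fun y => F (p.1, y)) p.2) (Prod.snd ⁻¹' U) := by
  induction l with
  | nil => exact hF
  | cons v l ih =>
    intro p hp
    set G : ℝ × (SymIdx m → ℝ) → ℂ := fun p => cDL (l.map rp) (fun y => F (p.1, y)) p.2 with hG
    -- A derivative in `y` with the exponent fixed is a derivative of the joint function in the
    -- direction `(0, v)`.
    have h1 : AnalyticAt ℝ (fun q => fderiv ℝ G q (0, v)) p :=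
      (ContinuousLinearMap.apply ℝ ℂ ((0 : ℝ), v)).analyticAt _ |>.comp (ih.fderiv p hp)
    refine h1.congr ?_
    filter_upwards [(ih p hp).eventually_analyticAt] with q hq
    have h2 := hq.differentiableAt.hasFDerivAt.hasLineDerivAt ((0 : ℝ), v)
    rw [List.map_cons, cDL_cons, cD_rp, ← h2.lineDeriv]
    simp [lineDeriv, hG]

/-- The constant in Cayley's identity `det(∂_Y) det(Y)^s = c(s) det(Y)^(s-1)`. -/
def cayleyConst (m : ℕ) (s : ℝ) : ℂ := detD (detExp s (0 : Matrix (Fin m) (Fin m) ℝ)) (idY m)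

lemma analyticOnNhd_cayleyConst : AnalyticOnNhd ℝ (cayleyConst m) Set.univ := by
  intro s _
  refine Finset.analyticAt_fun_sum _ fun σ _ => analyticAt_const.mul ?_
  have h := analyticAt_cDL_joint (U := posCone m)
    (F := fun p : ℝ × (SymIdx m → ℝ) => detExp p.1 0 p.2)
    (fun p hp => analyticAt_detExp_joint 0 p.1 hp) (List.ofFn fun i => wdir (σ i) i)
    (s, idY m) idY_mem_posCone
  rw [List.map_ofFn] at h
  exact h.comp_of_eq (f := fun s : ℝ => (s, idY m)) (analyticAt_id.prod analyticAt_const) rfl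

lemma detExp_conjL (s : ℝ) (A g : Matrix (Fin m) (Fin m) ℝ) {y : SymIdx m → ℝ}
    (hy : y ∈ posCone m) :
    detExp s A (conjL g y) = (((g.det ^ 2) ^ s : ℝ) : ℂ) * detExp s (gᵀ * A * g) y := by
  have h1 : dt (conjL g y) = g.det ^ 2 * dt y := by
    rw [dt, symOf_conjL, Matrix.det_mul, Matrix.det_mul, Matrix.det_transpose, dt]; ring
  have h2 : negTr A (conjL g y) = negTr (gᵀ * A * g) y := by
    rw [negTr_apply, negTr_apply, symOf_conjL, ← mul_assoc, Matrix.trace_mul_comm]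
    congr 3
    simp only [mul_assoc]
  rw [detExp, detExp, h1, h2, Real.mul_rpow (sq_nonneg _) (dt_pos hy).le]
  push_cast
  ring

/-- Writing `y = g 1 gᵀ` moves the evaluation to the identity matrix; the factors `det(g)^(2s)` and
`det(g)^(-2)` combine to `det(y)^(s-1)`. So the exponent drops by `1`, although the operator has
order `m`. With `A = 0` this is Cayley's identity. -/
lemma detD_detExp_eq (s : ℝ) (A : Matrix (Fin m) (Fin m) ℝ) {y : SymIdx m → ℝ}
    (hy : y ∈ posCone m) {g : Matrix (Fin m) (Fin m) ℝ} (hg : symOf y = g * gᵀ) :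
    detD (detExp s A) y = ((dt y ^ (s - 1) : ℝ) : ℂ) * detD (detExp s (gᵀ * A * g)) (idY m) := by
  have h1 : conjL g (idY m) = y := by
    rw [← upper_symOf (conjL g _), symOf_conjL, symOf_idY, mul_one, ← hg, upper_symOf]
  have h2 : dt y = g.det ^ 2 := by
    rw [dt, hg, Matrix.det_mul, Matrix.det_transpose, sq]
  have h3 := detD_comp_conjL (isOpen_posCone m) (analyticOnNhd_detExp s A) g (y := idY m)
    (by rwa [h1])
  have h4 : Set.EqOn (fun z => detExp s A (conjL g z))
      (fun z => (((g.det ^ 2) ^ s : ℝ) : ℂ) * detExp s (gᵀ * A * g) z) (posCone m) :=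
    fun z hz => detExp_conjL s A g hz
  rw [detD_congr (isOpen_posCone m) h4 idY_mem_posCone, detD_const_mul, h1, ← h2] at h3
  have h5 : ((g.det : ℂ)) ^ 2 = ((dt y : ℝ) : ℂ) := by rw [h2]; push_cast; rfl
  rw [h5] at h3
  have h6 : ((dt y : ℝ) : ℂ) ≠ 0 := by exact_mod_cast (dt_pos hy).ne'
  rw [Real.rpow_sub_one (dt_pos hy).ne']
  push_cast
  rw [div_mul_eq_mul_div, h3, mul_div_cancel_left₀ _ h6]

/-- Cayley's identity for symmetric matrices, up to the value of the constant. -/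
theorem detD_detExp_zero (s : ℝ) {y : SymIdx m → ℝ} (hy : y ∈ posCone m) :
    detD (detExp s 0) y = ((dt y ^ (s - 1) : ℝ) : ℂ) * cayleyConst m s := by
  obtain ⟨g, hg⟩ := exists_eq_mul_transpose hy.posSemidef
  rw [detD_detExp_eq s 0 hy hg, mul_zero, zero_mul, cayleyConst]

lemma exists_bound_list_sum {ι S : Type*} (L : List ι) (F : ι → S → ℂ) (G : S → ℝ)
    (h : ∀ q ∈ L, ∃ K : ℝ, 0 ≤ K ∧ ∀ a, ‖F q a‖ ≤ K * G a) :
    ∃ K : ℝ, 0 ≤ K ∧ ∀ a, ‖(L.map fun q => F q a).sum‖ ≤ K * G a := by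
  induction L with
  | nil => exact ⟨0, le_rfl, fun a => by simp⟩
  | cons q L ih =>
    obtain ⟨K, hK, h1⟩ := ih fun q hq => h q (List.mem_cons_of_mem _ hq)
    obtain ⟨K', hK', h2⟩ := h q List.mem_cons_self
    refine ⟨K' + K, by positivity, fun a => ?_⟩
    rw [List.map_cons, List.sum_cons, add_mul]
    exact (norm_add_le _ _).trans (add_le_add (h2 a) (h1 a))

lemma length_snd_of_mem_splits {α : Type*} {l : List α} {q : List α × List α}
    (hq : q ∈ splits l) : q.2.length ≤ l.length ∧ ∀ a ∈ q.2, a ∈ l := by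
  induction l generalizing q with
  | nil => simp only [splits, List.mem_singleton] at hq; subst hq; simp
  | cons a l ih =>
    simp only [splits, List.mem_append, List.mem_map] at hq
    rcases hq with ⟨r, hr, rfl⟩ | ⟨r, hr, rfl⟩
    · obtain ⟨h1, h2⟩ := ih hr
      exact ⟨h1.trans (Nat.le_succ _), fun b hb => List.mem_cons_of_mem _ (h2 b hb)⟩
    · obtain ⟨h1, h2⟩ := ih hr
      refine ⟨Nat.succ_le_succ h1, fun b hb => ?_⟩
      rcases List.mem_cons.mp hb with rfl | hb
      · exact List.mem_cons_self
      · exact List.mem_cons_of_mem _ (h2 b hb)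

/-- Uniformity in `A` is the point, since the matrix at the identity is `gᵀ * A * g`, which varies
with `y`. In the Leibniz expansion only the exponential depends on `A`, and each derivative of it
costs a factor bounded by a multiple of `tr A`. -/
lemma exists_bound_cDL_detExp (s : ℝ) (l : List (SymIdx m → ℝ)) :
    ∃ K : ℝ, 0 ≤ K ∧ ∀ A : {A : Matrix (Fin m) (Fin m) ℝ // A.PosSemidef},
      ‖cDL (l.map rp) (detExp s A.1) (idY m)‖ ≤
        K * ((1 + A.1.trace) ^ l.length * Real.exp (-A.1.trace)) := by
  have hf : ContDiffOn ℝ (⊤ : ℕ∞) (fun y : SymIdx m → ℝ => ((dt y ^ s : ℝ) : ℂ)) (posCone m) := by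
    have := contDiffOn_detExp s (0 : Matrix (Fin m) (Fin m) ℝ)
    refine this.congr fun y _ => ?_
    simp [detExp, negTr_apply]
  have he : ∀ A : Matrix (Fin m) (Fin m) ℝ,
      ContDiffOn ℝ (⊤ : ℕ∞) (fun y => Complex.exp (negTr A y)) (posCone m) := fun A =>
    ((negTr A).contDiff.cexp).contDiffOn
  have key : ∀ A : {A : Matrix (Fin m) (Fin m) ℝ // A.PosSemidef},
      cDL (l.map rp) (detExp s A.1) (idY m) = ((splits (l.map rp)).map fun q =>
        cDL q.1 (fun y : SymIdx m → ℝ => ((dt y ^ s : ℝ) : ℂ)) (idY m) *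
          cDL q.2 (fun y => Complex.exp (negTr A.1 y)) (idY m)).sum := fun A =>
    cDL_mul (isOpen_posCone m) (ContDiffOn.iterDiffOn (isOpen_posCone m) hf)
      (ContDiffOn.iterDiffOn (isOpen_posCone m) (he A.1)) _ idY_mem_posCone
  simp only [key]
  have htr : ∀ A : {A : Matrix (Fin m) (Fin m) ℝ // A.PosSemidef}, 0 ≤ A.1.trace :=
    fun A => A.2.trace_nonneg
  refine exists_bound_list_sum _ _ _ fun q hq => ?_
  obtain ⟨hlen, hmem⟩ := length_snd_of_mem_splits hq
  rw [List.length_map] at hlen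
  have hprod : ∀ l' : List (FirstOrder (SymIdx m → ℝ)), (∀ a ∈ l', a ∈ l.map rp) →
      ∃ K : ℝ, 0 ≤ K ∧ ∀ A : {A : Matrix (Fin m) (Fin m) ℝ // A.PosSemidef},
        ‖(l'.map (symb (negTr A.1))).prod‖ ≤ K * (1 + A.1.trace) ^ l'.length := by
    intro l'
    induction l' with
    | nil => exact fun _ => ⟨1, zero_le_one, fun A => by simp⟩
    | cons p l' ih =>
      intro h
      obtain ⟨K, hK, h1⟩ := ih fun a ha => h a (List.mem_cons_of_mem _ ha)
      obtain ⟨v, _, rfl⟩ := List.mem_map.mp (h p List.mem_cons_self)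
      refine ⟨m * ‖v‖ * K, by positivity, fun A => ?_⟩
      have h2 : ‖symb (negTr A.1) (rp v)‖ ≤ m * ‖v‖ * (1 + A.1.trace) := by
        rw [symb_rp, negTr_apply, Complex.norm_real, Real.norm_eq_abs, abs_neg]
        refine (trace_mul_symOf_le A.2 v).trans ?_
        gcongr
        linarith
      rw [List.map_cons, List.prod_cons, norm_mul, List.length_cons, pow_succ]
      have := htr A
      calc _ ≤ (m * ‖v‖ * (1 + A.1.trace)) * (K * (1 + A.1.trace) ^ l'.length) := by
            gcongr; exact h1 A
        _ = _ := by ring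
  obtain ⟨K, hK, h1⟩ := hprod q.2 hmem
  refine ⟨‖cDL q.1 (fun y : SymIdx m → ℝ => ((dt y ^ s : ℝ) : ℂ)) (idY m)‖ * K,
    by positivity, fun A => ?_⟩
  have h2 : ‖Complex.exp (negTr A.1 (idY m))‖ = Real.exp (-A.1.trace) := by
    rw [Complex.norm_exp, negTr_apply, Complex.ofReal_re, symOf_idY, mul_one]
  rw [cDL_cexp, norm_mul, norm_mul, h2, mul_assoc, ← mul_assoc K]
  have := htr A
  gcongr
  refine (h1 A).trans ?_
  gcongr
  linarith

/-- The function `det(∂_Y)(det(Y)^s exp(-tr(AY)))` is `det(Y)^(s-1) exp(-tr(AY))` up to a factor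
of polynomial growth. -/
theorem exists_bound_detD_detExp (s : ℝ) {A : Matrix (Fin m) (Fin m) ℝ} (hA : A.PosSemidef) :
    ∃ K : ℝ, 0 ≤ K ∧ ∀ y ∈ posCone m, ‖detD (detExp s A) y‖ ≤
      K * (dt y ^ (s - 1) * (1 + ‖y‖) ^ m * Real.exp (-(A * symOf y).trace)) := by
  have h1 : ∃ K : ℝ, 0 ≤ K ∧ ∀ B : {B : Matrix (Fin m) (Fin m) ℝ // B.PosSemidef},
      ‖detD (detExp s B.1) (idY m)‖ ≤ K * ((1 + B.1.trace) ^ m * Real.exp (-B.1.trace)) := by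
    choose K hK hle using fun σ : Equiv.Perm (Fin m) =>
      exists_bound_cDL_detExp s (List.ofFn fun i => wdir (m := m) (σ i) i)
    refine ⟨∑ σ, K σ, Finset.sum_nonneg fun σ _ => hK σ, fun B => ?_⟩
    rw [detD, Finset.sum_mul]
    refine (norm_sum_le _ _).trans (Finset.sum_le_sum fun σ _ => ?_)
    have h2 : ‖((Equiv.Perm.sign σ : ℤ) : ℂ)‖ = 1 := by
      rcases Int.units_eq_one_or (Equiv.Perm.sign σ) with h | h <;> simp [h]
    have h3 := hle σ B
    rw [List.map_ofFn, List.length_ofFn] at h3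
    rw [norm_mul, h2, one_mul]
    exact h3
  obtain ⟨K, hK, hle⟩ := h1
  have hAtr := hA.trace_nonneg
  refine ⟨K * (1 + m * A.trace) ^ m, by positivity, fun y hy => ?_⟩
  obtain ⟨g, hg⟩ := exists_eq_mul_transpose hy.posSemidef
  have hB : (gᵀ * A * g).PosSemidef := by
    have := hA.conjTranspose_mul_mul_same g
    rwa [Matrix.conjTranspose_eq_transpose_of_trivial] at this
  have htr : (gᵀ * A * g).trace = (A * symOf y).trace := by
    rw [hg, mul_assoc, Matrix.trace_mul_comm, mul_assoc]
  have h2 := hle ⟨_, hB⟩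
  simp only [htr] at h2
  have h0 : 0 ≤ (A * symOf y).trace := trace_mul_nonneg hA hy.posSemidef
  have h3 : 1 + (A * symOf y).trace ≤ (1 + m * A.trace) * (1 + ‖y‖) := by
    have := (le_abs_self _).trans (trace_mul_symOf_le hA y)
    have : 0 ≤ m * A.trace := by positivity
    nlinarith [norm_nonneg y]
  have hr := Real.rpow_nonneg (dt_pos hy).le (s - 1)
  rw [detD_detExp_eq s A hy hg, norm_mul, Complex.norm_real, Real.norm_of_nonneg hr]
  calc _ ≤ dt y ^ (s - 1) * (K * ((1 + (A * symOf y).trace) ^ m *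
          Real.exp (-(A * symOf y).trace))) := by gcongr
    _ ≤ dt y ^ (s - 1) * (K * (((1 + m * A.trace) * (1 + ‖y‖)) ^ m *
          Real.exp (-(A * symOf y).trace))) := by gcongr
    _ = _ := by rw [mul_pow]; ring

end DetExp

/-! ### Integration by parts over the cone -/

section ByParts

variable {m : ℕ}

lemma hasTemperateGrowth_fderiv_apply {E : Type*} [NormedAddCommGroup E] [NormedSpace ℝ E]
    {p : E → ℂ} (hp : p.HasTemperateGrowth) (v : E) :
    (fun y => fderiv ℝ p y v).HasTemperateGrowth := by
  have h1 : (fderiv ℝ p).HasTemperateGrowth := by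
    refine ⟨hp.1.fderiv_right (by simp), fun n => ?_⟩
    obtain ⟨k, C, h⟩ := hp.2 (n + 1)
    exact ⟨k, C, fun x => by rw [norm_iteratedFDeriv_fderiv]; exact h x⟩
  exact (ContinuousLinearMap.apply ℝ ℂ v).hasTemperateGrowth.comp h1

lemma hasTemperateGrowth_dt :
    (fun y : SymIdx m → ℝ => ((dt y : ℝ) : ℂ)).HasTemperateGrowth := by
  have h : (fun y : SymIdx m → ℝ => ((dt y : ℝ) : ℂ)) =
      fun y => ∑ σ : Equiv.Perm (Fin m),
        ((Equiv.Perm.sign σ : ℤ) : ℂ) * ∏ i, ((symOf y (σ i) i : ℝ) : ℂ) := by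
    funext y
    rw [dt, Matrix.det_apply']
    push_cast
    rfl
  rw [h]
  refine Function.HasTemperateGrowth.sum fun σ _ =>
    (Function.HasTemperateGrowth.const _).mul ?_
  have : ∀ s : Finset (Fin m), (fun y : SymIdx m → ℝ =>
      ∏ i ∈ s, ((symOf y (σ i) i : ℝ) : ℂ)).HasTemperateGrowth := by
    intro s
    induction s using Finset.induction_on with
    | empty => simp
    | insert i s hi ih =>
      simp only [Finset.prod_insert hi]
      refine Function.HasTemperateGrowth.mul ?_ ih
      simp only [symOf_apply]
      exact (Complex.ofRealCLM ∘L
        (ContinuousLinearMap.proj (R := ℝ) (φ := fun _ : SymIdx m => ℝ) _)).hasTemperateGrowth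
  exact this _

/-- Functions on the cone of the form `p(y) det(y)^β exp(-tr(A y))` with `p` of temperate
growth. -/
def ConeClass (β : ℝ) (A : Matrix (Fin m) (Fin m) ℝ) (G : (SymIdx m → ℝ) → ℂ) : Prop :=
  ∃ p : (SymIdx m → ℝ) → ℂ, p.HasTemperateGrowth ∧ ∀ y ∈ posCone m, G y = p y * detExp β A y

variable {β γ : ℝ} {A : Matrix (Fin m) (Fin m) ℝ} {G H : (SymIdx m → ℝ) → ℂ}

lemma coneClass_detExp (β : ℝ) (A : Matrix (Fin m) (Fin m) ℝ) : ConeClass β A (detExp β A) :=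
  ⟨fun _ => 1, Function.HasTemperateGrowth.const 1, fun _ _ => (one_mul _).symm⟩

lemma detExp_zero_mul {y : SymIdx m → ℝ} (hy : y ∈ posCone m) (β γ : ℝ)
    (A : Matrix (Fin m) (Fin m) ℝ) : detExp β A y * detExp γ 0 y = detExp (β + γ) A y := by
  have h0 : negTr (0 : Matrix (Fin m) (Fin m) ℝ) y = 0 := by simp [negTr_apply]
  rw [detExp, detExp, detExp, Real.rpow_add (dt_pos hy), h0, Complex.exp_zero]
  push_cast
  ring

lemma ConeClass.mul (hG : ConeClass β A G) (hH : ConeClass γ 0 H) :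
    ConeClass (β + γ) A (fun y => G y * H y) := by
  obtain ⟨p, hp, h1⟩ := hG
  obtain ⟨q, hq, h2⟩ := hH
  refine ⟨fun y => p y * q y, hp.mul hq, fun y hy => ?_⟩
  beta_reduce
  rw [h1 y hy, h2 y hy, ← detExp_zero_mul hy]
  ring

lemma ConeClass.contDiffOn (hG : ConeClass β A G) : ContDiffOn ℝ (⊤ : ℕ∞) G (posCone m) := by
  obtain ⟨p, hp, h1⟩ := hG
  exact (hp.1.contDiffOn.mul (contDiffOn_detExp β A)).congr h1

lemma hasLineDerivAt_dt_rpow {y : SymIdx m → ℝ} (hy : y ∈ posCone m) (v : SymIdx m → ℝ) (β : ℝ) :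
    HasLineDerivAt ℝ (fun y => ((dt y ^ β : ℝ) : ℂ))
      (β * ((dt y ^ (β - 1) : ℝ) : ℂ) *
        fderiv ℝ (fun y : SymIdx m → ℝ => ((dt y : ℝ) : ℂ)) y v) y v := by
  have h1 : HasFDerivAt dt (fderiv ℝ dt y) y := (analyticAt_dt y).differentiableAt.hasFDerivAt
  have h2 := Complex.ofRealCLM.hasFDerivAt.comp y h1
  have h3 := Complex.ofRealCLM.hasFDerivAt.comp y
    (h1.rpow_const (p := β) (Or.inl (dt_pos hy).ne'))
  have h4 := h3.hasLineDerivAt v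
  have h5 : fderiv ℝ (fun y : SymIdx m → ℝ => ((dt y : ℝ) : ℂ)) y v = (fderiv ℝ dt y v : ℝ) := by
    have : fderiv ℝ (fun y : SymIdx m → ℝ => ((dt y : ℝ) : ℂ)) y =
      Complex.ofRealCLM ∘L fderiv ℝ dt y := h2.fderiv
    rw [this]; rfl
  rw [h5]
  refine HasDerivAt.congr_deriv h4 ?_
  simp [mul_assoc]

/-- A crude count, one power of the determinant per derivative. It suffices wherever the exponent
can be taken large; the sharp loss for `det(∂_Y)` comes from covariance instead. -/
lemma ConeClass.cD (hG : ConeClass β A G) (v : SymIdx m → ℝ) :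
    ConeClass (β - 1) A (cD (rp v) G) := by
  obtain ⟨p, hp, h1⟩ := hG
  set d : (SymIdx m → ℝ) → ℂ := fun y => ((dt y : ℝ) : ℂ) with hd
  refine ⟨fun y => β * fderiv ℝ d y v * p y + d y * fderiv ℝ p y v + d y * p y * negTr A v, ?_, ?_⟩
  · have hdt : d.HasTemperateGrowth := hasTemperateGrowth_dt
    exact ((((Function.HasTemperateGrowth.const _).mul (hasTemperateGrowth_fderiv_apply hdt v)).mul
      hp).add (hdt.mul (hasTemperateGrowth_fderiv_apply hp v))).add
      ((hdt.mul hp).mul (Function.HasTemperateGrowth.const _))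
  · intro y hy
    rw [cD_congr (isOpen_posCone m) h1 _ hy, cD_rp]
    have hpd : HasLineDerivAt ℝ p (fderiv ℝ p y v) y v :=
      (hp.1.differentiable (by simp) y).hasFDerivAt.hasLineDerivAt v
    have h2 := HasLineDerivAt.mul' hpd
      (HasLineDerivAt.mul' (hasLineDerivAt_dt_rpow hy v β) (hasLineDerivAt_cexp (negTr A) y v))
    have h3 : HasLineDerivAt ℝ (fun y => p y * detExp β A y) _ y v := h2
    rw [h3.lineDeriv, detExp]
    have h4 : ((dt y ^ β : ℝ) : ℂ) = d y * ((dt y ^ (β - 1) : ℝ) : ℂ) := by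
      rw [hd, ← Complex.ofReal_mul, Real.rpow_sub_one (dt_pos hy).ne']
      congr 1
      field_simp [(dt_pos hy).ne']
    rw [h4]
    ring

lemma ConeClass.cDL (hG : ConeClass β A G) (l : List (SymIdx m → ℝ)) :
    ConeClass (β - l.length) A (cDL (l.map rp) G) := by
  induction l with
  | nil => simpa using hG
  | cons v l ih =>
    have := ih.cD v
    rw [List.map_cons, cDL_cons, List.length_cons]
    convert this using 1
    push_cast
    ring

lemma norm_detExp {y : SymIdx m → ℝ} (hy : y ∈ posCone m) (β : ℝ)
    (A : Matrix (Fin m) (Fin m) ℝ) :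
    ‖detExp β A y‖ = dt y ^ β * Real.exp (-(A * symOf y).trace) := by
  rw [detExp, norm_mul, Complex.norm_exp, negTr_apply, Complex.ofReal_re, Complex.norm_real,
    Real.norm_of_nonneg (Real.rpow_nonneg (dt_pos hy).le β)]

lemma ConeClass.exists_bound (hG : ConeClass β A G) : ∃ (N : ℕ) (K : ℝ), 0 ≤ K ∧
    ∀ y ∈ posCone m,
      ‖G y‖ ≤ K * (dt y ^ β * (1 + ‖y‖) ^ N * Real.exp (-(A * symOf y).trace)) := by
  obtain ⟨p, hp, h1⟩ := hG
  obtain ⟨N, K, h2⟩ := hp.2 0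
  have h3 : ∀ y, ‖p y‖ ≤ K * (1 + ‖y‖) ^ N := fun y => by
    simpa using h2 y
  refine ⟨N, K, ?_, fun y hy => ?_⟩
  · have := (norm_nonneg _).trans (h3 0); simpa using this
  · rw [h1 y hy, norm_mul, norm_detExp hy]
    have := Real.rpow_nonneg (dt_pos hy).le β
    calc _ ≤ K * (1 + ‖y‖) ^ N * (dt y ^ β * Real.exp (-(A * symOf y).trace)) := by
          gcongr; exact h3 y
      _ = _ := by ring

/-- A continuous function on the cone dominated by `det(y)^β (1 + |y|)^N exp(-tr(A y))` is
integrable if `β > -1/m`. -/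
lemma integrableOn_of_bound (hm : 0 < m) (hβ : -1 < m * β) (hA : A.PosDef)
    (hG : ContinuousOn G (posCone m)) {N : ℕ} {K : ℝ} (hK : 0 ≤ K)
    (h : ∀ y ∈ posCone m,
      ‖G y‖ ≤ K * (dt y ^ β * (1 + ‖y‖) ^ N * Real.exp (-(A * symOf y).trace))) :
    IntegrableOn G (posCone m) := by
  obtain ⟨c, hc, hle⟩ := exists_norm_le_trace_mul hA
  refine ((integrableOn_dt_rpow hm hβ hc N).const_mul K).mono'
    (hG.aestronglyMeasurable measurableSet_posCone) ?_
  refine (ae_restrict_iff' measurableSet_posCone).mpr (Eventually.of_forall fun y hy => ?_)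
  refine (h y hy).trans ?_
  have := Real.rpow_nonneg (dt_pos hy).le β
  gcongr
  linarith [hle y hy]

lemma ConeClass.integrableOn (hm : 0 < m) (hA : A.PosDef) (hG : ConeClass β A G)
    (hβ : -1 < m * β) : IntegrableOn G (posCone m) := by
  obtain ⟨N, K, hK, h⟩ := hG.exists_bound
  exact integrableOn_of_bound hm hβ hA hG.contDiffOn.continuousOn hK h

lemma dt_eq_zero_of_mem_closure {x : SymIdx m → ℝ} (hx : x ∉ posCone m)
    (hx' : x ∈ closure (posCone m)) : dt x = 0 := by
  have hpsd : (symOf x).PosSemidef := by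
    refine Matrix.PosSemidef.of_dotProduct_mulVec_nonneg (isHermitian_symOf x) fun w => ?_
    have hc : Continuous fun y : SymIdx m → ℝ => star w ⬝ᵥ (symOf y *ᵥ w) := by
      have : Continuous fun y : SymIdx m → ℝ => symOf y :=
        (symOfL m ℝ).continuous_of_finiteDimensional
      fun_prop
    have hcl : IsClosed {y : SymIdx m → ℝ | 0 ≤ star w ⬝ᵥ (symOf y *ᵥ w)} :=
      isClosed_le continuous_const hc
    have hsub : posCone m ⊆ {y : SymIdx m → ℝ | 0 ≤ star w ⬝ᵥ (symOf y *ᵥ w)} := fun y hy =>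
      (mem_posCone.mp hy).posSemidef.dotProduct_mulVec_nonneg w
    exact closure_minimal hsub hcl hx'
  by_contra h
  exact hx (hpsd.posDef_iff_det_ne_zero.mpr h)

/-- Extension by zero stays differentiable at the boundary: the determinant vanishes there and is
`O(t)` along any line, so with exponent at least `2` the function is `O(t^2)`. This is why
integration by parts leaves no boundary term. -/
lemma ConeClass.hasLineDerivAt_indicator (hA : A.PosSemidef) (hG : ConeClass β A G) (hβ : 2 ≤ β)
    (x v : SymIdx m → ℝ) :
    HasLineDerivAt ℝ ((posCone m).indicator G)
      ((posCone m).indicator (SiegelSturm.cD (rp v) G) x) x v := by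
  by_cases hx : x ∈ posCone m
  · rw [Set.indicator_of_mem hx, cD_rp]
    have h1 : HasLineDerivAt ℝ G (lineDeriv ℝ G x v) x v :=
      (((hG.contDiffOn.differentiableOn (by simp)).differentiableAt
        ((isOpen_posCone m).mem_nhds hx)).lineDifferentiableAt).hasLineDerivAt
    refine h1.congr_of_eventuallyEq ?_
    filter_upwards [(isOpen_posCone m).mem_nhds hx] with y hy
    exact Set.indicator_of_mem hy _
  · rw [Set.indicator_of_notMem hx]
    have hlin : Continuous fun t : ℝ => x + t • v := by fun_prop
    by_cases hx' : x ∈ closure (posCone m)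
    · have hd0 := dt_eq_zero_of_mem_closure hx hx'
      have hO : (fun t : ℝ => (posCone m).indicator G (x + t • v)) =O[𝓝 0]
          fun t : ℝ => ‖t - 0‖ ^ 2 := by
        obtain ⟨N, K, hK, hle⟩ := hG.exists_bound
        have h1 : (fun t : ℝ => dt (x + t • v)) =O[𝓝 0] fun t : ℝ => t := by
          have := ((analyticAt_dt x).differentiableAt.hasFDerivAt.hasLineDerivAt v)
          have h2 := HasDerivAt.isBigO_sub this
          simpa [hd0] using h2
        obtain ⟨c, hc, h2⟩ := h1.exists_pos
        refine Asymptotics.IsBigO.of_bound (K * (c ^ 2 * (2 + ‖x‖) ^ N)) ?_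
        have h3 : ∀ᶠ t : ℝ in 𝓝 0, dt (x + t • v) < 1 := by
          refine (continuous_dt.comp hlin).continuousAt.eventually_lt continuousAt_const ?_
          simp [hd0]
        have h4 : ∀ᶠ t : ℝ in 𝓝 0, ‖x + t • v‖ < 1 + ‖x‖ := by
          refine (hlin.norm).continuousAt.eventually_lt continuousAt_const ?_
          simp
        filter_upwards [h2.bound, h3, h4] with t ht h3 h4
        by_cases hy : x + t • v ∈ posCone m
        · rw [Set.indicator_of_mem hy]
          refine (hle _ hy).trans ?_
          rw [mul_assoc K]
          have hp := dt_pos hy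
          have h5 : dt (x + t • v) ^ β ≤ dt (x + t • v) ^ 2 := by
            rw [← Real.rpow_two]
            exact Real.rpow_le_rpow_of_exponent_ge hp h3.le hβ
          have h6 : dt (x + t • v) ^ 2 ≤ (c * ‖t‖) ^ 2 := by
            rw [Real.norm_of_nonneg hp.le] at ht
            gcongr
          have h7 : Real.exp (-(A * symOf (x + t • v)).trace) ≤ 1 :=
            Real.exp_le_one_iff.mpr (neg_nonpos.mpr (trace_mul_nonneg hA hy.posSemidef))
          have h8 : (1 + ‖x + t • v‖) ^ N ≤ (2 + ‖x‖) ^ N := by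
            refine pow_le_pow_left₀ (by positivity) (by linarith) N
          have h9 := Real.rpow_nonneg hp.le β
          refine mul_le_mul_of_nonneg_left ?_ hK
          calc dt (x + t • v) ^ β * (1 + ‖x + t • v‖) ^ N *
                Real.exp (-(A * symOf (x + t • v)).trace)
              ≤ (c * ‖t‖) ^ 2 * (2 + ‖x‖) ^ N * 1 := by
                gcongr
                exact h5.trans h6
            _ = c ^ 2 * (2 + ‖x‖) ^ N * ‖‖t - 0‖ ^ 2‖ := by
                rw [sub_zero, norm_pow, norm_norm]; ring
        · rw [Set.indicator_of_notMem hy, norm_zero]; positivity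
      have h0 := (Asymptotics.IsBigO.hasFDerivAt (𝕜 := ℝ) hO one_lt_two).hasDerivAt
      simpa [HasLineDerivAt] using h0
    · have h1 : (fun t : ℝ => (posCone m).indicator G (x + t • v)) =ᶠ[𝓝 0] fun _ => 0 := by
        have : ∀ᶠ t : ℝ in 𝓝 0, x + t • v ∈ (closure (posCone m))ᶜ := by
          refine hlin.continuousAt.eventually (isClosed_closure.isOpen_compl.mem_nhds ?_)
          simpa using hx'
        filter_upwards [this] with t ht
        exact Set.indicator_of_notMem (fun h => ht (subset_closure h)) _
      exact (hasDerivAt_const (0 : ℝ) (0 : ℂ)).congr_of_eventuallyEq h1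

lemma ConeClass.integral_cD_eq_zero (hm : 0 < m) (hA : A.PosDef) (hG : ConeClass β A G)
    (hβ : 2 ≤ β) (v : SymIdx m → ℝ) : ∫ y in posCone m, SiegelSturm.cD (rp v) G y = 0 := by
  have hm' : (1 : ℝ) ≤ m := by exact_mod_cast hm
  have hi1 := hG.integrableOn hm hA (by nlinarith)
  have hi2 := (hG.cD v).integrableOn hm hA (by nlinarith)
  rw [← integrable_indicator_iff measurableSet_posCone] at hi1 hi2
  -- Integration by parts on the whole coordinate space, for the zero extension against the constant
  -- `1`.
  have key := integral_bilinear_hasLineDerivAt_right_eq_neg_left_of_integrable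
    (μ := (volume : Measure (SymIdx m → ℝ))) (B := ContinuousLinearMap.mul ℝ ℂ)
    (f := (posCone m).indicator G) (f' := (posCone m).indicator (SiegelSturm.cD (rp v) G))
    (g := fun _ => 1) (g' := fun _ => 0) (v := v)
    (by simpa using hi2) (by simp) (by simpa using hi1)
    (fun x _ => hG.hasLineDerivAt_indicator hA.posSemidef hβ x v)
    (fun x _ => hasDerivAt_const (0 : ℝ) (1 : ℂ))
  simp only [ContinuousLinearMap.mul_apply', mul_zero, integral_zero, mul_one] at key
  rw [integral_indicator measurableSet_posCone] at key
  exact neg_eq_zero.mp key.symm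

/-- Derivatives cross over one at a time, outermost first, hence the reversed order. The bound on `β
+ γ` keeps the exponent of the product at least `2` at every crossing, as the vanishing of boundary
terms demands. -/
lemma integral_cDL_mul (hm : 0 < m) (hA : A.PosDef) (hG : ConeClass β A G)
    (l : List (SymIdx m → ℝ)) (hH : ConeClass γ 0 H) (hβ : l.length + 1 ≤ β + γ) :
    ∫ y in posCone m, cDL (l.map rp) G y * H y =
      (-1) ^ l.length * ∫ y in posCone m, G y * SiegelSturm.cDL (l.reverse.map rp) H y := by
  have hm' : (1 : ℝ) ≤ m := by exact_mod_cast hm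
  induction l generalizing H γ with
  | nil => simp
  | cons v l ih =>
    rw [List.length_cons] at hβ ⊢
    push_cast at hβ
    have h1 := hG.cDL l
    have h2 := h1.mul hH
    have h3 := h2.integral_cD_eq_zero hm hA (by linarith) v
    have h4 : Set.EqOn (SiegelSturm.cD (rp v) fun y => SiegelSturm.cDL (l.map rp) G y * H y)
        (fun y => SiegelSturm.cDL ((v :: l).map rp) G y * H y +
          SiegelSturm.cDL (l.map rp) G y * SiegelSturm.cD (rp v) H y) (posCone m) := by
      intro y hy
      have hd := fun {F : (SymIdx m → ℝ) → ℂ} (hF : ContDiffOn ℝ (⊤ : ℕ∞) F (posCone m)) =>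
        (((hF.differentiableOn (by simp)).differentiableAt
          ((isOpen_posCone m).mem_nhds hy)).lineDifferentiableAt (v := v)).hasLineDerivAt
      rw [cD_rp, (HasLineDerivAt.mul' (hd h1.contDiffOn) (hd hH.contDiffOn)).lineDeriv,
        List.map_cons, cDL_cons]
      simp only [cD_rp]
    have h5 : ConeClass (β - l.length - 1 + γ) A
        (fun y => SiegelSturm.cDL ((v :: l).map rp) G y * H y) := by
      rw [List.map_cons, cDL_cons]
      exact (h1.cD v).mul hH
    have h6 := h1.mul (hH.cD v)
    rw [setIntegral_congr_fun measurableSet_posCone h4,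
      integral_add (h5.integrableOn hm hA (by nlinarith)) (h6.integrableOn hm hA (by nlinarith)),
      ih (hH.cD v) (by linarith)] at h3
    rw [eq_neg_of_add_eq_zero_left h3, List.reverse_cons, List.map_append, pow_succ]
    simp only [cDL_append, List.map_cons, List.map_nil, cDL_cons, cDL_nil]
    ring

lemma cDL_reverse_ofFn {U : Set (SymIdx m → ℝ)} (hU : IsOpen U) {f : (SymIdx m → ℝ) → ℂ}
    (hf : AnalyticOnNhd ℝ f U) {n : ℕ} (v : Fin n → SymIdx m → ℝ) {y : SymIdx m → ℝ} (hy : y ∈ U) :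
    cDL ((List.ofFn v).reverse.map rp) f y = cDL ((List.ofFn v).map rp) f y := by
  have h1 : (List.ofFn v).reverse = List.ofFn (v ∘ Fin.rev) := by
    refine List.ext_getElem (by simp) fun i h1 h2 => ?_
    simp only [List.getElem_reverse, List.getElem_ofFn, Function.comp]
    congr 1
    ext
    simp [Fin.rev]
    omega
  have hs : ContDiffOn ℝ (⊤ : ℕ∞) f U := hf.contDiffOn_of_completeSpace
  rw [h1, List.map_ofFn, List.map_ofFn]
  have h2 := cDL_ofFn_eq_iteratedFDeriv hU hs n (v ∘ Fin.rev) hy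
  have h3 := cDL_ofFn_eq_iteratedFDeriv hU hs n v hy
  have h4 := (hf y hy).contDiffAt.iteratedFDeriv_comp_perm v Fin.revPerm
  exact h2.trans (h4.trans h3.symm)

/-- The formal adjoint of `det(∂_Y)` is `(-1)^m det(∂_Y)`. -/
theorem integral_detD_mul_detExp (hm : 0 < m) (hA : A.PosDef) {α s : ℝ} (hs : m + 1 ≤ α + s) :
    ∫ y in posCone m, detD (detExp α A) y * detExp s 0 y =
      (-1) ^ m * ∫ y in posCone m, detExp α A y * detD (detExp s 0) y := by
  have hm' : (1 : ℝ) ≤ m := by exact_mod_cast hm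
  have hint1 : ∀ l : List (SymIdx m → ℝ), l.length = m → IntegrableOn
      (fun y => cDL (l.map rp) (detExp α A) y * detExp s 0 y) (posCone m) := fun l hl =>
    (((coneClass_detExp α A).cDL l).mul (coneClass_detExp s 0)).integrableOn hm hA
      (by rw [hl]; nlinarith)
  have hint2 : ∀ l : List (SymIdx m → ℝ), l.length = m → IntegrableOn
      (fun y => detExp α A y * cDL (l.map rp) (detExp s 0) y) (posCone m) := fun l hl =>
    ((coneClass_detExp α A).mul ((coneClass_detExp s 0).cDL l)).integrableOn hm hA
      (by rw [hl]; nlinarith)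
  simp only [detD, Finset.sum_mul, Finset.mul_sum]
  have hof : ∀ σ : Equiv.Perm (Fin m), (List.ofFn fun i => rp (wdir (σ i) i)) =
      (List.ofFn fun i => wdir (σ i) i).map rp := fun σ => by rw [List.map_ofFn]; rfl
  simp only [hof, mul_assoc, mul_left_comm (detExp α A _)]
  rw [integral_finsetSum _ fun σ _ => (hint1 _ (by simp)).const_mul _,
    integral_finsetSum _ fun σ _ => (hint2 _ (by simp)).const_mul _, Finset.mul_sum]
  refine Finset.sum_congr rfl fun σ _ => ?_
  rw [integral_const_mul, integral_const_mul,
    integral_cDL_mul hm hA (coneClass_detExp α A) _ (coneClass_detExp s 0) (by simpa using hs),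
    mul_left_comm, List.length_ofFn]
  congr 2
  refine setIntegral_congr_fun measurableSet_posCone fun y hy => ?_
  rw [cDL_reverse_ofFn (isOpen_posCone m) (analyticOnNhd_detExp s 0) _ hy]

end ByParts

/-! ### The zero of Cayley's constant at `(1 - m) / 2` -/

section Gaussian

variable {m : ℕ}

/-- Moving from `y` to `y - η • 1` inside the cone raises the exponent by `η tr(W)`. Both the effect
of a small displacement and the norm of the functional are bounded by multiples of `tr(W)`,
uniformly in `W`. -/
lemma laplaceDominated_negTr {Ω : Type*} (W : Ω → Matrix (Fin m) (Fin m) ℝ)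
    (hW : ∀ ω, (W ω).PosSemidef) : LaplaceDominated (posCone m) fun ω => negTr (W ω) := by
  intro y hy
  obtain ⟨η, hη, h⟩ := exists_posDef_sub_smul hy
  -- Of the `2m + 1` parts of `η`, `m` pay for the displacement `w`, `m` for `δ * ‖negTr (W ω)‖`,
  -- and one is to spare.
  refine ⟨η / (2 * m + 1), by positivity, y - η • idY m, ?_, fun ω w hw => ?_⟩
  · rwa [mem_posCone, symOf_sub, symOf_smul, symOf_idY]
  · have htr := (hW ω).trace_nonneg
    have h1 : ‖negTr (W ω)‖ ≤ m * (W ω).trace := by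
      refine ContinuousLinearMap.opNorm_le_bound _ (by positivity) fun v => ?_
      rw [negTr_apply, Complex.norm_real, Real.norm_eq_abs, abs_neg]
      exact (trace_mul_symOf_le (hW ω) v).trans (le_of_eq (by ring))
    have h2 := (abs_le.mp (trace_mul_symOf_le (hW ω) w)).1
    rw [le_div_iff₀ (by positivity)] at hw
    have h3 : η / (2 * m + 1) * (2 * m + 1) = η := div_mul_cancel₀ _ (by positivity)
    set δ := η / (2 * m + 1)
    have hδ : 0 < δ := by positivity
    have hw' : ‖w‖ ≤ δ := by
      have : (0 : ℝ) < 2 * m + 1 := by positivity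
      nlinarith
    simp only [negTr_apply, Complex.ofReal_re, symOf_add, symOf_sub, symOf_smul, symOf_idY,
      mul_add, mul_sub, Matrix.trace_add, Matrix.trace_sub, mul_smul_comm, mul_one,
      Matrix.trace_smul, smul_eq_mul]
    have h4 : m * ‖w‖ * (W ω).trace ≤ m * δ * (W ω).trace := by gcongr
    have h5 : δ * ‖negTr (W ω)‖ ≤ δ * (m * (W ω).trace) := by gcongr
    have h6 : η * (W ω).trace = 2 * (m * δ * (W ω).trace) + δ * (W ω).trace := by
      rw [← h3]; ring
    have h7 : 0 ≤ δ * (W ω).trace := by positivity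
    nlinarith

lemma quadForm_mul_transpose (B : Matrix (Fin m) (Fin m) ℝ) (v : Fin m → ℝ) :
    v ⬝ᵥ ((B * Bᵀ) *ᵥ v) = (Bᵀ *ᵥ v) ⬝ᵥ (Bᵀ *ᵥ v) := by
  rw [← Matrix.mulVec_mulVec, Matrix.dotProduct_mulVec, Matrix.mulVec_transpose]

lemma integrable_exp_neg_dotProduct_self (m : ℕ) :
    Integrable fun v : Fin m → ℝ => Real.exp (-(v ⬝ᵥ v)) := by
  have h : (fun v : Fin m → ℝ => Real.exp (-(v ⬝ᵥ v))) =
      fun v => ∏ i, Real.exp (-1 * v i ^ 2) := by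
    funext v
    rw [← Real.exp_sum, dotProduct, ← Finset.sum_neg_distrib]
    exact congrArg _ (Finset.sum_congr rfl fun i _ => by ring)
  rw [h]
  exact Integrable.fintype_prod fun _ => integrable_exp_neg_mul_sq one_pos

/-- The Gaussian integral attached to a positive definite matrix. -/
lemma gaussian_integral {y : SymIdx m → ℝ} (hy : y ∈ posCone m) :
    Integrable (fun v : Fin m → ℝ => Real.exp (-(v ⬝ᵥ (symOf y *ᵥ v)))) ∧
    ∫ v : Fin m → ℝ, Real.exp (-(v ⬝ᵥ (symOf y *ᵥ v))) =
      dt y ^ (-(1 / 2) : ℝ) * ∫ v : Fin m → ℝ, Real.exp (-(v ⬝ᵥ v)) := by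
  obtain ⟨B, hB⟩ := exists_eq_mul_transpose hy.posSemidef
  have hd : dt y = B.det ^ 2 := by rw [dt, hB, Matrix.det_mul, Matrix.det_transpose, sq]
  have hB0 : Bᵀ.det ≠ 0 := by
    rw [Matrix.det_transpose]
    intro h
    have := dt_pos hy
    rw [hd, h] at this
    simp at this
  have hmap := Real.map_matrix_volume_pi_eq_smul_volume_pi hB0
  have hmeas : Measurable (toLin' Bᵀ) :=
    (LinearMap.continuous_of_finiteDimensional (toLin' Bᵀ)).measurable
  have hf : (fun v : Fin m → ℝ => Real.exp (-(v ⬝ᵥ (symOf y *ᵥ v)))) =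
      (fun v => Real.exp (-(v ⬝ᵥ v))) ∘ toLin' Bᵀ := by
    funext v
    rw [hB, quadForm_mul_transpose]; rfl
  have hcont : Continuous fun v : Fin m → ℝ => Real.exp (-(v ⬝ᵥ v)) := by fun_prop
  constructor
  · rw [hf]
    refine (integrable_map_measure ?_ hmeas.aemeasurable).mp ?_
    · exact hcont.aestronglyMeasurable
    · rw [hmap]
      exact (integrable_exp_neg_dotProduct_self m).smul_measure ENNReal.ofReal_ne_top
  · have h1 := integral_map (μ := volume) hmeas.aemeasurable
      (f := fun v : Fin m → ℝ => Real.exp (-(v ⬝ᵥ v))) hcont.aestronglyMeasurable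
    rw [hf]
    simp only [Function.comp_def]
    rw [← h1, hmap, integral_smul_measure, ENNReal.toReal_ofReal (abs_nonneg _), smul_eq_mul]
    congr 1
    rw [Real.rpow_neg (dt_pos hy).le, ← Real.sqrt_eq_rpow, hd, Real.sqrt_sq_eq_abs, abs_inv,
      Matrix.det_transpose]

/-- The Gram matrix `xᵀ x` of a tuple of vectors. -/
def gramMat {n : ℕ} (x : Fin n → Fin m → ℝ) : Matrix (Fin m) (Fin m) ℝ :=
  (Matrix.of x)ᵀ * Matrix.of x

lemma gramMat_posSemidef {n : ℕ} (x : Fin n → Fin m → ℝ) : (gramMat x).PosSemidef := by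
  have := Matrix.posSemidef_conjTranspose_mul_self (Matrix.of x)
  rwa [Matrix.conjTranspose_eq_transpose_of_trivial] at this

lemma det_gramMat_eq_zero {n : ℕ} (hn : n < m) (x : Fin n → Fin m → ℝ) :
    (gramMat x).det = 0 := by
  by_contra h
  have h1 : IsUnit (gramMat x) := (Matrix.isUnit_iff_isUnit_det _).mpr (isUnit_iff_ne_zero.mpr h)
  have h2 := Matrix.rank_of_isUnit _ h1
  have h3 : (gramMat x).rank ≤ n := by
    refine (Matrix.rank_mul_le_right _ _).trans ?_
    simpa using Matrix.rank_le_card_height (Matrix.of x)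
  rw [h2, Fintype.card_fin] at h3
  omega

lemma trace_gramMat_mul {n : ℕ} (x : Fin n → Fin m → ℝ) (Y : Matrix (Fin m) (Fin m) ℝ) :
    (gramMat x * Y).trace = ∑ j, x j ⬝ᵥ (Y *ᵥ x j) := by
  rw [gramMat, Matrix.mul_assoc, Matrix.trace_mul_comm, Matrix.trace]
  refine Finset.sum_congr rfl fun j _ => ?_
  rw [Matrix.diag_apply, Matrix.mul_apply, dotProduct_mulVec, dotProduct]
  rfl

/-- The Gaussian factors over the `n` vectors and each contributes `det(y)^(-1/2)`. This exhibits
`det(y)^(-n/2)` as a Laplace transform supported on matrices of rank at most `n`. -/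
lemma gaussian_product {n : ℕ} {y : SymIdx m → ℝ} (hy : y ∈ posCone m) :
    Integrable (fun x : Fin n → Fin m → ℝ => Complex.exp (negTr (gramMat x) y)) ∧
    ∫ x : Fin n → Fin m → ℝ, Complex.exp (negTr (gramMat x) y) =
      ((dt y ^ (-(n / 2) : ℝ) : ℝ) : ℂ) *
        (((∫ v : Fin m → ℝ, Real.exp (-(v ⬝ᵥ v))) ^ n : ℝ) : ℂ) := by
  have h : (fun x : Fin n → Fin m → ℝ => Complex.exp (negTr (gramMat x) y)) =
      fun x => ((∏ j, Real.exp (-(x j ⬝ᵥ (symOf y *ᵥ x j))) : ℝ) : ℂ) := by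
    funext x
    rw [negTr_apply, ← Complex.ofReal_exp, trace_gramMat_mul, ← Finset.sum_neg_distrib,
      Real.exp_sum]
  obtain ⟨h1, h2⟩ := gaussian_integral hy
  rw [h]
  constructor
  · exact (Integrable.fintype_prod (f := fun _ v => Real.exp (-(v ⬝ᵥ (symOf y *ᵥ v))))
      fun _ => h1).ofReal
  · have h3 := integral_fintype_prod_volume_eq_pow (ι := Fin n)
      (fun v : Fin m → ℝ => Real.exp (-(v ⬝ᵥ (symOf y *ᵥ v))))
    have h4 := integral_ofReal (𝕜 := ℂ) (μ := (volume : Measure (Fin n → Fin m → ℝ)))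
      (f := fun x => ∏ j, Real.exp (-(x j ⬝ᵥ (symOf y *ᵥ x j))))
    refine h4.trans ?_
    rw [h3, h2, mul_pow, ← Real.rpow_natCast (dt y ^ _), ← Real.rpow_mul (dt_pos hy).le,
      Fintype.card_fin]
    push_cast
    congr 4
    ring

/-- Cayley's constant vanishes at `(1 - m) / 2`. -/
theorem cayleyConst_eq_zero (hm : 0 < m) : cayleyConst m ((1 - m) / 2) = 0 := by
  -- With `n = m - 1` vectors the Gaussian integral is a multiple of `det(y)^((1-m)/2)`, and their
  -- `m × m` Gram matrix is singular.
  obtain ⟨n, rfl⟩ : ∃ n, m = n + 1 := ⟨m - 1, by omega⟩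
  set I : ℝ := (∫ v : Fin (n + 1) → ℝ, Real.exp (-(v ⬝ᵥ v))) ^ n with hI
  have hI0 : (I : ℂ) ≠ 0 := by
    have := integral_exp_pos (integrable_exp_neg_dotProduct_self (n + 1))
    exact_mod_cast (pow_pos this n).ne'
  set Φ : (SymIdx (n + 1) → ℝ) → ℂ := fun y =>
    ∫ x : Fin n → Fin (n + 1) → ℝ, (1 : ℂ) * Complex.exp (negTr (gramMat x) y) with hΦ
  have hmeas : ∀ v : SymIdx (n + 1) → ℝ,
      Measurable fun x : Fin n → Fin (n + 1) → ℝ => negTr (gramMat x) v := by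
    intro v
    have : Continuous fun x : Fin n → Fin (n + 1) → ℝ => negTr (gramMat x) v := by
      simp only [negTr_apply, trace_gramMat_mul]
      fun_prop
    exact this.measurable
  have hlap := cDL_laplace (μ := volume) (isOpen_posCone (n + 1)) hmeas
    (laplaceDominated_negTr (fun x : Fin n → Fin (n + 1) → ℝ => gramMat x) gramMat_posSemidef)
    (b := fun _ => 1) measurable_const (fun y hy => by simpa using (gaussian_product hy).1)
  have heq : Set.EqOn (detExp ((1 - (n + 1 : ℕ)) / 2) 0) (fun y => (I : ℂ)⁻¹ * Φ y)
      (posCone (n + 1)) := by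
    intro y hy
    have h0 : negTr (0 : Matrix (Fin (n + 1)) (Fin (n + 1)) ℝ) y = 0 := by simp [negTr_apply]
    simp only [hΦ, one_mul]
    rw [(gaussian_product hy).2, detExp, h0, Complex.exp_zero, mul_one, ← hI,
      mul_comm _ (I : ℂ), inv_mul_cancel_left₀ hI0]
    congr 3
    push_cast
    ring
  rw [cayleyConst, detD_congr (isOpen_posCone _) heq idY_mem_posCone, detD_const_mul]
  refine mul_eq_zero_of_right _ ?_
  rw [detD]
  have h1 : ∀ σ : Equiv.Perm (Fin (n + 1)),
      ((Equiv.Perm.sign σ : ℤ) : ℂ) * cDL (List.ofFn fun i => rp (wdir (σ i) i)) Φ (idY (n + 1)) =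
      ∫ x : Fin n → Fin (n + 1) → ℝ, ((Equiv.Perm.sign σ : ℤ) : ℂ) *
        ((1 : ℂ) * ((List.ofFn fun i => rp (wdir (σ i) i)).map (symb (negTr (gramMat x)))).prod *
        Complex.exp (negTr (gramMat x) (idY (n + 1)))) := by
    intro σ
    rw [(hlap _).2 idY_mem_posCone, integral_const_mul]
  simp only [h1]
  rw [← integral_finsetSum _ fun σ _ => ((hlap _).1 _ idY_mem_posCone).const_mul _]
  refine integral_eq_zero_of_ae (Eventually.of_forall fun x => ?_)
  have h2 : ∀ σ : Equiv.Perm (Fin (n + 1)),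
      ((List.ofFn fun i => rp (wdir (σ i) i)).map (symb (negTr (gramMat x)))).prod =
        ∏ i, (-((gramMat x).map Complex.ofReal)) (σ i) i := by
    intro σ
    rw [List.map_ofFn, List.prod_ofFn]
    refine Finset.prod_congr rfl fun i _ => ?_
    have hs : (gramMat x).IsSymm := by
      have := (gramMat_posSemidef x).isHermitian
      rwa [Matrix.IsHermitian, Matrix.conjTranspose_eq_transpose_of_trivial] at this
    have := trL_wdir hs (σ i) i
    rw [trL_apply] at this
    simp [symb_rp, negTr_apply, this]
  simp only [h2, one_mul, ← mul_assoc]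
  -- The signed sum of symbols is the determinant of minus the Gram matrix, so the integrand
  -- vanishes at every point.
  rw [← Finset.sum_mul, ← Matrix.det_apply', Matrix.det_neg]
  have h3 : ((gramMat x).map Complex.ofReal).det = 0 := by
    have := (Complex.ofRealHom.map_det (gramMat x)).symm
    rw [det_gramMat_eq_zero (Nat.lt_succ_self n) x, map_zero] at this
    exact this
  rw [h3]
  simp

end Gaussian

/-! ### Analytic continuation in the exponent -/

section Continuation

variable {m : ℕ}

/-- The integral `∫ g(y) det(y)^s dy` over the cone. -/
def coneMellin (g : (SymIdx m → ℝ) → ℂ) (s : ℂ) : ℂ :=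
  ∫ y in posCone m, g y * (dt y : ℂ) ^ s

lemma continuousOn_dt_cpow (s : ℂ) :
    ContinuousOn (fun y : SymIdx m → ℝ => (dt y : ℂ) ^ s) (posCone m) := by
  refine ContinuousOn.cpow (Complex.continuous_ofReal.comp continuous_dt).continuousOn
    continuousOn_const fun y hy => ?_
  exact Complex.ofReal_mem_slitPlane.mpr (dt_pos hy)

lemma norm_dt_cpow {y : SymIdx m → ℝ} (hy : y ∈ posCone m) (s : ℂ) :
    ‖(dt y : ℂ) ^ s‖ = dt y ^ s.re := Complex.norm_cpow_eq_rpow_re_of_pos (dt_pos hy) s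

/-- Domination of a function on the cone by `det(y)^b (1 + |y|)^N exp(-tr(A y))`. -/
def ConeBound (b : ℝ) (A : Matrix (Fin m) (Fin m) ℝ) (g : (SymIdx m → ℝ) → ℂ) : Prop :=
  ∃ (N : ℕ) (K : ℝ), 0 ≤ K ∧ ∀ y ∈ posCone m,
    ‖g y‖ ≤ K * (dt y ^ b * (1 + ‖y‖) ^ N * Real.exp (-(A * symOf y).trace))

variable {b : ℝ} {A : Matrix (Fin m) (Fin m) ℝ} {g : (SymIdx m → ℝ) → ℂ}

lemma ConeBound.integrableOn_mul_cpow (hm : 0 < m) (hA : A.PosDef)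
    (hc : ContinuousOn g (posCone m)) (hg : ConeBound b A g) {s : ℂ} (hs : -1 < m * (b + s.re)) :
    IntegrableOn (fun y => g y * (dt y : ℂ) ^ s) (posCone m) := by
  obtain ⟨N, K, hK, h⟩ := hg
  refine integrableOn_of_bound hm hs hA (hc.mul (continuousOn_dt_cpow s)) (N := N) hK
    fun y hy => ?_
  rw [norm_mul, norm_dt_cpow hy, Real.rpow_add (dt_pos hy)]
  have := Real.rpow_nonneg (dt_pos hy).le s.re
  calc _ ≤ K * (dt y ^ b * (1 + ‖y‖) ^ N * Real.exp (-(A * symOf y).trace)) * dt y ^ s.re := by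
        gcongr; exact h y hy
    _ = _ := by ring

lemma rpow_le_add_rpow {d : ℝ} (hd : 0 < d) {x y z : ℝ} (h1 : x ≤ y) (h2 : y ≤ z) :
    d ^ y ≤ d ^ x + d ^ z := by
  rcases le_total d 1 with h | h
  · exact (Real.rpow_le_rpow_of_exponent_ge hd h h1).trans
      (le_add_of_nonneg_right (Real.rpow_nonneg hd.le _))
  · exact (Real.rpow_le_rpow_of_exponent_le h h2).trans
      (le_add_of_nonneg_left (Real.rpow_nonneg hd.le _))

lemma abs_log_le_rpow {d ε : ℝ} (hd : 0 < d) (hε : 0 < ε) :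
    |Real.log d| ≤ (d ^ (-ε) + d ^ ε) / ε := by
  have h1 := Real.log_le_rpow_div hd.le hε
  have h2 := Real.log_le_rpow_div (inv_pos.mpr hd).le hε
  rw [Real.log_inv, Real.inv_rpow hd.le, ← Real.rpow_neg hd.le] at h2
  have h3 : 0 ≤ d ^ ε / ε := by positivity
  have h4 : 0 ≤ d ^ (-ε) / ε := by positivity
  rw [add_div]
  exact abs_le.mpr ⟨by linarith, by linarith⟩

theorem ConeBound.differentiableAt_coneMellin (hm : 0 < m) (hA : A.PosDef)
    (hc : ContinuousOn g (posCone m)) (hg : ConeBound b A g) {s : ℂ} (hs : -1 < m * (b + s.re)) :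
    DifferentiableAt ℂ (coneMellin g) s := by
  have hm' : (0 : ℝ) < m := by exact_mod_cast hm
  -- One `ε` is the radius of the disc around `s`, the other bounds the logarithm by powers with
  -- exponent `±ε`. The choice makes `2mε` half of the distance `m(b + Re s) + 1` to the edge of
  -- convergence.
  obtain ⟨ε, hε, hsε⟩ : ∃ ε : ℝ, 0 < ε ∧ -1 < m * (b + (s.re - 2 * ε)) := by
    refine ⟨(m * (b + s.re) + 1) / (4 * m), by have : 0 < m * (b + s.re) + 1 := by linarith
                                               positivity, ?_⟩
    have : m * (2 * ((m * (b + s.re) + 1) / (4 * m))) = (m * (b + s.re) + 1) / 2 := by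
      field_simp; ring
    nlinarith
  have hint : ∀ τ : ℝ, s.re - 2 * ε ≤ τ →
      IntegrableOn (fun y => g y * (dt y : ℂ) ^ (τ : ℂ)) (posCone m) := fun τ hτ =>
    hg.integrableOn_mul_cpow hm hA hc (by
      rw [Complex.ofReal_re]
      have : m * (b + (s.re - 2 * ε)) ≤ m * (b + τ) := by gcongr
      linarith)
  have hlogc : ContinuousOn (fun y : SymIdx m → ℝ => ((Real.log (dt y) : ℝ) : ℂ)) (posCone m) :=
    Complex.continuous_ofReal.comp_continuousOn
      (continuous_dt.continuousOn.log fun y hy => (dt_pos hy).ne')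
  have hFm : ∀ z : ℂ, AEStronglyMeasurable (fun y => g y * (dt y : ℂ) ^ z)
      (volume.restrict (posCone m)) := fun z =>
    (hc.mul (continuousOn_dt_cpow z)).aestronglyMeasurable measurableSet_posCone
  have key := hasDerivAt_integral_of_dominated_loc_of_deriv_le (𝕜 := ℂ)
    (μ := volume.restrict (posCone m))
    (F := fun z y => g y * (dt y : ℂ) ^ z)
    (F' := fun z y => g y * ((dt y : ℂ) ^ z * ((Real.log (dt y) : ℝ) : ℂ)))
    (x₀ := s) (s := Metric.ball s ε)
    (bound := fun y => (‖g y * (dt y : ℂ) ^ ((s.re - 2 * ε : ℝ) : ℂ)‖ +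
      ‖g y * (dt y : ℂ) ^ ((s.re : ℝ) : ℂ)‖ + (‖g y * (dt y : ℂ) ^ ((s.re : ℝ) : ℂ)‖ +
      ‖g y * (dt y : ℂ) ^ ((s.re + 2 * ε : ℝ) : ℂ)‖)) * (1 / ε))
    (Metric.ball_mem_nhds _ hε) (Eventually.of_forall hFm)
    (hg.integrableOn_mul_cpow hm hA hc hs)
    ((hc.mul ((continuousOn_dt_cpow s).mul hlogc)).aestronglyMeasurable measurableSet_posCone)
    ?_ ?_ ?_
  · exact key.2.differentiableAt
  · refine (ae_restrict_iff' measurableSet_posCone).mpr (Eventually.of_forall fun y hy z hz => ?_)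
    have hd := dt_pos hy
    have hz' : |z.re - s.re| ≤ ε := by
      rw [Metric.mem_ball, Complex.dist_eq] at hz
      have := Complex.abs_re_le_norm (z - s)
      rw [Complex.sub_re] at this
      linarith
    obtain ⟨hz1, hz2⟩ := abs_le.mp hz'
    have h1 : dt y ^ z.re ≤ dt y ^ (s.re - ε) + dt y ^ (s.re + ε) :=
      rpow_le_add_rpow hd (by linarith) (by linarith)
    have h2 := abs_log_le_rpow hd hε
    have e1 : dt y ^ (s.re - ε) * dt y ^ (-ε) = dt y ^ (s.re - 2 * ε) := by
      rw [← Real.rpow_add hd]; ring_nf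
    have e2 : dt y ^ (s.re - ε) * dt y ^ ε = dt y ^ s.re := by
      rw [← Real.rpow_add hd]; ring_nf
    have e3 : dt y ^ (s.re + ε) * dt y ^ (-ε) = dt y ^ s.re := by
      rw [← Real.rpow_add hd]; ring_nf
    have e4 : dt y ^ (s.re + ε) * dt y ^ ε = dt y ^ (s.re + 2 * ε) := by
      rw [← Real.rpow_add hd]; ring_nf
    simp only [norm_mul, norm_dt_cpow hy, Complex.ofReal_re, Complex.norm_real, Real.norm_eq_abs]
    calc ‖g y‖ * (dt y ^ z.re * |Real.log (dt y)|)
        ≤ ‖g y‖ * ((dt y ^ (s.re - ε) + dt y ^ (s.re + ε)) *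
            ((dt y ^ (-ε) + dt y ^ ε) / ε)) := by gcongr
      _ = ‖g y‖ * (dt y ^ (s.re - ε) * dt y ^ (-ε) + dt y ^ (s.re - ε) * dt y ^ ε +
            (dt y ^ (s.re + ε) * dt y ^ (-ε) + dt y ^ (s.re + ε) * dt y ^ ε)) * (1 / ε) := by ring
      _ = _ := by rw [e1, e2, e3, e4]; ring
  · exact ((((hint _ le_rfl).norm.add (hint _ (by linarith)).norm).add
      ((hint _ (by linarith)).norm.add (hint _ (by linarith)).norm)).mul_const _)
  · refine (ae_restrict_iff' measurableSet_posCone).mpr (Eventually.of_forall fun y hy z _ => ?_)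
    have hd : (dt y : ℂ) ≠ 0 := by exact_mod_cast (dt_pos hy).ne'
    have := ((hasDerivAt_id z).const_cpow (c := (dt y : ℂ)) (Or.inl hd)).const_mul (g y)
    rw [Complex.ofReal_log (dt_pos hy).le]
    simpa using this

lemma ConeBound.analyticOnNhd_coneMellin (hm : 0 < m) (hA : A.PosDef)
    (hc : ContinuousOn g (posCone m)) (hg : ConeBound b A g) (f : ℝ → ℝ)
    (hf : AnalyticOnNhd ℝ f Set.univ) :
    AnalyticOnNhd ℝ (fun s : ℝ => coneMellin g (f s)) {s | -1 < m * (b + f s)} := by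
  intro s hs
  have hopen : IsOpen {z : ℂ | -1 < m * (b + z.re)} :=
    isOpen_lt continuous_const (by fun_prop)
  have h1 : DifferentiableOn ℂ (coneMellin g) {z : ℂ | -1 < m * (b + z.re)} := fun z hz =>
    (hg.differentiableAt_coneMellin hm hA hc hz).differentiableWithinAt
  have h2 : AnalyticAt ℂ (coneMellin g) ((f s : ℝ) : ℂ) :=
    h1.analyticAt (hopen.mem_nhds (by simpa using hs))
  have h3 : AnalyticAt ℝ (fun s : ℝ => ((f s : ℝ) : ℂ)) s :=
    (Complex.ofRealCLM.analyticAt _).comp (hf s trivial)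
  exact (h2.restrictScalars (𝕜 := ℝ)).comp_of_eq h3 rfl

lemma coneBound_detExp (β : ℝ) (A : Matrix (Fin m) (Fin m) ℝ) : ConeBound β A (detExp β A) :=
  (coneClass_detExp β A).exists_bound

lemma coneBound_detD_detExp (α : ℝ) (hA : A.PosSemidef) :
    ConeBound (α - 1) A (detD (detExp α A)) :=
  let ⟨K, hK, h⟩ := exists_bound_detD_detExp α hA
  ⟨m, K, hK, h⟩

lemma continuousOn_detD_detExp (α : ℝ) (A : Matrix (Fin m) (Fin m) ℝ) :
    ContinuousOn (detD (detExp α A)) (posCone m) := by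
  refine continuousOn_finsetSum _ fun σ _ => continuousOn_const.mul ?_
  exact (ContDiffOn.cDL (isOpen_posCone m) (contDiffOn_detExp α A) _).continuousOn

lemma detExp_zero_right {y : SymIdx m → ℝ} (hy : y ∈ posCone m) (s : ℝ) :
    detExp s 0 y = (dt y : ℂ) ^ (s : ℂ) := by
  have h0 : negTr (0 : Matrix (Fin m) (Fin m) ℝ) y = 0 := by simp [negTr_apply]
  rw [detExp, h0, Complex.exp_zero, mul_one, Complex.ofReal_cpow (dt_pos hy).le]

/-- The formal computation, adjoint plus Cayley's identity, in the range where it is free of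
boundary terms. -/
lemma coneMellin_detD_of_large (hm : 0 < m) (hA : A.PosDef) {α s : ℝ} (hs : m + 1 ≤ α + s) :
    coneMellin (detD (detExp α A)) s =
      (-1) ^ m * (cayleyConst m s * coneMellin (detExp α A) ((s - 1 : ℝ) : ℂ)) := by
  have h := integral_detD_mul_detExp hm hA hs
  rw [coneMellin, coneMellin]
  rw [setIntegral_congr_fun (g := fun y => detD (detExp α A) y * (dt y : ℂ) ^ (s : ℂ))
    measurableSet_posCone fun y hy => by beta_reduce; rw [detExp_zero_right hy]] at h
  rw [h, ← integral_const_mul (cayleyConst m s)]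
  congr 1
  refine setIntegral_congr_fun measurableSet_posCone fun y hy => ?_
  rw [detD_detExp_zero s hy, Complex.ofReal_cpow (dt_pos hy).le]
  ring

/-- The integral of `det(∂_Y)(det(Y)^α exp(-tr(AY)))` against `det(Y)^((1-m)/2)` vanishes. -/
theorem coneMellin_detD_eq_zero (hm : 0 < m) (hA : A.PosDef) {α : ℝ}
    (hα : ((m : ℝ) + 1) / 2 ≤ α) :
    coneMellin (detD (detExp α A)) (((1 - m) / 2 : ℝ) : ℂ) = 0 := by
  have hm' : (0 : ℝ) < m := by exact_mod_cast hm
  -- A half-line on which both sides converge: on the left `det(∂_Y)` leaves the exponent `α - 1`,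
  -- and on the right the lowered exponent `s - 1` is added to `α`.
  set U : Set ℝ := {s | -1 < m * (α - 1 + s)} with hU
  have hUeq : U = Set.Ioi (-1 / m + 1 - α) := by
    ext s
    rw [hU, Set.mem_ofPred_eq, Set.mem_Ioi, ← div_lt_iff₀' hm']
    constructor <;> intro h <;> linarith
  have hpre : IsPreconnected U := by rw [hUeq]; exact isPreconnected_Ioi
  have hf : AnalyticOnNhd ℝ (fun s : ℝ => coneMellin (detD (detExp α A)) (s : ℂ)) U :=
    (coneBound_detD_detExp α hA.posSemidef).analyticOnNhd_coneMellin hm hA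
      (continuousOn_detD_detExp α A) (fun s => s) analyticOnNhd_id
  have hsub : AnalyticOnNhd ℝ (fun s : ℝ => s - 1) Set.univ := fun s _ =>
    analyticAt_id.sub analyticAt_const
  have hg1 := (coneBound_detExp α A).analyticOnNhd_coneMellin hm hA
      (contDiffOn_detExp α A).continuousOn (fun s => s - 1) hsub
  have hg : AnalyticOnNhd ℝ (fun s : ℝ =>
      (-1) ^ m * (cayleyConst m s * coneMellin (detExp α A) ((s - 1 : ℝ) : ℂ))) U := by
    intro s hs
    refine analyticAt_const.mul ((analyticOnNhd_cayleyConst s trivial).mul (hg1 s ?_))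
    rw [hU, Set.mem_ofPred_eq] at hs
    rw [Set.mem_ofPred_eq]
    convert hs using 2
    ring
  have hz0 : (m + 2 : ℝ) ∈ U := by
    rw [hU, Set.mem_ofPred_eq]
    have : 0 ≤ m * (α - 1 + (m + 2)) := mul_nonneg hm'.le (by linarith)
    linarith
  -- The identity theorem propagates the equality from a neighbourhood of `m + 2`, where the parts
  -- formula holds, to all of `U`.
  have heq := hf.eqOn_of_preconnected_of_eventuallyEq hg hpre hz0 (by
    filter_upwards [lt_mem_nhds (show (m + 1 : ℝ) < m + 2 by linarith)] with s hs
    exact coneMellin_detD_of_large hm hA (by linarith))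
  -- The assumption on `α` says exactly that the total exponent `α - 1 + (1-m)/2` is nonnegative.
  have hmem : ((1 - m) / 2 : ℝ) ∈ U := by
    rw [hU, Set.mem_ofPred_eq]
    have : 0 ≤ m * (α - 1 + (1 - m) / 2) := mul_nonneg hm'.le (by linarith)
    linarith
  have := heq hmem
  beta_reduce at this
  rw [this, cayleyConst_eq_zero hm]
  simp

end Continuation

/-! ### Complex coordinates on the half space and the passage from `det(∂_Z)` to `det(∂_Y)` -/

section ComplexCoordinates

variable {m : ℕ}

/-- The imaginary part in coordinates. -/
def imL (m : ℕ) : (SymIdx m → ℂ) →L[ℝ] (SymIdx m → ℝ) :=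
  ContinuousLinearMap.pi fun p => Complex.imCLM ∘L ContinuousLinearMap.proj p

/-- The real part in coordinates. -/
def reL (m : ℕ) : (SymIdx m → ℂ) →L[ℝ] (SymIdx m → ℝ) :=
  ContinuousLinearMap.pi fun p => Complex.reCLM ∘L ContinuousLinearMap.proj p

lemma imL_apply (z : SymIdx m → ℂ) (p : SymIdx m) : imL m z p = (z p).im := rfl

lemma reL_apply (z : SymIdx m → ℂ) (p : SymIdx m) : reL m z p = (z p).re := rfl

/-- Embedding of real coordinates into complex coordinates. -/
def toC (x : SymIdx m → ℝ) : SymIdx m → ℂ := fun p => (x p : ℂ)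

@[simp] lemma imL_toC (x : SymIdx m → ℝ) : imL m (toC x) = 0 := by
  funext p; simp [imL_apply, toC]

@[simp] lemma reL_toC (x : SymIdx m → ℝ) : reL m (toC x) = x := by
  funext p; simp [reL_apply, toC]

@[simp] lemma imL_I_smul_toC (x : SymIdx m → ℝ) : imL m (Complex.I • toC x) = x := by
  funext p; simp [imL_apply, toC]

@[simp] lemma reL_I_smul_toC (x : SymIdx m → ℝ) : reL m (Complex.I • toC x) = 0 := by
  funext p; simp [reL_apply, toC]

/-- The coordinates of `X + iY`. -/
def xy (x y : SymIdx m → ℝ) : SymIdx m → ℂ := toC x + Complex.I • toC y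

@[simp] lemma imL_xy (x y : SymIdx m → ℝ) : imL m (xy x y) = y := by simp [xy]

@[simp] lemma reL_xy (x y : SymIdx m → ℝ) : reL m (xy x y) = x := by simp [xy]

lemma xy_re_im (z : SymIdx m → ℂ) : xy (reL m z) (imL m z) = z := by
  funext p
  simp only [xy, toC, reL_apply, imL_apply, Pi.add_apply, Pi.smul_apply, smul_eq_mul]
  rw [mul_comm]; exact Complex.re_add_im _

lemma mkZ_symOf (x y : SymIdx m → ℝ) : mkZ (symOf x) (symOf y) = symOf (xy x y) := by
  ext i j
  simp [mkZ, symOf_apply, xy, toC]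

lemma imPart_symOf (z : SymIdx m → ℂ) : imPart (symOf z) = symOf (imL m z) := by
  rw [imPart, symOf_map]; rfl

lemma rePart_symOf (z : SymIdx m → ℂ) : rePart (symOf z) = symOf (reL m z) := by
  rw [rePart, symOf_map]; rfl

/-- The Siegel upper half space in coordinates. -/
def halfSpace (m : ℕ) : Set (SymIdx m → ℂ) := {z | symOf z ∈ siegelUpperHalfSpace m}

lemma mem_halfSpace {z : SymIdx m → ℂ} : z ∈ halfSpace m ↔ imL m z ∈ posCone m := by
  change (symOf z).IsSymm ∧ (imPart (symOf z)).PosDef ↔ _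
  rw [imPart_symOf]
  exact and_iff_right (symOf_isSymm z)

lemma isOpen_halfSpace (m : ℕ) : IsOpen (halfSpace m) := by
  have : halfSpace m = imL m ⁻¹' posCone m := Set.ext fun _ => mem_halfSpace
  rw [this]
  exact (isOpen_posCone m).preimage (imL m).continuous

lemma xy_mem_halfSpace (x : SymIdx m → ℝ) {y : SymIdx m → ℝ} (hy : y ∈ posCone m) :
    xy x y ∈ halfSpace m := by rwa [mem_halfSpace, imL_xy]

/-- The operator `½ (∂_X - i ∂_Y)` along the real direction `v`. -/
def dzDir (v : SymIdx m → ℝ) : FirstOrder (SymIdx m → ℂ) :=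
  ((1 / 2, toC v), (-(Complex.I / 2), Complex.I • toC v))

lemma symOf_toC_wdir (i j : Fin m) : symOf (toC (wdir i j)) = symDir i j := by
  have h : symOf (toC (wdir i j)) = (symOf (wdir i j)).map Complex.ofReal := (symOf_map _ _).symm
  rw [h, symOf_wdir]
  ext a b
  simp only [symDir, Matrix.map_apply, Matrix.smul_apply, Matrix.add_apply, Matrix.single_apply]
  split_ifs <;> simp

lemma lineDeriv_comp_symOf (F : Matrix (Fin m) (Fin m) ℂ → ℂ) (z w : SymIdx m → ℂ) :
    lineDeriv ℝ (fun z => F (symOf z)) z w = lineDeriv ℝ F (symOf z) (symOf w) := by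
  have h : ∀ t : ℝ, symOf (z + t • w) = symOf z + t • symOf w := fun t => by
    ext i j; simp [symOf_apply]
  simp only [lineDeriv, h]

lemma dZ_symOf (i j : Fin m) (F : Matrix (Fin m) (Fin m) ℂ → ℂ) (z : SymIdx m → ℂ) :
    dZ i j F (symOf z) = cD (dzDir (wdir i j)) (fun z => F (symOf z)) z := by
  simp only [dZ, cD, dzDir]
  rw [lineDeriv_comp_symOf, lineDeriv_comp_symOf, symOf_smul, symOf_toC_wdir]
  ring

lemma dZPerm_symOf (σ : Equiv.Perm (Fin m)) (F : Matrix (Fin m) (Fin m) ℂ → ℂ)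
    (z : SymIdx m → ℂ) :
    dZPerm σ F (symOf z) =
      cDL (List.ofFn fun i => dzDir (wdir (σ i) i)) (fun z => F (symOf z)) z := by
  rw [dZPerm, List.ofFn_eq_map]
  induction List.finRange m generalizing z with
  | nil => rfl
  | cons i l ih =>
    rw [List.foldr_cons, dZ_symOf, List.map_cons, cDL_cons]
    exact congrFun (congrArg _ (funext ih)) z

/-- The exponent of the holomorphic exponential `exp(i tr(A Z))`. -/
def holTr (A : Matrix (Fin m) (Fin m) ℝ) : (SymIdx m → ℂ) →L[ℝ] ℂ :=
  -(Complex.I • (negTr A ∘L reL m)) + negTr A ∘L imL m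

/-- The exponent of `exp(i tr(A \bar Z))`. -/
def antiTr (A : Matrix (Fin m) (Fin m) ℝ) : (SymIdx m → ℂ) →L[ℝ] ℂ :=
  -(Complex.I • (negTr A ∘L reL m)) - negTr A ∘L imL m

lemma holTr_apply (A : Matrix (Fin m) (Fin m) ℝ) (z : SymIdx m → ℂ) :
    holTr A z = -(Complex.I * negTr A (reL m z)) + negTr A (imL m z) := rfl

lemma antiTr_apply (A : Matrix (Fin m) (Fin m) ℝ) (z : SymIdx m → ℂ) :
    antiTr A z = -(Complex.I * negTr A (reL m z)) - negTr A (imL m z) := rfl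

lemma negTr_smul (c : ℝ) (A : Matrix (Fin m) (Fin m) ℝ) (y : SymIdx m → ℝ) :
    negTr (c • A) y = c * negTr A y := by
  simp [negTr_apply]

/-- The Cauchy–Riemann cancellation: `∂_Z` annihilates functions of `Z̄`. -/
lemma symb_antiTr_dzDir (A : Matrix (Fin m) (Fin m) ℝ) (v : SymIdx m → ℝ) :
    symb (antiTr A) (dzDir v) = 0 := by
  simp only [symb, dzDir, antiTr_apply, imL_toC, reL_toC, imL_I_smul_toC, reL_I_smul_toC, map_zero]
  ring

lemma holTr_re (A : Matrix (Fin m) (Fin m) ℝ) (z : SymIdx m → ℂ) :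
    (holTr A z).re = (negTr A (imL m z)).re := by
  simp [holTr_apply, negTr_apply]

lemma norm_holTr_le (A : Matrix (Fin m) (Fin m) ℝ) : ‖holTr A‖ ≤ 2 * ‖negTr A‖ := by
  refine ContinuousLinearMap.opNorm_le_bound _ (by positivity) fun z => ?_
  have hr : ‖reL m z‖ ≤ ‖z‖ := by
    refine (pi_norm_le_iff_of_nonneg (norm_nonneg _)).mpr fun p => ?_
    exact (Complex.abs_re_le_norm _).trans (norm_le_pi_norm z p)
  have hi : ‖imL m z‖ ≤ ‖z‖ := by
    refine (pi_norm_le_iff_of_nonneg (norm_nonneg _)).mpr fun p => ?_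
    exact (Complex.abs_im_le_norm _).trans (norm_le_pi_norm z p)
  rw [holTr_apply]
  refine (norm_add_le _ _).trans ?_
  rw [norm_neg, norm_mul, Complex.norm_I, one_mul]
  have h1 := (negTr A).le_opNorm_of_le hr
  have h2 := (negTr A).le_opNorm_of_le hi
  linarith

lemma laplaceDominated_holTr {Ω : Type*} (W : Ω → Matrix (Fin m) (Fin m) ℝ)
    (hW : ∀ ω, (W ω).PosSemidef) : LaplaceDominated (halfSpace m) fun ω => holTr (W ω) := by
  intro z hz
  obtain ⟨δ, hδ, y', hy', h⟩ := laplaceDominated_negTr W hW _ (mem_halfSpace.mp hz)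
  -- The radius is halved because passing to complex coordinates can double the norm of the
  -- functional.
  refine ⟨δ / 2, by positivity, xy 0 y', xy_mem_halfSpace 0 hy', fun ω w hw => ?_⟩
  have hi : ‖imL m w‖ ≤ ‖w‖ := by
    refine (pi_norm_le_iff_of_nonneg (norm_nonneg _)).mpr fun p => ?_
    exact (Complex.abs_im_le_norm _).trans (norm_le_pi_norm w p)
  have h1 := h ω (imL m w) (by linarith)
  rw [holTr_re, holTr_re, imL_xy, map_add]
  have h2 := mul_le_mul_of_nonneg_left (norm_holTr_le (W ω)) hδ.le
  linarith

/-- A product of an antiholomorphic exponential and a function of `Y` only. -/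
lemma cDL_dzDir_antiTr_mul (A : Matrix (Fin m) (Fin m) ℝ) {G : (SymIdx m → ℝ) → ℂ}
    (hG : ContDiffOn ℝ (⊤ : ℕ∞) G (posCone m)) (l : List (SymIdx m → ℝ)) :
    Set.EqOn (cDL (l.map dzDir) fun z => Complex.exp (antiTr A z) * G (imL m z))
      (fun z => (-(Complex.I / 2)) ^ l.length *
        (Complex.exp (antiTr A z) * cDL (l.map rp) G (imL m z))) (halfSpace m) := by
  induction l with
  | nil => intro z _; simp
  | cons v l ih =>
    intro z hz
    rw [List.map_cons, cDL_cons, cD_congr (isOpen_halfSpace m) ih _ hz]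
    set g := cDL (l.map rp) G with hg
    have hd : ∀ w, LineDifferentiableAt ℝ g (imL m z) w := fun w =>
      ContDiffOn.iterDiffOn (isOpen_posCone m) hG _ _ (mem_halfSpace.mp hz) w
    have hg' : ∀ w, HasLineDerivAt ℝ (fun z => g (imL m z)) (lineDeriv ℝ g (imL m z) (imL m w))
        z w := fun w => by
      have := (hd (imL m w)).hasLineDerivAt
      simpa [HasLineDerivAt] using this
    have key : ∀ w, HasLineDerivAt ℝ (fun z => (-(Complex.I / 2)) ^ l.length *
        (Complex.exp (antiTr A z) * g (imL m z))) ((-(Complex.I / 2)) ^ l.length *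
        (antiTr A w * Complex.exp (antiTr A z) * g (imL m z) +
          Complex.exp (antiTr A z) * lineDeriv ℝ g (imL m z) (imL m w))) z w := fun w =>
      HasDerivAt.const_mul _ (HasLineDerivAt.mul' (hasLineDerivAt_cexp _ z w) (hg' w))
    rw [HasLineDerivAt.cD_eq (key _) (key _)]
    have hs := symb_antiTr_dzDir A v
    simp only [symb] at hs
    beta_reduce
    have e1 : imL m (dzDir v).1.2 = 0 := imL_toC v
    have e2 : imL m (dzDir v).2.2 = v := imL_I_smul_toC v
    have e3 : (dzDir v).2.1 = -(Complex.I / 2) := rfl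
    have e4 : lineDeriv ℝ g (imL m z) 0 = 0 := by simp [lineDeriv]
    rw [List.map_cons, cDL_cons, cD_rp, List.length_cons, e1, e2, e4, pow_succ]
    rw [e3] at hs ⊢
    linear_combination ((-(Complex.I / 2)) ^ l.length * Complex.exp (antiTr A z) *
      g (imL m z)) * hs

/-- Replacing `Z` by `Z̄` in the exponential costs `exp(-2 tr(AY))`, a function of `Y` alone. After
this exchange `∂_Z` sees only the `Y`-dependent factor, on which it is `-(i/2) ∂_Y`. -/
lemma dt_rpow_mul_cexp_holTr (α : ℝ) (A : Matrix (Fin m) (Fin m) ℝ) (z : SymIdx m → ℂ) :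
    ((dt (imL m z) ^ α : ℝ) : ℂ) * Complex.exp (holTr A z) =
      Complex.exp (antiTr A z) * detExp α ((2 : ℝ) • A) (imL m z) := by
  rw [detExp, mul_left_comm, ← Complex.exp_add, negTr_smul, holTr_apply, antiTr_apply]
  congr 2
  push_cast
  ring

/-- `det(∂_Z)` applied to `det(Y)^α exp(i tr(A Z))`. -/
lemma sum_cDL_dt_rpow_mul_cexp (α : ℝ) (A : Matrix (Fin m) (Fin m) ℝ) {z : SymIdx m → ℂ}
    (hz : z ∈ halfSpace m) :
    ∑ σ : Equiv.Perm (Fin m), ((Equiv.Perm.sign σ : ℤ) : ℂ) *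
      cDL (List.ofFn fun i => dzDir (wdir (σ i) i))
        (fun z => ((dt (imL m z) ^ α : ℝ) : ℂ) * Complex.exp (holTr A z)) z =
    (-(Complex.I / 2)) ^ m * (Complex.exp (antiTr A z) *
      detD (detExp α ((2 : ℝ) • A)) (imL m z)) := by
  rw [detD, Finset.mul_sum, Finset.mul_sum]
  refine Finset.sum_congr rfl fun σ _ => ?_
  have h := cDL_dzDir_antiTr_mul A (contDiffOn_detExp α ((2 : ℝ) • A))
    (List.ofFn fun i => wdir (σ i) i) hz
  simp only [← dt_rpow_mul_cexp_holTr, List.map_ofFn, List.length_ofFn] at h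
  simp only [Function.comp_def] at h
  rw [h]
  ring

end ComplexCoordinates

/-! ### Termwise differentiation of exponential series -/

section Series

lemma hasSum_list_sum {α ι : Type*} (l : List α) {g : α → ι → ℂ} {G : α → ℂ}
    (h : ∀ q, HasSum (g q) (G q)) :
    HasSum (fun i => (l.map fun q => g q i).sum) (l.map G).sum := by
  induction l with
  | nil => simp
  | cons q l ih => simpa using (h q).add ih

variable {E : Type*} [NormedAddCommGroup E] [NormedSpace ℝ E] {U : Set E} {ι : Type*} [Countable ι]
  {L : ι → E →L[ℝ] ℂ} {b : ι → ℂ} {F : E → ℂ}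

lemma integrable_count_iff_summable [MeasurableSpace ι] [DiscreteMeasurableSpace ι] (g : ι → ℂ) :
    Integrable g Measure.count ↔ Summable g := by
  rw [Integrable, hasFiniteIntegral_count_iff, summable_norm_iff]
  exact and_iff_right (Measurable.of_discrete (f := g)).aestronglyMeasurable

lemma hasSum_integral_count [MeasurableSpace ι] [DiscreteMeasurableSpace ι] {g : ι → ℂ}
    (hg : Summable g) : HasSum g (∫ i, g i ∂Measure.count) := by
  have h := hasSum_integral_measure (μ := fun i : ι => Measure.dirac i)
    ((integrable_count_iff_summable g).mpr hg)
  simp only [integral_dirac] at h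
  exact h

/-- An absolutely convergent exponential series is a Laplace transform for the counting measure, so
termwise differentiation is differentiation under that integral. -/
lemma hasSum_cDL_exp (hU : IsOpen U) (hdom : LaplaceDominated U L)
    (hF : ∀ z ∈ U, HasSum (fun i => b i * Complex.exp (L i z)) (F z)) :
    IterDiffOn F U ∧ ∀ l : List (FirstOrder E), ∀ z ∈ U,
      HasSum (fun i => b i * cDL l (fun y => Complex.exp (L i y)) z) (cDL l F z) := by
  let _ : MeasurableSpace ι := ⊤
  have : DiscreteMeasurableSpace ι := ⟨fun _ => trivial⟩
  have hL : ∀ v, Measurable fun i => L i v := fun v => Measurable.of_discrete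
  have hb : Measurable b := Measurable.of_discrete
  have hint : ∀ z ∈ U, Integrable (fun i => b i * Complex.exp (L i z)) Measure.count :=
    fun z hz => (integrable_count_iff_summable _).mpr (hF z hz).summable
  have hEq : Set.EqOn F (fun z => ∫ i, b i * Complex.exp (L i z) ∂Measure.count) U :=
    fun z hz => (hF z hz).unique (hasSum_integral_count (hF z hz).summable)
  refine ⟨fun l z hz v => ?_, fun l z hz => ?_⟩
  · have h := iterDiffOn_laplace hU hL hdom hb hint l z hz v
    have h2 := ((cDL_congr hU hEq l).eventuallyEq_of_mem (hU.mem_nhds hz))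
    exact (h2.lineDifferentiableAt_iff).mpr h
  · obtain ⟨h1, h2⟩ := cDL_laplace hU hL hdom hb hint l
    rw [cDL_congr hU hEq l hz, h2 hz]
    simp only [cDL_cexp, ← mul_assoc]
    exact hasSum_integral_count ((integrable_count_iff_summable _).mp (h1 z hz))

/-- Termwise differentiation of the product of a smooth function and an exponential series. -/
theorem hasSum_cDL_mul_exp (hU : IsOpen U) (hdom : LaplaceDominated U L)
    (hF : ∀ z ∈ U, HasSum (fun i => b i * Complex.exp (L i z)) (F z)) {f : E → ℂ}
    (hf : IterDiffOn f U) (l : List (FirstOrder E)) {z : E} (hz : z ∈ U) :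
    HasSum (fun i => b i * cDL l (fun y => f y * Complex.exp (L i y)) z)
      (cDL l (fun y => f y * F y) z) := by
  obtain ⟨h1, h2⟩ := hasSum_cDL_exp hU hdom hF
  have he : ∀ i, IterDiffOn (fun y => Complex.exp (L i y)) U := fun i =>
    ContDiffOn.iterDiffOn hU (L i).contDiff.cexp.contDiffOn
  rw [cDL_mul hU hf h1 l hz]
  have h3 := hasSum_list_sum (splits l) fun q => (h2 q.2 z hz).mul_left (cDL q.1 f z)
  refine h3.congr_fun fun i => ?_
  rw [cDL_mul hU hf (he i) l hz, ← List.sum_map_mul_left]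
  refine congrArg List.sum (List.map_congr_left fun q _ => ?_)
  ring

end Series

/-! ### Orthogonality of characters and Fourier coefficients -/

section Fourier

variable {m : ℕ}

lemma integral_exp_two_pi_int (n : ℤ) :
    ∫ t in Set.Icc (0 : ℝ) 1, Complex.exp (2 * Real.pi * Complex.I * (n * t)) =
      if n = 0 then 1 else 0 := by
  split_ifs with hn
  · simp [hn]
  · rw [integral_Icc_eq_integral_Ioc, ← intervalIntegral.integral_of_le zero_le_one]
    have hc : (2 * Real.pi * Complex.I * n : ℂ) ≠ 0 :=
      mul_ne_zero Complex.two_pi_I_ne_zero (by exact_mod_cast hn)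
    have h := integral_exp_mul_complex (a := 0) (b := 1) hc
    simp only [mul_assoc] at h ⊢
    rw [h]
    have : Complex.exp (2 * (Real.pi * (Complex.I * (n * ((1 : ℝ) : ℂ))))) = 1 := by
      rw [Complex.exp_eq_one_iff]
      exact ⟨n, by push_cast; ring⟩
    rw [this]
    simp

lemma integral_exp_two_pi_pi {ι : Type*} [Fintype ι] (n : ι → ℤ) :
    ∫ x in Set.Icc (0 : ι → ℝ) 1, Complex.exp (2 * Real.pi * Complex.I * ∑ p, n p * x p) =
      if n = 0 then 1 else 0 := by
  have h1 : Set.Icc (0 : ι → ℝ) 1 = Set.univ.pi fun _ => Set.Icc (0 : ℝ) 1 :=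
    (Set.pi_univ_Icc _ _).symm
  have h2 : (fun x : ι → ℝ => Complex.exp (2 * Real.pi * Complex.I * ∑ p, n p * x p)) =
      fun x => ∏ p, (fun p (t : ℝ) => Complex.exp (2 * Real.pi * Complex.I * (n p * t))) p (x p) := by
    funext x
    push_cast
    rw [Finset.mul_sum, Complex.exp_sum]
  rw [h2, h1, volume_pi, Measure.restrict_pi_pi, integral_fintype_prod_eq_prod
    (fun p (t : ℝ) => Complex.exp (2 * Real.pi * Complex.I * (n p * t)))]
  simp only [integral_exp_two_pi_int]
  split_ifs with hn
  · simp [hn]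
  · obtain ⟨p, hp⟩ := Function.ne_iff.mp hn
    exact Finset.prod_eq_zero (Finset.mem_univ p) (if_neg hp)

lemma single_eq_smul_wdir (p : SymIdx m) :
    (Pi.single p 1 : SymIdx m → ℝ) =
      (if p.1.1 = p.1.2 then 1 else 2 : ℝ) • wdir p.1.1 p.1.2 := by
  obtain ⟨⟨i, j⟩, hij⟩ := p
  funext q
  obtain ⟨⟨a, c⟩, hac⟩ := q
  simp only [Pi.single_apply, wdir, upper, Pi.smul_apply, Matrix.smul_apply, Matrix.add_apply,
    Matrix.single_apply, Subtype.mk.injEq, Prod.mk.injEq, smul_eq_mul] at *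
  by_cases h1 : i = j
  · subst h1
    grind
  · have : i < j := lt_of_le_of_ne hij h1
    grind

lemma trL_eq_sum {D : Matrix (Fin m) (Fin m) ℝ} (hD : D.IsSymm) (x : SymIdx m → ℝ) :
    trL D x = ∑ p : SymIdx m, (if p.1.1 = p.1.2 then 1 else 2) * D p.1.1 p.1.2 * x p := by
  conv_lhs => rw [← Finset.univ_sum_single x]
  rw [map_sum]
  refine Finset.sum_congr rfl fun p _ => ?_
  have : (Pi.single p (x p) : SymIdx m → ℝ) = x p • Pi.single p 1 := by
    rw [← Pi.single_smul, smul_eq_mul, mul_one]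
  rw [this, single_eq_smul_wdir, map_smul, map_smul, trL_wdir hD, smul_eq_mul, smul_eq_mul]
  ring

lemma expTr_mul_symOf (D : Matrix (Fin m) (Fin m) ℝ) (x : SymIdx m → ℝ) :
    expTr ((D * symOf x).map Complex.ofReal) =
      Complex.exp (2 * Real.pi * Complex.I * (trL D x : ℝ)) := by
  rw [expTr, trL_apply]
  congr 2
  exact (AddMonoidHom.map_trace Complex.ofRealHom.toAddMonoidHom _).symm

lemma expTr_neg_mul_symOf (D : Matrix (Fin m) (Fin m) ℝ) (x : SymIdx m → ℝ) :
    expTr (-(D * symOf x).map Complex.ofReal) =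
      Complex.exp (-(2 * Real.pi * Complex.I * (trL D x : ℝ))) := by
  rw [expTr, Matrix.trace_neg, mul_neg, Complex.exp_neg, Complex.exp_neg, ← expTr_mul_symOf, expTr]

/-- For half-integral matrices, `tr((T - T')X)` is an integral linear form in the coordinates
`x_ij`, `i ≤ j`: off-diagonal entries occur doubled. Orthogonality then splits into one-dimensional
integrals. -/
lemma integral_character_mul (T T' : PosHalfInt m) :
    ∫ x in Set.Icc (0 : SymIdx m → ℝ) 1, expTr ((T.1 * symOf x).map Complex.ofReal) *
      expTr (-(T'.1 * symOf x).map Complex.ofReal) = if T = T' then 1 else 0 := by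
  have hD : (T.1 - T'.1).IsSymm := T.2.2.1.sub T'.2.2.1
  have hn : ∀ p : SymIdx m, ∃ n : ℤ,
      (if p.1.1 = p.1.2 then 1 else 2) * (T.1 - T'.1) p.1.1 p.1.2 = n := by
    intro p
    split_ifs with h
    · obtain ⟨a, ha⟩ := T.2.2.2.1 p.1.1
      obtain ⟨c, hc⟩ := T'.2.2.2.1 p.1.1
      exact ⟨a - c, by rw [← h, Matrix.sub_apply, ha, hc]; push_cast; ring⟩
    · obtain ⟨a, ha⟩ := T.2.2.2.2 p.1.1 p.1.2
      obtain ⟨c, hc⟩ := T'.2.2.2.2 p.1.1 p.1.2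
      exact ⟨a - c, by rw [Matrix.sub_apply, mul_sub, ha, hc]; push_cast; ring⟩
  choose n hn using hn
  have h1 : ∀ x : SymIdx m → ℝ, expTr ((T.1 * symOf x).map Complex.ofReal) *
      expTr (-(T'.1 * symOf x).map Complex.ofReal) =
      Complex.exp (2 * Real.pi * Complex.I * ∑ p, n p * x p) := by
    intro x
    rw [expTr_mul_symOf, expTr_neg_mul_symOf, ← Complex.exp_add]
    have h2 : trL T.1 x - trL T'.1 x = ∑ p, n p * x p := by
      rw [← Finset.sum_congr rfl fun p _ => congrArg (· * x p) (hn p), ← trL_eq_sum hD]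
      simp [trL_apply, sub_mul]
    congr 1
    rw [← h2]
    push_cast
    ring
  simp only [h1, integral_exp_two_pi_pi]
  refine if_congr ?_ rfl rfl
  constructor
  · intro h
    refine Subtype.ext (sub_eq_zero.mp ?_)
    rw [← symOf_upper hD]
    have : upper (T.1 - T'.1) = 0 := by
      funext p
      have h2 := hn p
      rw [h] at h2
      rw [Pi.zero_apply, Int.cast_zero] at h2
      refine (mul_eq_zero.mp h2).resolve_left ?_
      split_ifs <;> norm_num
    rw [this]
    exact (symOfL m ℝ).map_zero
  · rintro rfl
    funext p
    have h2 := hn p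
    rw [sub_self, Matrix.zero_apply, mul_zero] at h2
    exact_mod_cast h2.symm

instance countable_posHalfInt : Countable (PosHalfInt m) := by
  choose n hn using fun (T : PosHalfInt m) (i j : Fin m) => T.2.2.2.2 i j
  refine Function.Injective.countable (f := n) fun T T' h => Subtype.ext ?_
  ext i j
  have h1 := hn T i j
  rw [h, ← hn T' i j] at h1
  linarith

lemma continuous_trL (D : Matrix (Fin m) (Fin m) ℝ) : Continuous (trL D : (SymIdx m → ℝ) → ℝ) :=
  (trL D).continuous_of_finiteDimensional

/-- The Fourier coefficients of an absolutely convergent Fourier series. -/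
theorem fourierCoeff_of_hasSum {F : Matrix (Fin m) (Fin m) ℂ → ℂ}
    {Y : Matrix (Fin m) (Fin m) ℝ} {a : PosHalfInt m → ℂ}
    (h : ∀ x : SymIdx m → ℝ, HasSum (fun T : PosHalfInt m =>
      a T * expTr ((T.1 * symOf x).map Complex.ofReal)) (F (mkZ (symOf x) Y)))
    (T : PosHalfInt m) : fourierCoeff F T.1 Y = a T := by
  have hnorm : ∀ (S : PosHalfInt m) (x : SymIdx m → ℝ),
      ‖expTr ((S.1 * symOf x).map Complex.ofReal)‖ = 1 := fun S x => by
    rw [expTr_mul_symOf, Complex.norm_exp]; simp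
  have hnorm2 : ∀ (S : PosHalfInt m) (x : SymIdx m → ℝ),
      ‖expTr (-(S.1 * symOf x).map Complex.ofReal)‖ = 1 := fun S x => by
    rw [expTr_neg_mul_symOf, Complex.norm_exp]; simp
  have ha : Summable fun S => ‖a S‖ := by
    have := (h 0).summable.norm
    simpa only [norm_mul, hnorm, mul_one] using this
  have hint : ∀ S : PosHalfInt m, IntegrableOn (fun x : SymIdx m → ℝ =>
      a S * (expTr ((S.1 * symOf x).map Complex.ofReal) *
        expTr (-(T.1 * symOf x).map Complex.ofReal))) (Set.Icc 0 1) := by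
    intro S
    refine ContinuousOn.integrableOn_compact isCompact_Icc (Continuous.continuousOn ?_)
    simp only [expTr_mul_symOf, expTr_neg_mul_symOf]
    have h1 := continuous_trL S.1
    have h2 := continuous_trL T.1
    fun_prop
  have hvol : (volume : Measure (SymIdx m → ℝ)).real (Set.Icc 0 1) = 1 := by
    rw [Measure.real, Real.volume_Icc_pi]; simp
  have h1 := hasSum_integral_of_summable_integral_norm hint (by
    simpa only [norm_mul, hnorm, hnorm2, mul_one, setIntegral_const, hvol, one_smul] using ha)
  simp only [integral_const_mul, integral_character_mul] at h1
  have h2 : HasSum (fun S => a S * if S = T then 1 else 0) (a T) := by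
    convert hasSum_ite_eq T (a T) using 2 with S
    by_cases hS : S = T <;> simp [hS]
  rw [← h1.unique h2, fourierCoeff]
  refine integral_congr_ae (ae_of_all _ fun x => ?_)
  beta_reduce
  rw [← ((h x).mul_right _).tsum_eq]
  simp only [mul_assoc]

end Fourier

/-! ### The Fourier expansion of the Maass shift -/

section Expansion

variable {m : ℕ}

/-- The function `det(Y)^(-α) exp(2π tr(TY)) det(∂_Y)(det(Y)^α exp(-4π tr(TY)))`. -/
def shiftCoeff (α : ℝ) (T : Matrix (Fin m) (Fin m) ℝ) (y : SymIdx m → ℝ) : ℂ :=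
  (((dt y ^ α)⁻¹ : ℝ) : ℂ) * (Complex.exp (-negTr ((2 * Real.pi) • T) y) *
    detD (detExp α ((4 * Real.pi) • T)) y)

lemma cexp_antiTr (T : Matrix (Fin m) (Fin m) ℝ) (z : SymIdx m → ℂ) :
    Complex.exp (antiTr ((2 * Real.pi) • T) z) =
      Complex.exp (-negTr ((2 * Real.pi) • T) (imL m z)) *
        expTr ((T * symOf (reL m z)).map Complex.ofReal) := by
  rw [expTr_mul_symOf, ← Complex.exp_add, antiTr_apply, negTr_smul _ _ (reL m z),
    negTr_apply _ (reL m z), trL_apply]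
  congr 1
  push_cast
  ring

lemma cexp_holTr (T : Matrix (Fin m) (Fin m) ℝ) (z : SymIdx m → ℂ) :
    Complex.exp (holTr ((2 * Real.pi) • T) z) = expTr (T.map Complex.ofReal * symOf z) := by
  have h1 : symOf z = (symOf (reL m z)).map Complex.ofReal +
      Complex.I • (symOf (imL m z)).map Complex.ofReal := by
    conv_lhs => rw [← xy_re_im z, ← mkZ_symOf]
    rfl
  have h2 : ∀ x : SymIdx m → ℝ, (T.map Complex.ofReal * (symOf x).map Complex.ofReal).trace =
      (((T * symOf x).trace : ℝ) : ℂ) := fun x => by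
    have : (T * symOf x).map Complex.ofReal =
        T.map Complex.ofReal * (symOf x).map Complex.ofReal :=
      Matrix.map_mul (f := Complex.ofRealHom)
    rw [← this]
    exact (AddMonoidHom.map_trace Complex.ofRealHom.toAddMonoidHom _).symm
  rw [expTr, h1, mul_add, Matrix.trace_add, Matrix.mul_smul, Matrix.trace_smul, h2, h2, holTr_apply,
    negTr_smul, negTr_smul, negTr_apply, negTr_apply, smul_eq_mul]
  congr 1
  push_cast
  linear_combination (2 * Real.pi * ((T * symOf (imL m z)).trace : ℂ)) * (-Complex.I_mul_I)

lemma detImPow_symOf (k : ℤ) (z : SymIdx m → ℂ) :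
    detImPow k (symOf z) = dt (imL m z) ^ ((k : ℝ) + (1 - (m : ℝ)) / 2) := by
  rw [detImPow, imPart_symOf, dt]

lemma iterDiffOn_dt_rpow_imL (α : ℝ) :
    IterDiffOn (fun z : SymIdx m → ℂ => ((dt (imL m z) ^ α : ℝ) : ℂ)) (halfSpace m) := by
  refine ContDiffOn.iterDiffOn (isOpen_halfSpace m) ?_
  have h := (contDiffOn_detExp α (0 : Matrix (Fin m) (Fin m) ℝ)).comp
    (imL m).contDiff.contDiffOn (s := halfSpace m) fun z hz => mem_halfSpace.mp hz
  refine h.congr fun z _ => ?_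
  simp [detExp, negTr_apply]

theorem hasSum_maassShift {k : ℤ} {h : Matrix (Fin m) (Fin m) ℂ → ℂ} {b : PosHalfInt m → ℂ}
    (hF : ∀ Z ∈ siegelUpperHalfSpace m,
      HasSum (fun T : PosHalfInt m => b T * expTr (T.1.map Complex.ofReal * Z)) (h Z))
    {z : SymIdx m → ℂ} (hz : z ∈ halfSpace m) :
    HasSum (fun T : PosHalfInt m =>
      b T * shiftCoeff ((k : ℝ) + (1 - (m : ℝ)) / 2) T.1 (imL m z) *
        expTr ((T.1 * symOf (reL m z)).map Complex.ofReal)) (maassShift k h (symOf z)) := by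
  set α : ℝ := (k : ℝ) + (1 - (m : ℝ)) / 2 with hα
  have hpos : ∀ T : PosHalfInt m, ((2 * Real.pi) • T.1).PosSemidef := fun T =>
    T.2.1.posSemidef.smul (by positivity)
  have hF' : ∀ z ∈ halfSpace m, HasSum (fun T : PosHalfInt m =>
      b T * Complex.exp (holTr ((2 * Real.pi) • T.1) z)) (h (symOf z)) := fun z hz => by
    simpa only [cexp_holTr] using hF _ hz
  have h1 := fun l => hasSum_cDL_mul_exp (isOpen_halfSpace m)
    (laplaceDominated_holTr (fun T : PosHalfInt m => (2 * Real.pi) • T.1) hpos) hF'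
    (iterDiffOn_dt_rpow_imL α) l hz
  have h2 := (hasSum_sum (s := Finset.univ) fun (σ : Equiv.Perm (Fin m)) _ =>
    (h1 (List.ofFn fun i => dzDir (wdir (σ i) i))).mul_left
      ((Equiv.Perm.sign σ : ℤ) : ℂ)).mul_left
        ((2 * Complex.I) ^ m * (((dt (imL m z) ^ α)⁻¹ : ℝ) : ℂ))
  have h3 : maassShift k h (symOf z) = (2 * Complex.I) ^ m * (((dt (imL m z) ^ α)⁻¹ : ℝ) : ℂ) *
      ∑ σ : Equiv.Perm (Fin m), ((Equiv.Perm.sign σ : ℤ) : ℂ) *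
        cDL (List.ofFn fun i => dzDir (wdir (σ i) i))
          (fun z => ((dt (imL m z) ^ α : ℝ) : ℂ) * h (symOf z)) z := by
    rw [maassShift, detDZ]
    simp only [dZPerm_symOf, detImPow_symOf, hα]
  rw [h3]
  refine h2.congr_fun fun T => ?_
  have h4 := sum_cDL_dt_rpow_mul_cexp α ((2 * Real.pi) • T.1) hz
  have h5 : (2 : ℝ) • (2 * Real.pi) • T.1 = (4 * Real.pi) • T.1 := by
    rw [smul_smul]; congr 1; ring
  -- The normalization `(2i)^m` of the Maass operator cancels the factor `(-i/2)^m` from `∂_Z =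
  -- -(i/2) ∂_Y`.
  have h6 : (2 * Complex.I) ^ m * (-(Complex.I / 2)) ^ m = 1 := by
    rw [← mul_pow]
    have : 2 * Complex.I * -(Complex.I / 2) = 1 := by
      linear_combination -Complex.I_mul_I
    rw [this, one_pow]
  rw [h5, cexp_antiTr] at h4
  simp only [mul_left_comm _ (b T)]
  rw [← Finset.mul_sum, h4, shiftCoeff]
  linear_combination (-(b T * (((dt (imL m z) ^ α)⁻¹ : ℝ) : ℂ) *
    (Complex.exp (-negTr ((2 * Real.pi) • T.1) (imL m z)) *
      expTr ((T.1 * symOf (reL m z)).map Complex.ofReal) *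
        detD (detExp α ((4 * Real.pi) • T.1)) (imL m z)))) * h6

lemma fourierCoeff_maassShift {k : ℤ} {h : Matrix (Fin m) (Fin m) ℂ → ℂ} {b : PosHalfInt m → ℂ}
    (hF : ∀ Z ∈ siegelUpperHalfSpace m,
      HasSum (fun T : PosHalfInt m => b T * expTr (T.1.map Complex.ofReal * Z)) (h Z))
    {y : SymIdx m → ℝ} (hy : y ∈ posCone m) (T : PosHalfInt m) :
    fourierCoeff (maassShift k h) T.1 (symOf y) =
      b T * shiftCoeff ((k : ℝ) + (1 - (m : ℝ)) / 2) T.1 y := by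
  refine fourierCoeff_of_hasSum
    (a := fun T => b T * shiftCoeff ((k : ℝ) + (1 - (m : ℝ)) / 2) T.1 y) (fun x => ?_) T
  have := hasSum_maassShift (k := k) hF (xy_mem_halfSpace x hy)
  rwa [imL_xy, reL_xy, ← mkZ_symOf] at this

lemma denom_one (Z : Matrix (Fin m) (Fin m) ℂ) : denom 1 Z = 1 := by
  have h1 : (1 : SpZ m).1 = Matrix.fromBlocks 1 0 0 1 := Matrix.fromBlocks_one.symm
  rw [denom, h1, Matrix.toBlocks_fromBlocks₂₁, Matrix.toBlocks_fromBlocks₂₂,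
    Matrix.map_zero _ Int.cast_zero, Matrix.map_one _ Int.cast_zero Int.cast_one, zero_mul, zero_add]

lemma slash_one (k : ℤ) (h : Matrix (Fin m) (Fin m) ℂ → ℂ) (Z : Matrix (Fin m) (Fin m) ℂ) :
    slash k 1 h Z = h Z := by
  have h1 : (1 : SpZ m).1 = Matrix.fromBlocks 1 0 0 1 := Matrix.fromBlocks_one.symm
  have h2 : moeb 1 Z = Z := by
    rw [moeb, denom_one, h1, Matrix.toBlocks_fromBlocks₁₁, Matrix.toBlocks_fromBlocks₁₂,
      Matrix.map_zero _ Int.cast_zero, Matrix.map_one _ Int.cast_zero Int.cast_one, one_mul,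
      add_zero, inv_one, mul_one]
  rw [slash, denom_one, h2, Matrix.det_one, _root_.one_zpow, one_mul]

/-- The expansion at the cusp `∞` with `N = 1`; the translations in `Γ` make this width admissible.
-/
lemma IsCuspForm.exists_hasSum {Γ : Subgroup (SpZ m)} (hΓ : ContainsTranslations Γ) {k : ℤ}
    {h : Matrix (Fin m) (Fin m) ℂ → ℂ} (hh : IsCuspForm Γ k h) :
    ∃ b : PosHalfInt m → ℂ, ∀ Z ∈ siegelUpperHalfSpace m,
      HasSum (fun T : PosHalfInt m => b T * expTr (T.1.map Complex.ofReal * Z)) (h Z) := by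
  obtain ⟨b, hb⟩ := hh.cuspidal 1 1 one_pos fun S hS => by
    rw [one_mul, inv_one, mul_one]
    exact hΓ _ _
  refine ⟨b, fun Z hZ => ?_⟩
  have := hb Z hZ
  simpa only [slash_one, Nat.cast_one, inv_one, one_smul] using this

/-- Sturm's integrand in terms of the integrand of a Mellin transform over the cone. -/
lemma sturmIntegrand_maassShift {k : ℤ} {h : Matrix (Fin m) (Fin m) ℂ → ℂ} {b : PosHalfInt m → ℂ}
    (hF : ∀ Z ∈ siegelUpperHalfSpace m,
      HasSum (fun T : PosHalfInt m => b T * expTr (T.1.map Complex.ofReal * Z)) (h Z))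
    (T : PosHalfInt m) (s : ℂ) {y : SymIdx m → ℝ} (hy : y ∈ posCone m) :
    sturmIntegrand (k + 2) (maassShift k h) T.1 s y =
      b T * (T.1.det : ℂ) ^ (((k + 2 : ℤ) : ℂ) - ((m : ℂ) + 1) / 2 + s) *
        (detD (detExp ((k : ℝ) + (1 - (m : ℝ)) / 2) ((4 * Real.pi) • T.1)) y *
          (dt y : ℂ) ^ ((((1 - m) / 2 : ℝ) : ℂ) + s)) := by
  have hd := dt_pos hy
  have hd0 : (dt y : ℂ) ≠ 0 := by exact_mod_cast hd.ne'
  have hdet : (((T.1 * symOf y).det : ℝ) : ℂ) = ((T.1.det : ℝ) : ℂ) * ((dt y : ℝ) : ℂ) := by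
    rw [Matrix.det_mul, dt]; push_cast; rfl
  have hexp : Complex.exp (-negTr ((2 * Real.pi) • T.1) y) *
      (Real.exp (-2 * Real.pi * (T.1 * symOf y).trace) : ℂ) = 1 := by
    rw [Complex.ofReal_exp, ← Complex.exp_add, negTr_smul, negTr_apply, Complex.exp_eq_one_iff]
    exact ⟨0, by push_cast; ring⟩
  rw [sturmIntegrand, fourierCoeff_maassShift hF hy, shiftCoeff, hdet,
    Complex.mul_cpow_ofReal_nonneg T.2.1.det_pos.le hd.le]
  change _ * _ * (_ * _) * (((dt y ^ (-(((m : ℝ) + 1) / 2)) : ℝ)) : ℂ) = _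
  -- The exponents `-(k + (1-m)/2)`, `k + 2 - (m+1)/2` and `-(m+1)/2` add up to `(1-m)/2`, the zero
  -- of Cayley's constant. This is where the weight `κ = k + 2` matters.
  have hpow : (((dt y ^ ((k : ℝ) + (1 - (m : ℝ)) / 2))⁻¹ : ℝ) : ℂ) *
      (dt y : ℂ) ^ (((k + 2 : ℤ) : ℂ) - ((m : ℂ) + 1) / 2 + s) *
      (((dt y ^ (-(((m : ℝ) + 1) / 2)) : ℝ)) : ℂ) =
      (dt y : ℂ) ^ ((((1 - m) / 2 : ℝ) : ℂ) + s) := by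
    rw [← Real.rpow_neg hd.le, Complex.ofReal_cpow hd.le, Complex.ofReal_cpow hd.le,
      ← Complex.cpow_add _ _ hd0, ← Complex.cpow_add _ _ hd0]
    congr 1
    push_cast
    ring
  rw [← hpow]
  linear_combination (b T * (((dt y ^ ((k : ℝ) + (1 - (m : ℝ)) / 2))⁻¹ : ℝ) : ℂ) *
    detD (detExp ((k : ℝ) + (1 - (m : ℝ)) / 2) ((4 * Real.pi) • T.1)) y *
    (T.1.det : ℂ) ^ (((k + 2 : ℤ) : ℂ) - ((m : ℂ) + 1) / 2 + s) *
    (dt y : ℂ) ^ (((k + 2 : ℤ) : ℂ) - ((m : ℂ) + 1) / 2 + s) *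
      (((dt y ^ (-(((m : ℝ) + 1) / 2)) : ℝ)) : ℂ)) * hexp

lemma sturmCoeffAt_maassShift {k : ℤ} {h : Matrix (Fin m) (Fin m) ℂ → ℂ} {b : PosHalfInt m → ℂ}
    (hF : ∀ Z ∈ siegelUpperHalfSpace m,
      HasSum (fun T : PosHalfInt m => b T * expTr (T.1.map Complex.ofReal * Z)) (h Z))
    (T : PosHalfInt m) (s : ℂ) :
    sturmCoeffAt (k + 2) (maassShift k h) T.1 s =
      ((sturmConst m (k + 2))⁻¹ : ℝ) *
        (b T * (T.1.det : ℂ) ^ (((k + 2 : ℤ) : ℂ) - ((m : ℂ) + 1) / 2 + s) *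
          coneMellin (detD (detExp ((k : ℝ) + (1 - (m : ℝ)) / 2) ((4 * Real.pi) • T.1)))
            ((((1 - m) / 2 : ℝ) : ℂ) + s)) := by
  rw [sturmCoeffAt, coneMellin, setIntegral_congr_fun measurableSet_posCone fun y hy =>
    sturmIntegrand_maassShift hF T s hy, integral_const_mul]

end Expansion

end

end SiegelSturm


/-! ### Vanishing of Sturm's coefficients -/

open SiegelSturm

theorem corollary3p4 (m : ℕ) (hm : 1 ≤ m) (k : ℤ) (hk : (m : ℤ) ≤ k)
    (Γ : Subgroup (SiegelSturm.SpZ m)) (hΓ : SiegelSturm.ContainsTranslations Γ)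
    (h : Matrix (Fin m) (Fin m) ℂ → ℂ) (hh : SiegelSturm.IsCuspForm Γ k h) :
    (∀ Z ∈ SiegelSturm.siegelUpperHalfSpace m,
      HasSum (fun T : SiegelSturm.PosHalfInt m =>
        SiegelSturm.fourierCoeff (SiegelSturm.maassShift k h) T.1 (SiegelSturm.imPart Z) *
          SiegelSturm.expTr ((T.1 * SiegelSturm.rePart Z).map Complex.ofReal))
        (SiegelSturm.maassShift k h Z)) ∧
    ∀ T : SiegelSturm.PosHalfInt m,
      (∀ᶠ s in 𝓝 (0 : ℂ), IntegrableOn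
        (SiegelSturm.sturmIntegrand (k + 2) (SiegelSturm.maassShift k h) T.1 s)
        (SiegelSturm.posCone m)) ∧
      SiegelSturm.sturmCoeff (k + 2) (SiegelSturm.maassShift k h) T.1 = 0 ∧
      Tendsto (SiegelSturm.sturmCoeffAt (k + 2) (SiegelSturm.maassShift k h) T.1)
        (𝓝 0) (𝓝 0) := by
  obtain ⟨b, hF⟩ := hh.exists_hasSum hΓ
  have hm' : (0 : ℝ) < m := by exact_mod_cast hm
  have hk' : (m : ℝ) ≤ k := by exact_mod_cast hk
  refine ⟨fun Z hZ => ?_, fun T => ?_⟩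
  · have hz : upper Z ∈ halfSpace m := by
      change symOf (upper Z) ∈ siegelUpperHalfSpace m
      rwa [symOf_upper hZ.1]
    have h1 := hasSum_maassShift (k := k) hF hz
    rw [← symOf_upper hZ.1, imPart_symOf, rePart_symOf]
    refine h1.congr_fun fun T => ?_
    rw [fourierCoeff_maassShift hF (mem_halfSpace.mp hz)]
  · set α : ℝ := (k : ℝ) + (1 - (m : ℝ)) / 2 with hα
    have hA : ((4 * Real.pi) • T.1).PosDef := T.2.1.smul (by positivity)
    have hcont := continuousOn_detD_detExp α ((4 * Real.pi) • T.1)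
    have hbound := coneBound_detD_detExp α hA.posSemidef
    -- At `s = 0` the total exponent of the determinant is `α - 1 + (1-m)/2 = k - m ≥ 0`, which
    -- leaves room for convergence down to `Re s > -1/m`.
    have hre : ∀ s : ℂ, -1 / m < s.re → -1 < m * (α - 1 + ((((1 - m) / 2 : ℝ) : ℂ) + s).re) := by
      intro s hs
      rw [Complex.add_re, Complex.ofReal_re, hα]
      rw [div_lt_iff₀ hm'] at hs
      nlinarith
    have h0 : sturmCoeffAt (k + 2) (maassShift k h) T.1 0 = 0 := by
      rw [sturmCoeffAt_maassShift hF, add_zero ((((1 - m) / 2 : ℝ) : ℂ)),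
        coneMellin_detD_eq_zero (by omega) hA (by linarith), mul_zero, mul_zero]
    refine ⟨?_, h0, ?_⟩
    · have hev : ∀ᶠ s in 𝓝 (0 : ℂ), -1 / (m : ℝ) < s.re :=
        Complex.continuous_re.continuousAt.eventually
          (lt_mem_nhds (by rw [Complex.zero_re]; exact div_neg_of_neg_of_pos (by norm_num) hm'))
      filter_upwards [hev] with s hs
      exact IntegrableOn.congr_fun ((hbound.integrableOn_mul_cpow (by omega) hA hcont
        (hre s hs)).const_mul _) (fun y hy => (sturmIntegrand_maassShift hF T s hy).symm)
        measurableSet_posCone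
    · have hd : ContinuousAt (sturmCoeffAt (k + 2) (maassShift k h) T.1) 0 := by
        have h1 : ContinuousAt (coneMellin (detD (detExp α ((4 * Real.pi) • T.1))))
            ((((1 - m) / 2 : ℝ) : ℂ) + 0) :=
          (hbound.differentiableAt_coneMellin (by omega) hA hcont (hre 0 (by
            rw [Complex.zero_re]; exact div_neg_of_neg_of_pos (by norm_num) hm'))).continuousAt
        have h2 : ContinuousAt (fun s : ℂ => coneMellin (detD (detExp α ((4 * Real.pi) • T.1)))
            ((((1 - m) / 2 : ℝ) : ℂ) + s)) 0 :=
          ContinuousAt.comp (g := coneMellin (detD (detExp α ((4 * Real.pi) • T.1))))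
            (f := fun s : ℂ => (((1 - m) / 2 : ℝ) : ℂ) + s) h1 (by fun_prop)
        have h3 : ContinuousAt (fun s : ℂ =>
            (T.1.det : ℂ) ^ (((k + 2 : ℤ) : ℂ) - ((m : ℂ) + 1) / 2 + s)) 0 :=
          ContinuousAt.const_cpow (by fun_prop) (Or.inl (by exact_mod_cast T.2.1.det_pos.ne'))
        have h4 : sturmCoeffAt (k + 2) (maassShift k h) T.1 = fun s =>
            ((sturmConst m (k + 2))⁻¹ : ℝ) *
              (b T * (T.1.det : ℂ) ^ (((k + 2 : ℤ) : ℂ) - ((m : ℂ) + 1) / 2 + s) *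
                coneMellin (detD (detExp α ((4 * Real.pi) • T.1)))
                  ((((1 - m) / 2 : ℝ) : ℂ) + s)) :=
          funext fun s => sturmCoeffAt_maassShift hF T s
        rw [h4]
        exact continuousAt_const.mul ((continuousAt_const.mul h3).mul h2)
      have := hd.tendsto
      rwa [h0] at this
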